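/- **Setting.** For a Polish space $E$ let $D_E$ be the space of right-continuous paths $[0,\infty)\to E$ with left limits, with coordinate process $X$, shifts $\theta_t$ and the $\sigma$-algebra generated by the coordinates. Let $\mathbb F^0$ be the raw filtration of $X$, $\mathbb F$ its right-continuous hull and $\mathcal T_E$ the set of bounded $\mathbb F$-stopping times. For a random time $\tau$, let $\omega*_\tau\omega'$ be the path that equals $\omega$ before $\tau(\omega)$ and $\omega'_{t-\tau(\omega)}$ at times $t\ge\tau(\omega)$; for a probability $\mu$ on $D_E$ and a universally measurable kernel $\nu$ from $E$ to $D_E$ let $\mu*_\tau\nu$ be the law $A\mapsto\iint 1_A(\omega*_\tau\omega')\,\nu_{X_\tau(\omega)}(d\omega')\,\mu(d\omega)$ (with $\omega*_\tau\omega'=\omega$ if $\tau(\omega)=\infty$). For a family $\mathcal P=(\mathcal P^x)_{x\in E}$ of sets of probabilities on $D_E$, let $\mathcal S(\mathcal P)$ be the set of universally measurable kernels $\nu$ with $\nu_x\in\mathcal P^x$ for all $x$. A Borel function $G:D_E\to[-\infty,\infty]$ with $\mathbb E^\mu[G^-]<\infty$ for all $\mu\in\bigcup_x\mathcal P^x$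 is *$(\mathcal P,\mathcal T)$-disintegrable* if 1. (tail property) for all $x$, $\mu\in\mathcal P^x$, $\nu\in\mathcal S(\mathcal P)$, $\tau\in\mathcal T$, $$\mathbb E^{\mu*_\tau\nu}[G]=\mathbb E^\mu\big[g(X_\tau)1_{\{\tau<\infty\}}+G\,1_{\{\tau=\infty\}}\big],\qquad g(y)=\mathbb E^{\nu_y}[G],$$ where the negative parts on both sides are integrable; and 2. for all $x$, $\mu\in\mathcal P^x$, $\tau\in\mathcal T$ there is $\nu\in\mathcal S(\mathcal P)$ with $\mathbb E^{\mu*_\tau\nu}[G]\le\mathbb E^\mu[G]$. **Market.** Let $E=[0,\infty)\times\mathbb R^d\times F$ with $F$ a locally compact Hausdorff space with a countable base, and write $X=(T,S,\eta)$ for the coordinate process on $D_E$. Let $(\mathbb P^x)_{x\in E}$ be probabilities on $D_E$, Borel measurable in $x$, such that * $\mathbb P^x[X_0=x]=1$, and $\mathbb E^x[Y\circ\theta_\tau\mid\mathcal F_\tau]=\mathbb E^{X_\tau}[Y]$, $\mathbb P^x$-a.s., for all $x\in E$, all $\tau\in\mathcal T_E$ and all bounded Borel $Y$; * (finite horizon)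 $T_t=T_0-t$ for $t\le T_0$, $\mathbb P^x$-a.s. for all $x$, and for $x\in\{0\}\times\mathbb R^d\times F$ the law $\mathbb P^x$ is the Dirac mass at the constant path $x$; * (no arbitrage) for every $x$, the set $\mathcal M^x$ of probabilities $\mathbb Q$ equivalent to $\mathbb P^x$ under which $S$ is an $\mathbb F^0$-local martingale is non-empty; * (uniform local boundedness from below) for each $n\in\mathbb N$ there is $a_n\in\mathbb R$ such that, with $\tau_n=\inf\{t\ge0:|S_t|\ge n\}$, for every $x=(T,s,\eta)\in E$ with $|s|<n$ all coordinates of $S^{\tau_n}$ are bounded from below by $a_n$, $\mathbb P^x$-a.s. Let $\tilde E=E\times[0,\infty)$. For $x\in E$ and $\mathbb Q\in\mathcal M^x$, let $Z^{\mathbb Q}$ be a right-continuous version with left limits of $t\mapsto\mathbb E^x[d\mathbb Q/d\mathbb P^x\mid\mathcal F_t]$; for $(x,z)\in\tilde E$ let $\tilde{\mathcal P}^{x,z}$ be the set of the $\mathbb P^x$-laws on $D_{\tilde E}$ of $(X,zZ^{\mathbb Q})$, $\mathbb Q\in\mathcal M^x$. **Proposition.** Let $G:D_{\tilde E}\to[-\infty,\infty]$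 be a Borel function such that $\mathbb E^\mu[G^-]<\infty$ for all $\mu\in\bigcup_{(x,z)\in\tilde E}\tilde{\mathcal P}^{x,z}$ and $G\circ\theta_t=G$ for all $t\ge0$. Then $G$ is $(\tilde{\mathcal P},\mathcal T_{\tilde E})$-disintegrable. -/

import Mathlib

open MeasureTheory ProbabilityTheory Filter Topology Set
open scoped NNReal ENNReal

noncomputable section

namespace DPP

/-! ### The path space -/

/-- A path on `[0, ∞)` is RCLL if it is right-continuous and has left limits in `E`. -/
def IsRCLL {E : Type*} [TopologicalSpace E] (f : ℝ≥0 → E) : Prop :=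
  ∀ t, ContinuousWithinAt f (Ici t) t ∧ ∃ l, Tendsto f (𝓝[<] t) (𝓝 l)

/-- The space `D_E` of RCLL paths `[0, ∞) → E`. -/
def PathSpace (E : Type*) [TopologicalSpace E] : Type _ := {f : ℝ≥0 → E // IsRCLL f}

/-- The σ-algebra on `D_E` generated by the coordinate maps (the Borel σ-algebra of the Skorokhod
topology, when `E` is Polish). -/
instance {E : Type*} [TopologicalSpace E] [MeasurableSpace E] : MeasurableSpace (PathSpace E) :=
  inferInstanceAs (MeasurableSpace {f : ℝ≥0 → E // IsRCLL f})

/-- The coordinate process. -/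
def coord {E : Type*} [TopologicalSpace E] (t : ℝ≥0) (ω : PathSpace E) : E := ω.1 t

theorem measurable_coord {E : Type*} [TopologicalSpace E] [MeasurableSpace E] (t : ℝ≥0) :
    Measurable (coord (E := E) t) :=
  (measurable_pi_apply t).comp measurable_subtype_coe

theorem tendsto_add_left (s t : ℝ≥0) : Tendsto (fun u : ℝ≥0 => u + t) (𝓝[<] s) (𝓝[<] (s + t)) := by
  refine tendsto_nhdsWithin_iff.2 ⟨?_, ?_⟩
  · exact ((continuous_id.add continuous_const).tendsto s).mono_left nhdsWithin_le_nhds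
  · filter_upwards [self_mem_nhdsWithin] with u hu
    have hu' : u < s := hu
    simpa using hu'

theorem tendsto_sub_left {s t : ℝ≥0} (h : t < s) :
    Tendsto (fun u : ℝ≥0 => u - t) (𝓝[<] s) (𝓝[<] (s - t)) := by
  refine tendsto_nhdsWithin_iff.2 ⟨?_, ?_⟩
  · exact ((continuous_id.sub continuous_const).tendsto s).mono_left nhdsWithin_le_nhds
  · filter_upwards [self_mem_nhdsWithin] with u hu
    exact (tsub_lt_tsub_iff_right_of_le_of_le hu h)
where
  tsub_lt_tsub_iff_right_of_le_of_le {u s t : ℝ≥0} (hu : u < s) (h : t < s) : u - t < s - t := by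
    rcases le_total u t with h' | h'
    · simpa [tsub_eq_zero_of_le h'] using h
    · exact tsub_lt_tsub_right_of_le h' hu

/-- The constant path. -/
def constPath {E : Type*} [TopologicalSpace E] (x : E) : PathSpace E :=
  ⟨fun _ => x, fun _ => ⟨continuousWithinAt_const, x, tendsto_const_nhds⟩⟩

/-- The shift operator `θ_t`: `X_s (θ_t ω) = X_{s+t} ω`. -/
def shift {E : Type*} [TopologicalSpace E] (t : ℝ≥0) (ω : PathSpace E) : PathSpace E :=
  ⟨fun s => ω.1 (s + t), fun s => by
    obtain ⟨hr, l, hl⟩ := ω.2 (s + t)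
    refine ⟨?_, l, hl.comp (tendsto_add_left s t)⟩
    refine ContinuousWithinAt.comp (f := fun u : ℝ≥0 => u + t) (t := Ici (s + t)) hr
      (continuous_id.add continuous_const).continuousWithinAt ?_
    intro u hu
    have hu' : s ≤ u := hu
    simpa using hu'⟩

/-- The concatenation of two paths at the time `t`: it follows `ω` before `t` and `ω'`
(run from time `0`) from `t` on. -/
def concatPath {E : Type*} [TopologicalSpace E] (t : ℝ≥0) (ω ω' : PathSpace E) : PathSpace E :=
  ⟨fun s => if s < t then ω.1 s else ω'.1 (s - t), fun s => by
    rcases lt_or_ge s t with hs | hs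
    · have he : (fun s => if s < t then ω.1 s else ω'.1 (s - t)) =ᶠ[𝓝 s] ω.1 := by
        filter_upwards [Iio_mem_nhds hs] with u hu
        exact if_pos hu
      obtain ⟨hr, l, hl⟩ := ω.2 s
      exact ⟨hr.congr_of_eventuallyEq (he.filter_mono nhdsWithin_le_nhds) he.eq_of_nhds, l,
        hl.congr' (he.filter_mono nhdsWithin_le_nhds).symm⟩
    · refine ⟨?_, ?_⟩
      · have hc : ContinuousWithinAt (fun u => ω'.1 (u - t)) (Ici s) s :=
          ContinuousWithinAt.comp (f := fun u : ℝ≥0 => u - t) (t := Ici (s - t)) (ω'.2 (s - t)).1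
            (continuous_id.sub continuous_const).continuousWithinAt
            (fun u hu => tsub_le_tsub_right (show s ≤ u from hu) t)
        exact hc.congr (fun u hu => if_neg (not_lt.2 (hs.trans hu))) (if_neg (not_lt.2 hs))
      · rcases hs.eq_or_lt with rfl | hs
        · obtain ⟨-, l, hl⟩ := ω.2 t
          refine ⟨l, hl.congr' ?_⟩
          filter_upwards [self_mem_nhdsWithin] with u hu
          exact (if_pos hu).symm
        · obtain ⟨-, l, hl⟩ := ω'.2 (s - t)
          refine ⟨l, (hl.comp (tendsto_sub_left hs)).congr' ?_⟩
          filter_upwards [mem_nhdsWithin_of_mem_nhds (Ioi_mem_nhds hs)] with u hu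
          exact (if_neg (not_lt.2 (le_of_lt hu))).symm⟩

/-! ### Filtrations and random times -/

/-- The raw filtration `𝔽⁰` generated by the coordinate process. -/
def rawFiltration (E : Type*) [TopologicalSpace E] [MeasurableSpace E] :
    Filtration ℝ≥0 (inferInstance : MeasurableSpace (PathSpace E)) where
  seq t := ⨆ s ≤ t, MeasurableSpace.comap (coord s) inferInstance
  mono' _ _ h := biSup_mono fun _ hs => hs.trans h
  le' _ := iSup₂_le fun s _ => (measurable_coord s).comap_le

/-- The right-continuous hull `𝔽` of the raw filtration. -/
def hullFiltration (E : Type*) [TopologicalSpace E] [MeasurableSpace E] :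
    Filtration ℝ≥0 (inferInstance : MeasurableSpace (PathSpace E)) :=
  (rawFiltration E).rightCont

/-- The set of bounded `𝔽`-stopping times. -/
def boundedStoppingTimes (E : Type*) [TopologicalSpace E] [MeasurableSpace E] :
    Set (PathSpace E → WithTop ℝ≥0) :=
  {τ | IsStoppingTime (hullFiltration E) τ ∧ ∃ C : ℝ≥0, ∀ ω, τ ω ≤ C}

/-- The position `X_τ`, used on `{τ < ∞}` only. -/
def positionAt {E : Type*} [TopologicalSpace E] (τ : PathSpace E → WithTop ℝ≥0)
    (ω : PathSpace E) : E :=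
  coord ((τ ω).untopD 0) ω

/-! ### Kernels, concatenation of laws, disintegrability -/

/-- Universal measurability: measurability with respect to the completion of the σ-algebra under
every probability measure. -/
def UniversallyMeasurable {α β : Type*} [MeasurableSpace α] [MeasurableSpace β] (f : α → β) : Prop :=
  ∀ m : Measure α, IsProbabilityMeasure m → NullMeasurable f m

/-- The set of universally measurable kernels `ν` with `ν x ∈ Fam x` for all `x`
(the `Fam`-selectors). -/
def Selectors {E : Type*} [TopologicalSpace E] [MeasurableSpace E]
    (Fam : E → Set (Measure (PathSpace E))) : Set (E → Measure (PathSpace E)) :=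
  {ν | (∀ x, ν x ∈ Fam x) ∧ ∀ A, MeasurableSet A → UniversallyMeasurable fun x => ν x A}

/-- The concatenation `μ *_τ ν`, i.e. the measure
`A ↦ ∫∫ 1_A(ω *_{τ(ω)} ω') ν_{X_τ(ω)}(dω') μ(dω)`, where `ω *_∞ ω' = ω`. -/
def concatLaw {E : Type*} [TopologicalSpace E] [MeasurableSpace E]
    (μ : Measure (PathSpace E)) (τ : PathSpace E → WithTop ℝ≥0)
    (ν : E → Measure (PathSpace E)) : Measure (PathSpace E) :=
  open Classical in
  μ.bind fun ω => if τ ω = ⊤ then Measure.dirac ω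
    else (ν (positionAt τ ω)).map (concatPath ((τ ω).untopD 0) ω)

/-- `𝔼^μ[G⁻] < ∞`. -/
def NegPartIntegrable {Ω : Type*} [MeasurableSpace Ω] (μ : Measure Ω) (G : Ω → EReal) : Prop :=
  ∫⁻ ω, (-G ω).toENNReal ∂μ < ⊤

/-- The extended expectation `𝔼^μ[G⁺] - 𝔼^μ[G⁻]`, meaningful if `𝔼^μ[G⁻] < ∞`. -/
def expect {Ω : Type*} [MeasurableSpace Ω] (μ : Measure Ω) (G : Ω → EReal) : EReal :=
  ((∫⁻ ω, (G ω).toENNReal ∂μ : ℝ≥0∞) : EReal) - ((∫⁻ ω, (-G ω).toENNReal ∂μ : ℝ≥0∞) : EReal)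

/-- The random variable `g(X_τ) 1_{τ<∞} + G 1_{τ=∞}` with `g(x) = 𝔼^{ν_x}[G]`. -/
def tailValue {E : Type*} [TopologicalSpace E] [MeasurableSpace E]
    (τ : PathSpace E → WithTop ℝ≥0) (ν : E → Measure (PathSpace E)) (G : PathSpace E → EReal)
    (ω : PathSpace E) : EReal :=
  open Classical in
  if τ ω = ⊤ then G ω else expect (ν (positionAt τ ω)) G

/-- Tail random variables. The two integrability clauses in `tail` say that both sides of
the identity are well-defined. -/
structure IsTail {E : Type*} [TopologicalSpace E] [MeasurableSpace E]
    (Fam : E → Set (Measure (PathSpace E))) (Tms : Set (PathSpace E → WithTop ℝ≥0))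
    (G : PathSpace E → EReal) : Prop where
  measurable : Measurable G
  lowerSemiIntegrable : ∀ x, ∀ μ ∈ Fam x, NegPartIntegrable μ G
  tail : ∀ x, ∀ μ ∈ Fam x, ∀ ν ∈ Selectors Fam, ∀ τ ∈ Tms,
    NegPartIntegrable (concatLaw μ τ ν) G ∧ NegPartIntegrable μ (tailValue τ ν G) ∧
      expect (concatLaw μ τ ν) G = expect μ (tailValue τ ν G)

/-- Disintegrable random variables. -/
structure IsDisintegrable {E : Type*} [TopologicalSpace E] [MeasurableSpace E]
    (Fam : E → Set (Measure (PathSpace E))) (Tms : Set (PathSpace E → WithTop ℝ≥0))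
    (G : PathSpace E → EReal) : Prop where
  isTail : IsTail Fam Tms G
  disint : ∀ x, ∀ μ ∈ Fam x, ∀ τ ∈ Tms, ∃ ν ∈ Selectors Fam,
    expect (concatLaw μ τ ν) G ≤ expect μ G

/-! ### The market model -/

/-- The state space `E = [0, ∞) × ℝ^d × F`, with points `(T, S, η)`. -/
abbrev State (d : ℕ) (F : Type*) : Type _ := ℝ≥0 × EuclideanSpace ℝ (Fin d) × F

section Market

variable {d : ℕ} {F : Type*} [TopologicalSpace F] [MeasurableSpace F]

/-- The time-to-go process `T`. -/
def timeToGo (t : ℝ≥0) (ω : PathSpace (State d F)) : ℝ≥0 := (coord t ω).1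

/-- The asset-price process `S`. -/
def price (t : ℝ≥0) (ω : PathSpace (State d F)) : EuclideanSpace ℝ (Fin d) := (coord t ω).2.1

/-- Canonical strong Markov families (the Borel measurability of `x ↦ P x` and the fact that every
`P x` is a probability are part of `Kernel` and `IsMarkovKernel`). -/
structure IsStrongMarkovFamily (P : Kernel (State d F) (PathSpace (State d F))) : Prop where
  start : ∀ x, ∀ᵐ ω ∂P x, coord 0 ω = x
  markov : ∀ (τ : PathSpace (State d F) → WithTop ℝ≥0)
    (hτ : IsStoppingTime (hullFiltration (State d F)) τ), (∃ C : ℝ≥0, ∀ ω, τ ω ≤ C) →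
    ∀ x, ∀ Y : PathSpace (State d F) → ℝ, Measurable Y → (∃ C : ℝ, ∀ ω, |Y ω| ≤ C) →
      (P x)[fun ω => Y (shift ((τ ω).untopD 0) ω) | hτ.measurableSpace]
        =ᵐ[P x] fun ω => ∫ ω', Y ω' ∂(P (positionAt τ ω))

/-- Finite horizon: `T_t = T_0 - t` for `t ≤ T_0`, and `{T = 0}` is absorbing. -/
structure FiniteHorizon (P : Kernel (State d F) (PathSpace (State d F))) : Prop where
  clock : ∀ x, ∀ᵐ ω ∂P x, ∀ t ≤ timeToGo 0 ω, timeToGo t ω = timeToGo 0 ω - t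
  absorbing : ∀ x : State d F, x.1 = 0 → P x = Measure.dirac (constPath x)

/-- `S` is a `(Q, 𝔽⁰)`-local martingale. -/
def IsLocalMartingalePrice (Q : Measure (PathSpace (State d F))) : Prop :=
  Locally (fun Y : ℝ≥0 → PathSpace (State d F) → EuclideanSpace ℝ (Fin d) =>
    Martingale Y (rawFiltration (State d F)) Q) (rawFiltration (State d F)) price Q

/-- The set `ℳ^x` of equivalent local-martingale measures. -/
def martingaleMeasures (P : Kernel (State d F) (PathSpace (State d F))) (x : State d F) :
    Set (Measure (PathSpace (State d F))) :=
  {Q | IsProbabilityMeasure Q ∧ Q ≪ P x ∧ P x ≪ Q ∧ IsLocalMartingalePrice Q}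

/-- Absence of arbitrage: every `ℳ^x` is non-empty. -/
def NFLVR (P : Kernel (State d F) (PathSpace (State d F))) : Prop :=
  ∀ x, (martingaleMeasures P x).Nonempty

/-- `τ_n = inf {t ≥ 0 : |S_t| ≥ n}`. -/
def priceHitting (d : ℕ) (F : Type*) [TopologicalSpace F] (n : ℕ) :
    PathSpace (State d F) → WithTop ℝ≥0 :=
  hittingAfter price {s | (n : ℝ) ≤ ‖s‖} 0

/-- Uniform local boundedness from below: the stopped process `S^{τ_n}` is bounded from below by a
constant `a_n`, for all initial states with `|S_0| < n` (for the others, `τ_n = 0`). -/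
def UniformlyLocallyBoundedBelow (P : Kernel (State d F) (PathSpace (State d F))) : Prop :=
  ∀ n : ℕ, ∃ a : ℝ, ∀ x : State d F, ‖x.2.1‖ < n →
    ∀ᵐ ω ∂P x, ∀ (t : ℝ≥0) (i : Fin d), a ≤ stoppedProcess price (priceHitting d F n) t ω i

/-! ### The augmented family -/

/-- `Z` is an RCLL version of the density process
`Z^Q_t = 𝔼^x[dQ/dP^x | 𝓕_t]`; here `Px` is `P^x`. -/
structure IsDensityProcess (Px Q : Measure (PathSpace (State d F)))
    (Z : PathSpace (State d F) → PathSpace ℝ≥0) : Prop where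
  measurable : Measurable Z
  version : ∀ t, (fun ω => ((coord t (Z ω) : ℝ≥0) : ℝ)) =ᵐ[Px]
    Px[fun ω => (Q.rnDeriv Px ω).toReal | hullFiltration (State d F) t]

/-- The path `t ↦ (ω_t, z ζ_t)`. -/
def augment {E : Type*} [TopologicalSpace E] (z : ℝ≥0) (ω : PathSpace E) (ζ : PathSpace ℝ≥0) :
    PathSpace (E × ℝ≥0) :=
  ⟨fun t => (ω.1 t, z * ζ.1 t), fun t => by
    obtain ⟨h, l, hl⟩ := ω.2 t
    obtain ⟨h', l', hl'⟩ := ζ.2 t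
    exact ⟨h.prodMk (continuousWithinAt_const.mul h'), (l, z * l'),
      hl.prodMk_nhds (tendsto_const_nhds.mul hl')⟩⟩

/-- The family `P̃^{x,z}` of the `P^x`-laws of `(X, z Z^Q)`, for `Q ∈ ℳ^x`. -/
def augmentedFamily (P : Kernel (State d F) (PathSpace (State d F))) (y : State d F × ℝ≥0) :
    Set (Measure (PathSpace (State d F × ℝ≥0))) :=
  {μ | ∃ Q ∈ martingaleMeasures P y.1, ∃ Z, IsDensityProcess (P y.1) Q Z ∧
    μ = (P y.1).map fun ω => augment y.2 ω (Z ω)}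

end Market

end DPP

end

noncomputable section

set_option linter.unusedSectionVars false

namespace DPP

/-! ### Regular functions on the nonnegative rationals -/

/-! The finite horizon drives the proof. Started at `x`, the path is almost surely constant from
time `x.1` on, so the density process equals `dQ/dP^x` from then on. A shift-invariant `G` therefore
sees only the path and the terminal weight: almost surely `G(X, zZ^Q)` is `terminal G X (z ·
dQ/dP^x)` (`terminal_of_eventually`, `IsDensityProcess.lintegral_augment`). Statements about
augmented laws become statements about densities under `P^x`, to which the strong Markov property
applies in the form `lintegral_shift`.

Tail property. A shift-invariant functional of a concatenated path depends on the second path only,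
so the identity is Fubini once the negative part is known to be integrable (`expect_concatLaw`).
Integrability is assumed only for members of the family, so the integral has to be recognised as one
taken under such a member. If `z ≠ 0`, the selector determines martingale measures; pasting `Q` with
them at `τ` gives an element of `ℳ^x` again (`exists_paste_mem`), and its density is `Z_τ` times the
density of the future (`lintegral_paste_density`). If `z = 0`, the weight vanishes identically, `Q`
plays no role, and the Markov property suffices.

Disintegration. By Bayes' formula the conditional law under `Q` of the future given the past belongs
to `ℳ^{X_τ}` for almost every past (`ae_futureLaw_mem`). It depends on the whole past, whereas a
selector may depend on `(X_τ, zZ_τ)` only. But almost every set of pasts with a common augmented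
state contains a past whose conditional value is at most the average over that set
(`exists_fiber_le`), and the weights fit: `zZ_τ` times the normalised future density is `z ·
dQ/dP^x`. The pairs of a state and a martingale measure satisfying this inequality form a Borel set
with non-empty sections, absence of arbitrage serving the exceptional null set, and the Jankov–von
Neumann theorem provides the selector (`exists_selector_le`).

Pasting, conditioning and the Borel property of `ℳ` all rest on one description of local martingale
measures. Let `S^n` be the price stopped when its running supremum of norms reaches `n`. Then
`|S^n_s| ≤ n + |S^n_t|` in each coordinate for `s ≤ t`, and `S^n` is bounded below by `a n`; Fatou
and dominated convergence turn the local martingale property into equalities of Lebesgue integrals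
of the non-negative excess `S^n - a n` (`SlackMartingale`), and countably many of them suffice
(`slackMartingale_of_rat`). The constants do not depend on the initial state, so the same test works
before and after `τ`: if `S` has not left the ball of radius `n` by time `τ`, then `|S_τ| < n`.

Two auxiliary constructions support this: density processes jointly measurable in a parameter
(`isDensityProcess_densityPath`), and the replacement of stopping times of the augmented path by
almost surely equal stopping times of the original one (`exists_stoppingTime_ae_eq`). -/

theorem exists_nnrat_between {a b : ℝ≥0} (h : a < b) : ∃ q : ℚ≥0, a < q ∧ (q : ℝ≥0) < b := by
  obtain ⟨q, hq, hq'⟩ := exists_rat_btwn (NNReal.coe_lt_coe.2 h)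
  have h0 : (0 : ℚ) ≤ q := by exact_mod_cast a.2.trans hq.le
  refine ⟨⟨q, h0⟩, ?_, ?_⟩
  · rw [← NNReal.coe_lt_coe]; exact hq
  · rw [← NNReal.coe_lt_coe]; exact hq'

/-- The filter of rationals decreasing strictly to `t`. -/
def rightFilter (t : ℝ≥0) : Filter ℚ≥0 := comap (fun q : ℚ≥0 => (q : ℝ≥0)) (𝓝[>] t)

/-- The filter of rationals increasing strictly to `t`. -/
def leftFilter (t : ℝ≥0) : Filter ℚ≥0 := comap (fun q : ℚ≥0 => (q : ℝ≥0)) (𝓝[<] t)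

instance (t : ℝ≥0) : (rightFilter t).IsCountablyGenerated := by
  unfold rightFilter; infer_instance

theorem mem_rightFilter {t : ℝ≥0} {s : Set ℚ≥0} :
    s ∈ rightFilter t ↔ ∃ u > t, ∀ q : ℚ≥0, t < q → (q : ℝ≥0) < u → q ∈ s := by
  rw [rightFilter, ((nhdsGT_basis t).comap _).mem_iff]
  exact exists_congr fun u => and_congr_right fun _ =>
    ⟨fun h q hq hq' => h ⟨hq, hq'⟩, fun h q hq => h q hq.1 hq.2⟩

theorem mem_leftFilter {t : ℝ≥0} (ht : 0 < t) {s : Set ℚ≥0} :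
    s ∈ leftFilter t ↔ ∃ u < t, ∀ q : ℚ≥0, u < q → (q : ℝ≥0) < t → q ∈ s := by
  rw [leftFilter, ((nhdsLT_basis_of_exists_lt ⟨0, ht⟩).comap _).mem_iff]
  exact exists_congr fun u => and_congr_right fun _ =>
    ⟨fun h q hq hq' => h ⟨hq, hq'⟩, fun h q hq => h q hq.1 hq.2⟩

instance (t : ℝ≥0) : (rightFilter t).NeBot := by
  refine ⟨fun h => ?_⟩
  obtain ⟨u, hu, h⟩ := mem_rightFilter.1 (h ▸ mem_bot : (∅ : Set ℚ≥0) ∈ rightFilter t)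
  obtain ⟨q, hq, hq'⟩ := exists_nnrat_between hu
  exact h q hq hq'

theorem leftFilter_neBot {t : ℝ≥0} (ht : 0 < t) : (leftFilter t).NeBot := by
  refine ⟨fun h => ?_⟩
  obtain ⟨u, hu, h⟩ := (mem_leftFilter ht).1 (h ▸ mem_bot : (∅ : Set ℚ≥0) ∈ leftFilter t)
  obtain ⟨q, hq, hq'⟩ := exists_nnrat_between hu
  exact h q hq hq'

theorem leftFilter_zero : leftFilter 0 = ⊥ := by
  rw [leftFilter, show (Iio (0 : ℝ≥0)) = ∅ by ext; simp, nhdsWithin_empty, comap_bot]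

/-- One-sided limits along the rationals exist at all times. -/
def IsReg {E : Type*} [TopologicalSpace E] (f : ℚ≥0 → E) : Prop :=
  ∀ t, (∃ l, Tendsto f (rightFilter t) (𝓝 l)) ∧ ∃ l, Tendsto f (leftFilter t) (𝓝 l)

section Regularize

variable {E : Type*} [TopologicalSpace E]

theorem tendsto_right_of_rcll (ω : PathSpace E) (t : ℝ≥0) :
    Tendsto (fun q : ℚ≥0 => ω.1 q) (rightFilter t) (𝓝 (ω.1 t)) :=
  ((ω.2 t).1.mono_left (nhdsWithin_mono _ Ioi_subset_Ici_self)).comp tendsto_comap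

theorem isReg_of_rcll (ω : PathSpace E) : IsReg fun q : ℚ≥0 => ω.1 q := fun t =>
  ⟨⟨_, tendsto_right_of_rcll ω t⟩, (ω.2 t).2.imp fun _ hl => hl.comp tendsto_comap⟩

/-- In a regular space closed neighbourhoods form a basis, and a closed set that contains `f` on a
rational interval contains every right limit taken inside it. This passes both one-sided limits from
`f` to `g`. -/
theorem isRCLL_of_tendsto [RegularSpace E] {f : ℚ≥0 → E} (hf : IsReg f) {g : ℝ≥0 → E}
    (hg : ∀ t, Tendsto f (rightFilter t) (𝓝 (g t))) : IsRCLL g := by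
  intro t
  constructor
  · rw [ContinuousWithinAt, (closed_nhds_basis (g t)).tendsto_right_iff]
    rintro V ⟨hV, hVc⟩
    obtain ⟨u, hu, h⟩ := mem_rightFilter.1 (hg t hV)
    filter_upwards [Ico_mem_nhdsGE hu] with s hs
    refine hVc.mem_of_tendsto (hg s) (mem_rightFilter.2 ⟨u, hs.2, fun q hq hq' => ?_⟩)
    exact h q (hs.1.trans_lt hq) hq'
  · obtain ⟨l, hl⟩ := (hf t).2
    refine ⟨l, ?_⟩
    rcases eq_zero_or_pos t with rfl | ht
    · rw [show (Iio (0 : ℝ≥0)) = ∅ by ext; simp, nhdsWithin_empty]; exact tendsto_bot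
    rw [(closed_nhds_basis l).tendsto_right_iff]
    rintro V ⟨hV, hVc⟩
    obtain ⟨u, hu, h⟩ := (mem_leftFilter ht).1 (hl hV)
    filter_upwards [Ioo_mem_nhdsLT hu] with s hs
    refine hVc.mem_of_tendsto (hg s) (mem_rightFilter.2 ⟨t, hs.2, fun q hq hq' => ?_⟩)
    exact h q (hs.1.trans hq) hq'

/-- An RCLL function as a point of the path space. -/
def PathSpace.mk (f : ℝ≥0 → E) (hf : IsRCLL f) : PathSpace E := ⟨f, hf⟩

/-- The RCLL path of right limits of a regular function (a constant path otherwise). -/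
def regularize [RegularSpace E] [Nonempty E] (f : ℚ≥0 → E) : PathSpace E :=
  open Classical in
  if h : IsReg f then
    PathSpace.mk (fun t => (h t).1.choose) (isRCLL_of_tendsto h fun t => (h t).1.choose_spec)
  else constPath (Classical.arbitrary E)

theorem tendsto_regularize [RegularSpace E] [Nonempty E] {f : ℚ≥0 → E} (hf : IsReg f) (t : ℝ≥0) :
    Tendsto f (rightFilter t) (𝓝 ((regularize f).1 t)) := by
  rw [regularize, dif_pos hf]
  exact (hf t).1.choose_spec

/-- A path is recovered from its rational values; this is the left inverse behind the embedding of
the path space into a countable product. -/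
theorem regularize_rcll [T3Space E] [Nonempty E] (ω : PathSpace E) :
    regularize (fun q : ℚ≥0 => ω.1 q) = ω :=
  Subtype.ext <| funext fun t => tendsto_nhds_unique
    (tendsto_regularize (isReg_of_rcll ω) t) (tendsto_right_of_rcll ω t)

end Regularize

/-- There is a chain of `n` steps larger than `ε` that ends at `q`. -/
def Oscillates {E : Type*} [PseudoMetricSpace E] (f : ℚ≥0 → E) (ε : ℝ) : ℕ → ℚ≥0 → Prop
  | 0, _ => True
  | n + 1, q => ∃ p < q, ε < dist (f p) (f q) ∧ Oscillates f ε n p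

theorem measurableSet_oscillates {E : Type*} [PseudoMetricSpace E] [SecondCountableTopology E]
    [MeasurableSpace E] [BorelSpace E] (ε : ℝ) (n : ℕ) (q : ℚ≥0) :
    MeasurableSet {f : ℚ≥0 → E | Oscillates f ε n q} := by
  induction n generalizing q with
  | zero => simp [Oscillates]
  | succ n ih =>
    have : {f : ℚ≥0 → E | Oscillates f ε (n + 1) q} = ⋃ p, ⋃ (_ : p < q),
        {f : ℚ≥0 → E | ε < dist (f p) (f q)} ∩ {f | Oscillates f ε n p} := by
      ext f
      simp only [mem_ofPred_eq, mem_iUnion, mem_inter_iff, Oscillates, exists_prop]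
    rw [this]
    refine MeasurableSet.iUnion fun p => MeasurableSet.iUnion fun _ => MeasurableSet.inter ?_ (ih p)
    exact measurableSet_lt measurable_const ((measurable_pi_apply p).dist (measurable_pi_apply q))

theorem exists_dist_of_not_cauchy {E : Type*} [PseudoMetricSpace E] {F : Filter ℚ≥0} [F.NeBot]
    {f : ℚ≥0 → E} (h : ¬ Cauchy (map f F)) :
    ∃ ε > 0, ∀ s ∈ F, ∀ x, ∃ q ∈ s, ε < dist x (f q) := by
  rw [Metric.cauchy_iff] at h
  push Not at h
  specialize h inferInstance
  obtain ⟨ε, hε, h⟩ := h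
  refine ⟨ε / 3, by positivity, fun s hs x => ?_⟩
  by_contra! hc
  obtain ⟨_, ⟨p, hp, rfl⟩, _, ⟨q, hq, rfl⟩, hpq⟩ := h (f '' s)
    (image_mem_map hs)
  have := dist_triangle_left (f p) (f q) x
  linarith [hc p hp, hc q hq]

/-- One-sided limits exist everywhere exactly when oscillations of each fixed size are bounded in
number on bounded intervals. The right side involves only countably many evaluations, which makes
regularity a Borel condition. -/
theorem isReg_iff {E : Type*} [PseudoMetricSpace E] [CompleteSpace E] (f : ℚ≥0 → E) :
    IsReg f ↔ ∀ k T : ℕ, ∃ N, ∀ q : ℚ≥0, q ≤ T → ¬ Oscillates f (1 / (k + 1 : ℝ)) N q := by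
  constructor
  · intro hf k T
    set ε : ℝ := 1 / (k + 1 : ℝ)
    have hε : 0 < ε := by positivity
    have key : ∀ s : ℝ≥0, ∃ N, ∀ q : ℚ≥0, (q : ℝ≥0) ≤ s → ¬ Oscillates f ε N q := by
      by_contra! hcon
      have small : ∀ (F : Filter ℚ≥0) (l : E), Tendsto f F (𝓝 l) →
          ∃ s ∈ F, ∀ p ∈ s, ∀ q ∈ s, ¬ ε < dist (f p) (f q) := by
        intro F l hl
        refine ⟨_, hl (Metric.ball_mem_nhds l (half_pos hε)), fun p hp q hq => not_lt.2 ?_⟩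
        have := dist_triangle_right (f p) (f q) l
        have h1 : dist (f p) l < ε / 2 := hp
        have h2 : dist (f q) l < ε / 2 := hq
        linarith
      set S : Set ℝ≥0 := {s | ∀ N, ∃ q : ℚ≥0, (q : ℝ≥0) ≤ s ∧ Oscillates f ε N q}
      have hS : S.Nonempty := hcon
      -- `t` is the critical horizon. The left limit at `t` shows that chains up to `t` are bounded
      -- in length; the right limit then excludes long chains ending just after `t`, a
      -- contradiction.
      set t := sInf S
      have hlt : ∀ s < t, ∃ N, ∀ q : ℚ≥0, (q : ℝ≥0) ≤ s → ¬ Oscillates f ε N q := by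
        intro s hs
        have := notMem_of_lt_csInf hs (OrderBot.bddBelow _)
        simpa [S] using this
      have hle : ∃ N, ∀ q : ℚ≥0, (q : ℝ≥0) ≤ t → ¬ Oscillates f ε N q := by
        rcases eq_zero_or_pos t with h0 | ht
        · refine ⟨1, fun q hq => ?_⟩
          rw [h0] at hq
          have : q = 0 := by
            have : (q : ℝ≥0) = 0 := le_antisymm hq (zero_le)
            exact_mod_cast this
          rintro ⟨p, hp, -⟩
          simp [this] at hp
        · obtain ⟨l, hl⟩ := (hf t).2
          obtain ⟨s, hs, hsmall⟩ := small _ l hl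
          obtain ⟨u, hu, h⟩ := (mem_leftFilter ht).1 hs
          obtain ⟨N, hN⟩ := hlt u hu
          have h1 : ∀ q : ℚ≥0, (q : ℝ≥0) < t → ¬ Oscillates f ε (N + 1) q := by
            rintro q hq ⟨p, hp, hd, ho⟩
            have hpu : u < p := lt_of_not_ge fun hpu => hN p hpu ho
            have hpq : (p : ℝ≥0) < q := by exact_mod_cast hp
            exact hsmall p (h p hpu (hpq.trans hq)) q (h q (hpu.trans hpq) hq) hd
          -- A chain may end at `t` itself, where the left limit gives no control; this costs one
          -- further step.
          refine ⟨N + 2, ?_⟩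
          rintro q hq ⟨p, hp, -, ho⟩
          have hpq : (p : ℝ≥0) < q := by exact_mod_cast hp
          exact h1 p (hpq.trans_le hq) ho
      obtain ⟨N, hN⟩ := hle
      obtain ⟨l, hl⟩ := (hf t).1
      obtain ⟨s, hs, hsmall⟩ := small _ l hl
      obtain ⟨u, hu, h⟩ := mem_rightFilter.1 hs
      obtain ⟨r, hrS, hr⟩ := exists_lt_of_csInf_lt hS hu
      obtain ⟨q, hq, p, hp, hd, ho⟩ := hrS (N + 1)
      have hpt : t < p := lt_of_not_ge fun hpt => hN p hpt ho
      have hpq : (p : ℝ≥0) < q := by exact_mod_cast hp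
      have hqu := hq.trans_lt hr
      exact hsmall p (h p hpt (hpq.trans hqu)) q (h q (hpt.trans hpq) hqu) hd
    obtain ⟨N, hN⟩ := key T
    exact ⟨N, fun q hq => hN q (by exact_mod_cast hq)⟩
  · intro h t
    have mono : ∀ {ε δ : ℝ}, ε ≤ δ → ∀ n q, Oscillates f δ n q → Oscillates f ε n q := by
      intro ε δ hεδ n
      induction n with
      | zero => intros; trivial
      | succ n ih =>
        rintro q ⟨p, hp, hd, ho⟩
        exact ⟨p, hp, hεδ.trans_lt hd, ih p ho⟩
    have bound : ∀ ε > 0, ∀ T : ℕ, ∃ N, ∀ q : ℚ≥0, q ≤ T → ¬ Oscillates f ε N q := by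
      intro ε hε T
      obtain ⟨k, hk⟩ := exists_nat_one_div_lt hε
      obtain ⟨N, hN⟩ := h k T
      exact ⟨N, fun q hq ho => hN q hq (mono hk.le _ _ ho)⟩
    obtain ⟨T, hT⟩ := exists_nat_gt (t + 1)
    constructor
    · suffices Cauchy (map f (rightFilter t)) from CompleteSpace.complete this
      by_contra hc
      obtain ⟨ε, hε, hc⟩ := exists_dist_of_not_cauchy hc
      obtain ⟨N, hN⟩ := bound ε hε T
      -- Failure of the Cauchy property gives, from any point, a jump larger than `ε` arbitrarily
      -- close to `t`, so chains of every length can be built downwards towards `t`.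
      have hall : ∀ n, ∀ q : ℚ≥0, t < q → Oscillates f ε n q := by
        intro n
        induction n with
        | zero => intros; trivial
        | succ n ih =>
          intro q hq
          obtain ⟨p, ⟨hp, hp'⟩, hd⟩ := hc {p | t < (p : ℝ≥0) ∧ p < q}
            (mem_rightFilter.2 ⟨q, hq, fun p hp hp' => ⟨hp, by exact_mod_cast hp'⟩⟩) (f q)
          exact ⟨p, hp', by rwa [dist_comm], ih p hp⟩
      obtain ⟨q, hq, hq'⟩ := exists_nnrat_between (lt_add_one t)
      exact hN q (by exact_mod_cast (hq'.trans hT).le) (hall N q hq)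
    · rcases eq_zero_or_pos t with rfl | ht
      · rw [leftFilter_zero]; exact ⟨f 0, tendsto_bot⟩
      have := leftFilter_neBot ht
      suffices Cauchy (map f (leftFilter t)) from CompleteSpace.complete this
      by_contra hc
      obtain ⟨ε, hε, hc⟩ := exists_dist_of_not_cauchy hc
      obtain ⟨N, hN⟩ := bound ε hε T
      have hall : ∀ n, ∃ q : ℚ≥0, (q : ℝ≥0) < t ∧ Oscillates f ε n q := by
        intro n
        induction n with
        | zero => exact ⟨0, by simpa using ht, trivial⟩
        | succ n ih =>
          obtain ⟨p, hp, ho⟩ := ih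
          obtain ⟨q, ⟨hq, hq'⟩, hd⟩ := hc {q | (q : ℝ≥0) < t ∧ p < q}
            ((mem_leftFilter ht).2 ⟨p, hp, fun q hq hq' => ⟨hq', by exact_mod_cast hq⟩⟩) (f p)
          exact ⟨q, hq, p, hq', hd, ho⟩
      obtain ⟨q, hq, ho⟩ := hall N
      refine hN q ?_ ho
      have : (q : ℝ≥0) < T := hq.trans ((lt_add_one t).trans hT)
      exact_mod_cast this.le

/-! ### The path space as a standard Borel space -/

section Standard

open TopologicalSpace

variable {E : Type*} [TopologicalSpace E] [PolishSpace E] [MeasurableSpace E] [BorelSpace E]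

theorem measurableSet_isReg : MeasurableSet {f : ℚ≥0 → E | IsReg f} := by
  let := upgradeIsCompletelyMetrizable E
  simp_rw [isReg_iff, ofPred_forall, ofPred_exists, ofPred_forall]
  exact MeasurableSet.iInter fun k => MeasurableSet.iInter fun T => MeasurableSet.iUnion fun N =>
    MeasurableSet.iInter fun q => MeasurableSet.iInter fun _ => (measurableSet_oscillates _ _ _).compl

theorem measurable_pathSpace {α : Type*} {mα : MeasurableSpace α} {g : α → PathSpace E} :
    Measurable g ↔ ∀ t, Measurable fun a => coord t (g a) := by
  refine ⟨fun h t => (measurable_coord t).comp h, fun h => ?_⟩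
  exact (measurable_pi_lambda _ h).subtype_mk

theorem measurable_regularize [Nonempty E] : Measurable (regularize (E := E)) := by
  classical
  refine measurable_pathSpace.2 fun t => ?_
  obtain ⟨u, hu⟩ := (rightFilter t).exists_seq_tendsto
  refine measurable_of_tendsto_metrizable (f := fun n f =>
    if f ∈ {f : ℚ≥0 → E | IsReg f} then f (u n) else Classical.arbitrary E) (fun n => ?_) ?_
  · exact Measurable.ite measurableSet_isReg (measurable_pi_apply _) measurable_const
  · refine tendsto_pi_nhds.2 fun f => ?_
    by_cases hf : IsReg f
    · simp only [mem_ofPred_eq, hf, if_true]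
      exact (tendsto_regularize hf t).comp hu
    · simp [hf, regularize, coord, constPath]

/-- Restriction to the rationals embeds the path space into a countable power of `E`. The range is
the set of functions fixed by regularizing and restricting again, hence Borel, and the Polish
topology is pulled back from there. -/
instance : StandardBorelSpace (PathSpace E) := by
  rcases isEmpty_or_nonempty E with hE | hE
  · have : IsEmpty (PathSpace E) := ⟨fun ω => hE.elim (ω.1 0)⟩
    infer_instance
  · have hm : Measurable fun (ω : PathSpace E) (q : ℚ≥0) => ω.1 q :=
      measurable_pi_lambda _ fun q => measurable_coord _
    have hr : range (fun (ω : PathSpace E) (q : ℚ≥0) => ω.1 q) =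
        {f | (fun q : ℚ≥0 => (regularize f).1 q) = f} := by
      ext f
      constructor
      · rintro ⟨ω, rfl⟩
        simp only [mem_ofPred_eq, regularize_rcll]
      · exact fun h => ⟨regularize f, h⟩
    have he : MeasurableEmbedding fun (ω : PathSpace E) (q : ℚ≥0) => ω.1 q := by
      refine MeasurableEmbedding.of_measurable_inverse hm ?_ measurable_regularize regularize_rcll
      rw [hr]
      exact measurableSet_eq_fun (hm.comp measurable_regularize) measurable_id
    have := he.measurableSet_range.standardBorel
    obtain ⟨t, hB, hP⟩ := this.polish
    let e := he.equivRange
    have hb : @BorelSpace (PathSpace E) (t.induced e) _ := by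
      let := t.induced e
      refine ⟨e.measurableEmbedding.comap_eq.symm.trans ?_⟩
      exact (congrArg (MeasurableSpace.comap e.toEquiv) hB.measurable_eq).trans borel_comap.symm
    exact ⟨t.induced e, hb, e.toEquiv.polishSpace_induced⟩

end Standard

/-- A locally compact space is open in its metric completion, since it is dense there and compact
neighbourhoods stay closed; an open subset of a Polish space is Polish. -/
theorem polishSpace_of_locallyCompact (F : Type*) [TopologicalSpace F] [T2Space F]
    [LocallyCompactSpace F] [SecondCountableTopology F] : PolishSpace F := by
  let := TopologicalSpace.metrizableSpaceMetric F
  have he := UniformSpace.Completion.isDenseEmbedding_coe (α := F)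
  have ho : IsOpen (range ((↑) : F → UniformSpace.Completion F)) := by
    refine isOpen_iff_mem_nhds.2 ?_
    rintro _ ⟨x, rfl⟩
    obtain ⟨K, hK, hx⟩ := exists_compact_mem_nhds x
    rw [he.isEmbedding.nhds_eq_comap, mem_comap] at hx
    obtain ⟨V, hV, hVK⟩ := hx
    obtain ⟨W, hWV, hW, hxW⟩ := mem_nhds_iff.1 hV
    refine mem_of_superset (hW.mem_nhds hxW) fun y hy => ?_
    have hc := (hK.image he.continuous).isClosed
    have : y ∈ closure (((↑) : F → UniformSpace.Completion F) '' K) := by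
      refine closure_mono ?_ (he.dense.open_subset_closure_inter hW hy)
      rintro _ ⟨hz, z, rfl⟩
      exact ⟨z, hVK (hWV hz), rfl⟩
    rw [hc.closure_eq] at this
    exact image_subset_range _ _ this
  have := ho.polishSpace
  exact (he.isEmbedding.toHomeomorph.isClosedEmbedding).polishSpace

end DPP

namespace DPP

/-! ### Analytic sets and measurable selection -/

/-- The sequences whose first `k` entries are bounded by those of `n`. -/
def boundedPrefix (n : ℕ → ℕ) (k : ℕ) : Set (ℕ → ℕ) := {x | ∀ i < k, x i ≤ n i}

/-- The bounds are chosen one entry at a time: as the bound on the next entry grows, the images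
increase to the previous image, and continuity from below, valid for arbitrary sets, keeps the outer
measure above `c`. -/
theorem exists_boundedPrefix_measure {X : Type*} [MeasurableSpace X] (m : Measure X)
    (f : (ℕ → ℕ) → X) {c : ℝ≥0∞} (hc : c < m (range f)) :
    ∃ n : ℕ → ℕ, ∀ k, c < m (f '' boundedPrefix n k) := by
  have step : ∀ (k : ℕ) (n : ℕ → ℕ), c < m (f '' boundedPrefix n k) →
      ∃ j, c < m (f '' boundedPrefix (Function.update n k j) (k + 1)) := by
    intro k n h
    have hU : f '' boundedPrefix n k =
        ⋃ j, f '' boundedPrefix (Function.update n k j) (k + 1) := by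
      rw [← image_iUnion]
      congr 1
      ext x
      simp only [boundedPrefix, mem_ofPred_eq, mem_iUnion]
      constructor
      · refine fun h => ⟨x k, fun i hi => ?_⟩
        rcases Nat.lt_succ_iff_lt_or_eq.1 hi with hi | rfl
        · simpa [hi.ne] using h i hi
        · simp
      · rintro ⟨j, h⟩ i hi
        simpa [hi.ne] using h i (hi.trans (Nat.lt_succ_self k))
    have hmono : Monotone fun j => f '' boundedPrefix (Function.update n k j) (k + 1) := by
      intro j j' hj
      refine image_mono fun x hx i hi => (hx i hi).trans ?_
      by_cases hik : i = k
      · subst hik; simpa using hj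
      · simp [hik]
    rw [hU, hmono.measure_iUnion, lt_iSup_iff] at h
    exact h
  choose! j hj using step
  let seq : ℕ → ℕ → ℕ := fun k => Nat.rec (fun _ => 0) (fun k n => Function.update n k (j k n)) k
  have hseq : ∀ k, seq (k + 1) = Function.update (seq k) k (j k (seq k)) := fun k => rfl
  have hs : ∀ k, c < m (f '' boundedPrefix (seq k) k) := by
    intro k
    induction k with
    | zero => simpa [boundedPrefix] using hc
    | succ k ih => rw [hseq]; exact hj k _ ih
  refine ⟨fun i => seq (i + 1) i, fun k => ?_⟩
  have stable : ∀ i d, seq (i + 1 + d) i = seq (i + 1) i := by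
    intro i d
    induction d with
    | zero => rfl
    | succ d ih =>
      rw [← add_assoc, hseq, Function.update_of_ne (by omega), ih]
  have : boundedPrefix (fun i => seq (i + 1) i) k = boundedPrefix (seq k) k := by
    ext x
    refine forall_congr' fun i => forall_congr' fun hi => ?_
    obtain ⟨d, rfl⟩ := Nat.exists_eq_add_of_lt hi
    rw [show i + d + 1 = i + 1 + d by ring, stable]
  rw [this]
  exact hs k

/-- Compactness: points nearly attaining `y` have preimages in one compact box, and a limit point of
these is a preimage of `y`. -/
theorem iInter_closure_subset {X : Type*} [TopologicalSpace X] [T2Space X]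
    [FirstCountableTopology X] {f : (ℕ → ℕ) → X} (hf : Continuous f) (n : ℕ → ℕ) :
    ⋂ k, closure (f '' boundedPrefix n k) ⊆ range f := by
  intro y hy
  rw [mem_iInter] at hy
  obtain ⟨u, hu⟩ := (𝓝 y).exists_antitone_basis
  have hx : ∀ k, ∃ x ∈ boundedPrefix n k, f x ∈ u k := by
    intro k
    obtain ⟨_, hz, x, hx, rfl⟩ := mem_closure_iff_nhds.1 (hy k) (u k) (hu.mem k)
    exact ⟨x, hx, hz⟩
  choose x hx hxu using hx
  -- Entry `i` of `x k` is bounded by `n i` only when `i < k`; the sum takes care of the finitely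
  -- many `k ≤ i`.
  let b : ℕ → ℕ := fun i => n i + ∑ k ∈ Finset.range (i + 1), x k i
  have hmem : ∀ k, x k ∈ Set.univ.pi fun i => Set.Iic (b i) := by
    intro k i _
    rcases lt_or_ge i k with h | h
    · exact (hx k i h).trans (Nat.le_add_right _ _)
    · refine le_trans ?_ (Nat.le_add_left _ _)
      exact Finset.single_le_sum (f := fun k => x k i) (fun _ _ => Nat.zero_le _)
        (Finset.mem_range.2 (Nat.lt_succ_of_le h))
  have hK : IsCompact (Set.univ.pi fun i => Set.Iic (b i)) :=
    isCompact_univ_pi fun i => (Set.finite_Iic (b i)).isCompact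
  obtain ⟨a, -, φ, hφ, ha⟩ := hK.tendsto_subseq hmem
  refine ⟨a, tendsto_nhds_unique ((hf.tendsto a).comp ha) ?_⟩
  exact (hu.tendsto hxu).comp hφ.tendsto_atTop

/-- Analytic sets are approximated from inside in measure by Borel sets, namely the intersections of
closures of the two preceding lemmas. -/
theorem nullMeasurableSet_range {X : Type*} [TopologicalSpace X] [PolishSpace X]
    [MeasurableSpace X] [BorelSpace X] (m : Measure X) [IsFiniteMeasure m] {f : (ℕ → ℕ) → X}
    (hf : Continuous f) : NullMeasurableSet (range f) m := by
  have key : ∀ c < m (range f), ∃ C ⊆ range f, MeasurableSet C ∧ c ≤ m C := by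
    intro c hc
    obtain ⟨n, hn⟩ := exists_boundedPrefix_measure m f hc
    refine ⟨_, iInter_closure_subset hf n, MeasurableSet.iInter fun k => measurableSet_closure, ?_⟩
    have hanti : Antitone fun k => closure (f '' boundedPrefix n k) := fun k l hkl =>
      closure_mono (image_mono fun x hx i hi => hx i (hi.trans_le hkl))
    rw [hanti.measure_iInter (fun k => measurableSet_closure.nullMeasurableSet)
      ⟨0, measure_ne_top _ _⟩]
    exact le_iInf fun k => (hn k).le.trans (measure_mono subset_closure)
  rcases eq_or_ne (m (range f)) 0 with h0 | h0
  · exact NullMeasurableSet.of_null h0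
  obtain ⟨u, -, hu, hlim⟩ := exists_seq_strictMono_tendsto' (pos_iff_ne_zero.2 h0)
  choose C hC hCm hcC using fun k => key (u k) (hu k).2
  have hsub : ⋃ k, C k ⊆ range f := iUnion_subset hC
  have hle : m (range f) ≤ m (⋃ k, C k) :=
    le_of_tendsto' hlim fun k => (hcC k).trans (measure_mono (subset_iUnion C k))
  exact (MeasurableSet.iUnion hCm).nullMeasurableSet.congr
    (ae_eq_of_subset_of_measure_ge hsub hle (MeasurableSet.iUnion hCm).nullMeasurableSet
      (measure_ne_top _ _))

theorem AnalyticSet.nullMeasurableSet {X : Type*} [TopologicalSpace X] [PolishSpace X]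
    [MeasurableSpace X] [BorelSpace X] (m : Measure X) [IsFiniteMeasure m] {s : Set X}
    (hs : AnalyticSet s) : NullMeasurableSet s m := by
  rw [AnalyticSet] at hs
  rcases hs with rfl | ⟨f, hf, rfl⟩
  · exact nullMeasurableSet_empty
  · exact nullMeasurableSet_range m hf

/-! ### Lexicographically minimal points of fibres -/

section Selection

variable {X : Type*} (g : (ℕ → ℕ) → X)

/-- The points whose `g`-fibre contains a sequence with prefix `w`. -/
def prefixSet {k : ℕ} (w : Fin k → ℕ) : Set X := g '' {b | ∀ i : Fin k, b i = w i}

/-- The first `k` entries of the lexicographically smallest sequence in the fibre. -/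
def lexPrefix : (k : ℕ) → X → Fin k → ℕ
  | 0, _ => Fin.elim0
  | k + 1, x => Fin.snoc (lexPrefix k x) (sInf {j | x ∈ prefixSet g (Fin.snoc (lexPrefix k x) j)})

theorem mem_prefixSet_lexPrefix (hg : Function.Surjective g) (k : ℕ) (x : X) :
    x ∈ prefixSet g (lexPrefix g k x) := by
  induction k with
  | zero =>
    obtain ⟨b, rfl⟩ := hg x
    exact ⟨b, fun i => i.elim0, rfl⟩
  | succ k ih =>
    have : {j | x ∈ prefixSet g (Fin.snoc (lexPrefix g k x) j : Fin (k + 1) → ℕ)}.Nonempty := by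
      obtain ⟨b, hb, rfl⟩ := ih
      refine ⟨b k, b, fun i => ?_, rfl⟩
      refine Fin.lastCases ?_ (fun i => ?_) i
      · simp
      · simpa using hb i
    exact Nat.sInf_mem this

theorem lexPrefix_apply {k l : ℕ} (h : k < l) (x : X) :
    lexPrefix g l x ⟨k, h⟩ = lexPrefix g (k + 1) x (Fin.last k) := by
  induction l with
  | zero => omega
  | succ l ih =>
    rcases Nat.lt_succ_iff_lt_or_eq.1 h with h' | rfl
    · rw [← ih h']
      exact Fin.snoc_castSucc (α := fun _ => ℕ) _ (lexPrefix g l x) ⟨k, h'⟩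
    · rfl

/-- The σ-algebra on `X` is arbitrary subject to containing the prefix sets. It is later the
σ-algebra of null-measurable sets, since prefix sets are analytic and need not be Borel. -/
theorem measurable_lexPrefix {mX : MeasurableSpace X}
    (h : ∀ k (w : Fin k → ℕ), MeasurableSet (prefixSet g w)) (k : ℕ) :
    Measurable (lexPrefix g k) := by
  induction k with
  | zero => exact measurable_const (a := Fin.elim0)
  | succ k ih =>
    have hN : Measurable fun p : X × (Fin k → ℕ) =>
        sInf {j | p.1 ∈ prefixSet g (Fin.snoc p.2 j : Fin (k + 1) → ℕ)} := by
      refine measurable_from_prod_countable_left fun w => ?_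
      refine measurable_to_countable' fun n => ?_
      have : (fun x => sInf {j | x ∈ prefixSet g (Fin.snoc w j : Fin (k + 1) → ℕ)}) ⁻¹' {n} =
          (prefixSet g (Fin.snoc w n : Fin (k + 1) → ℕ) ∩
            ⋂ j, ⋂ (_ : j < n), (prefixSet g (Fin.snoc w j : Fin (k + 1) → ℕ))ᶜ) ∪
          {x | n = 0 ∧ ∀ j, x ∉ prefixSet g (Fin.snoc w j : Fin (k + 1) → ℕ)} := by
        ext x
        simp only [mem_preimage, mem_singleton_iff, mem_union, mem_inter_iff, mem_iInter,
          mem_compl_iff, mem_ofPred_eq]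
        constructor
        · rintro rfl
          by_cases hne : {j | x ∈ prefixSet g (Fin.snoc w j : Fin (k + 1) → ℕ)}.Nonempty
          · exact Or.inl ⟨Nat.sInf_mem hne, fun j hj => Nat.notMem_of_lt_sInf hj⟩
          · rw [not_nonempty_iff_eq_empty] at hne
            refine Or.inr ⟨by rw [hne, Nat.sInf_empty], fun j hj => ?_⟩
            exact (hne ▸ hj : j ∈ (∅ : Set ℕ))
        · rintro (⟨h1, h2⟩ | ⟨rfl, h2⟩)
          · refine le_antisymm (Nat.sInf_le h1) (le_of_not_gt fun hlt => ?_)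
            exact h2 _ hlt (Nat.sInf_mem (s := {j | x ∈ prefixSet g (Fin.snoc w j)}) ⟨n, h1⟩)
          · rw [show {j | x ∈ prefixSet g (Fin.snoc w j : Fin (k + 1) → ℕ)} = ∅ from
              eq_empty_of_forall_notMem h2, Nat.sInf_empty]
      rw [this]
      refine MeasurableSet.union ((h _ _).inter ?_) ?_
      · exact MeasurableSet.iInter fun j => MeasurableSet.iInter fun _ => (h _ _).compl
      · rw [ofPred_and, ofPred_forall]
        exact (MeasurableSet.const _).inter (MeasurableSet.iInter fun j => (h _ _).compl)
    have hN' := hN.comp (measurable_id.prodMk ih)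
    refine measurable_pi_lambda _ fun i => ?_
    refine Fin.lastCases ?_ (fun i => ?_) i
    · simp only [lexPrefix, Fin.snoc_last]
      exact hN'
    · simp only [lexPrefix, Fin.snoc_castSucc]
      exact (measurable_pi_apply i).comp ih

end Selection

/-- The Jankov–von Neumann selection theorem. -/
theorem exists_universallyMeasurable_selector {X Y : Type*} [MeasurableSpace X]
    [StandardBorelSpace X] [MeasurableSpace Y] [StandardBorelSpace Y] {A : Set (X × Y)}
    (hA : MeasurableSet A) (h : ∀ x, ∃ y, (x, y) ∈ A) :
    ∃ s : X → Y, UniversallyMeasurable s ∧ ∀ x, (x, s x) ∈ A := by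
  rcases isEmpty_or_nonempty X with hX | ⟨⟨x₀⟩⟩
  · exact ⟨fun x => hX.elim x, fun m hm => (measurable_of_empty _).nullMeasurable, fun x => hX.elim x⟩
  let := upgradeStandardBorel X
  let := upgradeStandardBorel Y
  have han := hA.analyticSet
  rw [AnalyticSet] at han
  rcases han with rfl | ⟨φ, hφ, hr⟩
  · exact absurd (h x₀).choose_spec (notMem_empty _)
  set g : (ℕ → ℕ) → X := fun b => (φ b).1
  have hg : Continuous g := continuous_fst.comp hφ
  have hsurj : Function.Surjective g := by
    intro x
    obtain ⟨y, hy⟩ := h x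
    rw [← hr] at hy
    obtain ⟨b, hb⟩ := hy
    exact ⟨b, by simp [g, hb]⟩
  let a : X → ℕ → ℕ := fun x k => lexPrefix g (k + 1) x (Fin.last k)
  have ha : ∀ x, g (a x) = x := by
    intro x
    choose b hb hbx using fun k => mem_prefixSet_lexPrefix g hsurj k x
    -- The fibre points `b k` agree with `a x` on the first `k` entries, so they converge to `a x`,
    -- and continuity of `g` puts `a x` in the fibre.
    have hlim : Tendsto b atTop (𝓝 (a x)) := by
      refine tendsto_pi_nhds.2 fun i => tendsto_const_nhds.congr' ?_
      filter_upwards [eventually_gt_atTop i] with k hk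
      exact (lexPrefix_apply g hk x).symm.trans (hb k ⟨i, hk⟩).symm
    exact tendsto_nhds_unique ((hg.tendsto _).comp hlim) (by
      simp [Function.comp_def, hbx])
  refine ⟨fun x => (φ (a x)).2, fun m hm => ?_, fun x => ?_⟩
  · have hT : ∀ k (w : Fin k → ℕ), NullMeasurableSet (prefixSet g w) m := fun k w => by
      refine AnalyticSet.nullMeasurableSet m ?_
      refine IsOpen.analyticSet_image ?_ hg
      rw [ofPred_forall]
      exact isOpen_iInter_of_finite fun i =>
        (isOpen_discrete {w i}).preimage (continuous_apply (A := fun _ => ℕ) (i : ℕ))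
    have hma : NullMeasurable a m :=
      measurable_pi_lambda (α := NullMeasurableSpace X m) a fun k => (measurable_pi_apply (Fin.last k)).comp (measurable_lexPrefix g hT (k + 1))
    exact (measurable_snd.comp hφ.measurable).comp_nullMeasurable hma
  · rw [← hr]
    exact ⟨a x, Prod.ext (ha x) rfl⟩

end DPP

namespace DPP

/-! ### Parametrization of laws, kernels and extended expectations -/

theorem isRatStieltjesPoint_cdf (ν : Measure ℝ) :
    IsRatStieltjesPoint (fun (c : ℚ → ℝ) => c) (fun q : ℚ => cdf ν q) where
  mono := fun p q h => monotone_cdf ν (by exact_mod_cast h)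
  tendsto_atTop_one := (tendsto_cdf_atTop ν).comp (tendsto_ratCast_atTop_iff.2 tendsto_id)
  tendsto_atBot_zero := (tendsto_cdf_atBot ν).comp (tendsto_ratCast_atBot_iff.2 tendsto_id)
  iInf_rat_gt_eq := fun t => by
    have h := (cdf ν).iInf_rat_gt_eq (t : ℝ)
    refine Eq.trans ?_ h
    refine Equiv.iInf_congr (Equiv.subtypeEquivRight fun r => ?_) fun r => rfl
    simp

/-- After embedding `Ω` into the line, a law is its distribution function on the rationals.
Selecting a law thus becomes selecting a point of the standard Borel space `ℚ → ℝ`. -/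
theorem exists_kernel_parametrization (Ω : Type*) [MeasurableSpace Ω] [StandardBorelSpace Ω]
    [Nonempty Ω] : ∃ κ : Kernel (ℚ → ℝ) Ω, IsMarkovKernel κ ∧
      ∀ μ : Measure Ω, IsProbabilityMeasure μ → ∃ c, κ c = μ := by
  let κ₀ : Kernel (ℚ → ℝ) ℝ := ⟨fun c => (stieltjesOfMeasurableRat (fun c => c) measurable_id c).measure,
    measurable_measure_stieltjesOfMeasurableRat measurable_id⟩
  have : IsMarkovKernel κ₀ :=
    ⟨fun c => instIsProbabilityMeasure_stieltjesOfMeasurableRat measurable_id c⟩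
  have he := measurableEmbedding_embeddingReal Ω
  refine ⟨κ₀.map he.invFun, Kernel.IsMarkovKernel.map _ he.measurable_invFun, fun μ hμ => ?_⟩
  set ν := μ.map (embeddingReal Ω)
  have hν : IsProbabilityMeasure ν := Measure.isProbabilityMeasure_map he.measurable.aemeasurable
  refine ⟨fun q => cdf ν q, ?_⟩
  have h : κ₀ (fun q => cdf ν q) = ν := by
    refine (Measure.ext_of_Iic _ _ fun x => ?_)
    change (stieltjesOfMeasurableRat (fun c => c) measurable_id _).measure (Iic x) = _
    rw [measure_stieltjesOfMeasurableRat_Iic, ← ofReal_cdf ν x]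
    congr 1
    rw [← StieltjesFunction.iInf_rat_gt_eq, ← StieltjesFunction.iInf_rat_gt_eq]
    refine iInf_congr fun r => ?_
    rw [stieltjesOfMeasurableRat_eq, toRatCDF_of_isRatStieltjesPoint (isRatStieltjesPoint_cdf ν)]
  rw [Kernel.map_apply _ he.measurable_invFun, h, Measure.map_map he.measurable_invFun he.measurable,
    he.leftInverse_invFun.comp_eq_id, Measure.map_id]

theorem exists_countable_piSystem (Ω : Type*) [mΩ : MeasurableSpace Ω] [StandardBorelSpace Ω] :
    ∃ b : ℚ → Set Ω, IsPiSystem (range b) ∧ mΩ = MeasurableSpace.generateFrom (range b) := by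
  have he := measurableEmbedding_embeddingReal Ω
  have hr : (range fun a : ℚ => embeddingReal Ω ⁻¹' Iic (a : ℝ)) =
      preimage (embeddingReal Ω) '' ⋃ a : ℚ, {Iic (a : ℝ)} := by
    ext s; simp [eq_comm]
  refine ⟨fun a => embeddingReal Ω ⁻¹' Iic (a : ℝ), ?_, ?_⟩
  · rintro _ ⟨p, rfl⟩ _ ⟨q, rfl⟩ -
    exact ⟨min p q, by simp [← preimage_inter, Iic_inter_Iic]⟩
  · rw [hr, ← MeasurableSpace.comap_generateFrom, ← Real.borel_eq_generateFrom_Iic_rat,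
      ← (inferInstance : BorelSpace ℝ).measurable_eq, he.comap_eq]

/-- A universally measurable family of probabilities agrees almost everywhere with a kernel. -/
theorem exists_kernel_ae_eq {X Ω : Type*} [MeasurableSpace X] [MeasurableSpace Ω]
    [StandardBorelSpace Ω] {ν : X → Measure Ω} (hp : ∀ x, IsProbabilityMeasure (ν x))
    (h : ∀ A, MeasurableSet A → UniversallyMeasurable fun x => ν x A)
    (m : Measure X) [IsProbabilityMeasure m] :
    ∃ κ : Kernel X Ω, IsMarkovKernel κ ∧ ∀ᵐ x ∂m, κ x = ν x := by
  classical
  obtain ⟨x₀⟩ := m.nonempty_of_neZero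
  obtain ⟨b, hb, hgen⟩ := exists_countable_piSystem Ω
  have hbm : ∀ q, MeasurableSet (b q) := fun q => by
    rw [hgen]; exact MeasurableSpace.measurableSet_generateFrom ⟨q, rfl⟩
  have ha : ∀ q, AEMeasurable (fun x => ν x (b q)) m := fun q =>
    (h (b q) (hbm q) m inferInstance).aemeasurable
  -- Outside this measurable null set the chosen Borel versions agree with `ν` on a countable
  -- generating π-system; inside it the kernel is constant.
  set N := toMeasurable m {x | ¬ ∀ q, ν x (b q) = (ha q).mk _ x}
  have hN : m N = 0 := by
    rw [measure_toMeasurable]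
    exact ae_all_iff.2 fun q => (ha q).ae_eq_mk
  let κ : X → Measure Ω := fun x => if x ∈ N then ν x₀ else ν x
  have hκp : ∀ x, IsProbabilityMeasure (κ x) := fun x => by
    by_cases hx : x ∈ N <;> simp only [κ, hx, if_true, if_false] <;> exact hp _
  have hκ : Measurable κ := by
    refine Measurable.measure_of_isPiSystem_of_isProbabilityMeasure hgen hb ?_
    rintro _ ⟨q, rfl⟩
    have : (fun x => κ x (b q)) = fun x => if x ∈ N then ν x₀ (b q) else (ha q).mk _ x := by
      ext x
      by_cases hx : x ∈ N
      · simp [κ, hx]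
      · have := not_not.1 fun hc => hx (subset_toMeasurable m _ hc)
        simp only [κ, hx, if_false]
        exact this q
    rw [this]
    exact Measurable.ite (measurableSet_toMeasurable _ _) measurable_const (ha q).measurable_mk
  refine ⟨⟨κ, hκ⟩, ⟨hκp⟩, ?_⟩
  filter_upwards [measure_eq_zero_iff_ae_notMem.1 hN] with x hx
  change κ x = ν x
  simp [κ, hx]

/-- Integrating a difference of extended nonnegative functions. -/
theorem expect_sub {Ω : Type*} [MeasurableSpace Ω] {μ : Measure Ω} {a b : Ω → ℝ≥0∞}
    (ha : AEMeasurable a μ) (hb : AEMeasurable b μ) (hfin : ∫⁻ ω, b ω ∂μ < ⊤) :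
    NegPartIntegrable μ (fun ω => (a ω : EReal) - b ω) ∧
      expect μ (fun ω => (a ω : EReal) - b ω) =
        ((∫⁻ ω, a ω ∂μ : ℝ≥0∞) : EReal) - ((∫⁻ ω, b ω ∂μ : ℝ≥0∞) : EReal) := by
  have hpos : ∀ ω, ((a ω : EReal) - b ω).toENNReal = a ω - b ω := fun ω => by
    rw [EReal.toENNReal_sub (EReal.coe_ennreal_nonneg _)]; simp
  have hneg : ∀ᵐ ω ∂μ, (-((a ω : EReal) - b ω)).toENNReal = b ω - a ω := by
    filter_upwards [ae_lt_top' hb hfin.ne] with ω hω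
    lift b ω to ℝ≥0 using hω.ne with y
    induction a ω with
    | top => simp [EReal.coe_nnreal_eq_coe_real]
    | coe x =>
      simp only [EReal.coe_nnreal_eq_coe_real]
      rw [← EReal.coe_sub, ← EReal.coe_neg, EReal.real_coe_toENNReal, neg_sub,
        ENNReal.ofReal_sub _ x.coe_nonneg, ENNReal.ofReal_coe_nnreal, ENNReal.ofReal_coe_nnreal]
  have h1 : ∫⁻ ω, (-((a ω : EReal) - b ω)).toENNReal ∂μ = ∫⁻ ω, (b ω - a ω) ∂μ :=
    lintegral_congr_ae hneg
  have h2 : ∫⁻ ω, (b ω - a ω) ∂μ < ⊤ := (lintegral_mono fun ω => tsub_le_self).trans_lt hfin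
  refine ⟨by rw [NegPartIntegrable, h1]; exact h2, ?_⟩
  rw [expect, h1]
  simp only [hpos]
  -- With truncated subtraction both sides are the integral of `max a b`.
  have h3 : ∫⁻ ω, (a ω - b ω) ∂μ + ∫⁻ ω, b ω ∂μ = ∫⁻ ω, a ω ∂μ + ∫⁻ ω, (b ω - a ω) ∂μ := by
    rw [← lintegral_add_left' (f := fun ω => a ω - b ω) (ha.sub hb), ← lintegral_add_left' ha]
    refine lintegral_congr fun ω => ?_
    rw [tsub_add_eq_max, add_comm, tsub_add_eq_max, max_comm]
  generalize ∫⁻ ω, (a ω - b ω) ∂μ = p at *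
  generalize ∫⁻ ω, a ω ∂μ = r at *
  lift ∫⁻ ω, b ω ∂μ to ℝ≥0 using hfin.ne with s
  lift ∫⁻ ω, (b ω - a ω) ∂μ to ℝ≥0 using h2.ne with q
  induction p with
  | top =>
    have : r = ⊤ := by
      rw [top_add] at h3
      exact (ENNReal.add_eq_top.1 h3.symm).resolve_right ENNReal.coe_ne_top
    subst this
    simp [EReal.coe_nnreal_eq_coe_real]
  | coe p =>
    have hr : r ≠ ⊤ := fun h => by
      rw [h, top_add] at h3
      exact absurd h3 (by simp)
    lift r to ℝ≥0 using hr
    have h3 : (p : ℝ) + s = r + q := by exact_mod_cast h3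
    simp only [EReal.coe_nnreal_eq_coe_real, ← EReal.coe_sub]
    congr 1
    linarith

end DPP

namespace DPP

/-! ### Discretization of times -/

/-- The smallest dyadic of order `k` strictly above `t`. -/
def disc (k : ℕ) (t : ℝ≥0) : ℝ≥0 := (⌊t * 2 ^ k⌋₊ + 1) / 2 ^ k

theorem lt_disc (k : ℕ) (t : ℝ≥0) : t < disc k t := by
  rw [disc, lt_div_iff₀ (by positivity)]
  exact Nat.lt_floor_add_one _

theorem disc_le (k : ℕ) (t : ℝ≥0) : disc k t ≤ t + 1 / 2 ^ k := by
  rw [disc, add_div]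
  gcongr
  rw [div_le_iff₀ (by positivity)]
  exact Nat.floor_le (zero_le)

theorem tendsto_disc (t : ℝ≥0) : Tendsto (fun k => disc k t) atTop (𝓝[>] t) := by
  refine tendsto_nhdsWithin_iff.2 ⟨?_, Eventually.of_forall fun k => lt_disc k t⟩
  refine tendsto_of_tendsto_of_tendsto_of_le_of_le tendsto_const_nhds ?_
    (fun k => (lt_disc k t).le) (fun k => disc_le k t)
  have h : Tendsto (fun k : ℕ => (1 / 2 : ℝ≥0) ^ k) atTop (𝓝 0) :=
    NNReal.tendsto_pow_atTop_nhds_zero_of_lt_one (by rw [← NNReal.coe_lt_coe]; norm_num)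
  simpa using (tendsto_const_nhds (x := t)).add h

/-! ### Measurability of right-continuous processes -/

section Progressive

variable {Ω β : Type*} {m : MeasurableSpace Ω} [TopologicalSpace β] [SecondCountableTopology β]
  [TopologicalSpace.PseudoMetrizableSpace β] [MeasurableSpace β] [BorelSpace β]

/-- Sampling at dyadic times just after `t` uses countably many times, so each approximation is
jointly measurable; right-continuity gives the limit. -/
theorem measurable_of_rightCont {u : ℝ≥0 → Ω → β} (hu : ∀ t, Measurable (u t))
    (hc : ∀ ω t, ContinuousWithinAt (fun s => u s ω) (Ici t) t) :
    Measurable fun p : ℝ≥0 × Ω => u p.1 p.2 := by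
  have h1 : ∀ k : ℕ, Measurable fun p : ℝ≥0 × Ω => u (disc k p.1) p.2 := fun k => by
    obtain ⟨φ, hφ⟩ : ∃ φ : ℕ → ℝ≥0, ∀ t, disc k t = φ ⌊t * 2 ^ k⌋₊ :=
      ⟨fun n => (n + 1) / 2 ^ k, fun t => rfl⟩
    have h : Measurable fun p : ℕ × Ω => u (φ p.1) p.2 :=
      measurable_from_prod_countable_right fun n => hu (φ n)
    have h' : Measurable fun t : ℝ≥0 => ⌊t * 2 ^ k⌋₊ :=
      Nat.measurable_floor.comp (measurable_id.mul_const _)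
    simp only [hφ]
    exact h.comp ((h'.comp measurable_fst).prodMk measurable_snd)
  refine measurable_of_tendsto_metrizable h1 (tendsto_pi_nhds.2 fun p => ?_)
  have h2 : Tendsto (fun k => disc k p.1) atTop (𝓝[Ici p.1] p.1) :=
    (tendsto_disc p.1).mono_right (nhdsWithin_mono _ Ioi_subset_Ici_self)
  exact Tendsto.comp (hc p.2 p.1) h2

theorem isStronglyProgressive_of_rightCont {ℱ : Filtration ℝ≥0 m} {u : ℝ≥0 → Ω → β}
    (hu : ∀ t, Measurable[ℱ t] (u t))
    (hc : ∀ ω t, ContinuousWithinAt (fun s => u s ω) (Ici t) t) : IsStronglyProgressive ℱ u := by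
  intro i
  have h := measurable_of_rightCont (m := ℱ i) (u := fun t => u (min t i))
    (fun t => (hu _).mono (ℱ.mono (min_le_right _ _)) le_rfl) fun ω t => by
      refine ContinuousWithinAt.comp (f := fun s => min s i) (t := Ici (min t i)) (hc ω _)
        (continuous_id.min continuous_const).continuousWithinAt fun s hs => ?_
      exact min_le_min_right i hs
  have h2 : Measurable[Subtype.instMeasurableSpace.prod (ℱ i)]
      fun p : Iic i × Ω => u (↑(p.1)) p.2 := by
    let := ℱ i
    have h4 := h.comp (measurable_subtype_coe.prodMap (measurable_id (α := Ω)) :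
      Measurable (Prod.map (fun t : Iic i => (t : ℝ≥0)) id))
    refine (congrArg Measurable (funext fun p => ?_)).mp h4
    simp [min_eq_left (show (p.1 : ℝ≥0) ≤ i from p.1.2)]
  exact h2.stronglyMeasurable

end Progressive

/-! ### Shifting, stopping and concatenating paths -/

section Paths

variable {E : Type*} [TopologicalSpace E]

@[simp] theorem coord_shift (s t : ℝ≥0) (ω : PathSpace E) : coord s (shift t ω) = coord (s + t) ω :=
  rfl

@[simp] theorem coord_constPath (s : ℝ≥0) (x : E) : coord s (constPath x) = x := rfl

theorem coord_concatPath (s t : ℝ≥0) (ω ω' : PathSpace E) :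
    coord s (concatPath t ω ω') = if s < t then coord s ω else coord (s - t) ω' := rfl

theorem coord_concatPath_add (s t : ℝ≥0) (ω ω' : PathSpace E) :
    coord (t + s) (concatPath t ω ω') = coord s ω' := by
  rw [coord_concatPath, if_neg (by simp), add_tsub_cancel_left]

theorem path_ext {ω ω' : PathSpace E} (h : ∀ t, coord t ω = coord t ω') : ω = ω' :=
  Subtype.ext (funext h)

theorem shift_concatPath (t : ℝ≥0) (ω ω' : PathSpace E) : shift t (concatPath t ω ω') = ω' :=
  path_ext fun s => by rw [coord_shift, add_comm, coord_concatPath_add]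

/-- The path stopped at time `t`. -/
def stopPath (t : ℝ≥0) (ω : PathSpace E) : PathSpace E := concatPath t ω (constPath (coord t ω))

theorem coord_stopPath (s t : ℝ≥0) (ω : PathSpace E) :
    coord s (stopPath t ω) = coord (min s t) ω := by
  rw [stopPath, coord_concatPath]
  split_ifs with h
  · rw [min_eq_left h.le]
  · rw [min_eq_right (not_lt.1 h), coord_constPath]

theorem concatPath_stopPath_shift (t : ℝ≥0) (ω : PathSpace E) :
    concatPath t (stopPath t ω) (shift t ω) = ω := path_ext fun s => by
  rw [coord_concatPath]
  split_ifs with h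
  · rw [coord_stopPath, min_eq_left h.le]
  · rw [coord_shift, tsub_add_cancel_of_le (not_lt.1 h)]

theorem stopPath_stopPath (s t : ℝ≥0) (ω : PathSpace E) :
    stopPath s (stopPath t ω) = stopPath (min s t) ω := path_ext fun r => by
  simp only [coord_stopPath, min_assoc]

theorem stopPath_concatPath {t : ℝ≥0} {ω ω' : PathSpace E} (h : coord t ω = coord 0 ω') :
    stopPath t (concatPath t ω ω') = stopPath t ω := path_ext fun r => by
  rw [coord_stopPath, coord_stopPath, coord_concatPath]
  split_ifs with hr
  · rfl
  · have : min r t = t := le_antisymm (min_le_right _ _) (not_lt.1 hr)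
    rw [this, tsub_self, h]

theorem stopPath_add_concatPath (s t : ℝ≥0) (ω ω' : PathSpace E) :
    stopPath (t + s) (concatPath t ω ω') = concatPath t ω (stopPath s ω') := path_ext fun r => by
  rw [coord_stopPath, coord_concatPath, coord_concatPath, coord_stopPath]
  by_cases h : r < t
  · rw [if_pos h, min_eq_left (h.le.trans le_self_add), if_pos h]
  · rw [if_neg h, if_neg (by simpa using not_lt.1 h)]
    congr 1
    rcases le_total r (t + s) with h' | h'
    · rw [min_eq_left h', min_eq_left (tsub_le_iff_left.2 h')]
    · rw [min_eq_right h', add_tsub_cancel_left, min_eq_right (le_tsub_of_add_le_left h')]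

theorem coord_rightCont (ω : PathSpace E) (t : ℝ≥0) :
    ContinuousWithinAt (fun s => coord s ω) (Ici t) t := (ω.2 t).1

variable [PolishSpace E] [MeasurableSpace E] [BorelSpace E]

theorem measurable_coord_uncurry : Measurable fun p : ℝ≥0 × PathSpace E => coord p.1 p.2 :=
  measurable_of_rightCont measurable_coord coord_rightCont

theorem measurable_coord_comp {α : Type*} [MeasurableSpace α] {t : α → ℝ≥0} {w : α → PathSpace E}
    (ht : Measurable t) (hw : Measurable w) : Measurable fun a => coord (t a) (w a) :=
  measurable_coord_uncurry.comp (ht.prodMk hw)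

theorem measurable_shift_comp {α : Type*} [MeasurableSpace α] {t : α → ℝ≥0} {w : α → PathSpace E}
    (ht : Measurable t) (hw : Measurable w) : Measurable fun a => shift (t a) (w a) :=
  measurable_pathSpace.2 fun s => by
    simp only [coord_shift]
    exact measurable_coord_comp (ht.const_add s) hw

theorem measurable_constPath : Measurable (constPath (E := E)) :=
  measurable_pathSpace.2 fun _ => measurable_id

theorem measurable_concatPath_comp {α : Type*} [MeasurableSpace α] {t : α → ℝ≥0}
    {w w' : α → PathSpace E} (ht : Measurable t) (hw : Measurable w) (hw' : Measurable w') :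
    Measurable fun a => concatPath (t a) (w a) (w' a) :=
  measurable_pathSpace.2 fun s => by
    simp only [coord_concatPath]
    exact Measurable.ite (measurableSet_lt measurable_const ht) ((measurable_coord s).comp hw)
      (measurable_coord_comp (measurable_const.sub ht) hw')

theorem measurable_stopPath_comp {α : Type*} [MeasurableSpace α] {t : α → ℝ≥0}
    {w : α → PathSpace E} (ht : Measurable t) (hw : Measurable w) :
    Measurable fun a => stopPath (t a) (w a) :=
  measurable_concatPath_comp ht hw (measurable_constPath.comp (measurable_coord_comp ht hw))

theorem measurable_stopPath (t : ℝ≥0) : Measurable (stopPath (E := E) t) :=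
  measurable_stopPath_comp measurable_const measurable_id

/-! ### The raw filtration and its right-continuous hull -/

theorem measurable_coord_raw {s t : ℝ≥0} (h : s ≤ t) : Measurable[rawFiltration E t] (coord (E := E) s) :=
  (comap_measurable _).mono (le_iSup₂_of_le s h le_rfl) le_rfl

theorem measurable_stopPath_raw (t : ℝ≥0) : Measurable[rawFiltration E t] (stopPath (E := E) t) := by
  refine (measurable_pathSpace (mα := rawFiltration E t)).2 fun s => ?_
  simp only [coord_stopPath]
  exact measurable_coord_raw (min_le_right _ _)

/-- This reduces raw measurability at time `t` to invariance under stopping at `t`, as in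
Galmarino's test. -/
theorem rawFiltration_eq_comap (t : ℝ≥0) :
    (rawFiltration E t) = MeasurableSpace.comap (stopPath t) inferInstance := by
  refine le_antisymm (iSup₂_le fun s hs => ?_) (measurable_stopPath_raw t).comap_le
  have : coord (E := E) s = coord s ∘ stopPath t := by
    ext ω; simp [coord_stopPath, min_eq_left hs]
  rw [this, ← MeasurableSpace.comap_comp]
  exact MeasurableSpace.comap_mono (measurable_coord s).comap_le

theorem measurable_raw_of_stopPath {β : Type*} [MeasurableSpace β] {t : ℝ≥0} {f : PathSpace E → β}
    (hf : Measurable f) (h : ∀ ω, f (stopPath t ω) = f ω) : Measurable[rawFiltration E t] f := by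
  have : f = f ∘ stopPath t := funext fun ω => (h ω).symm
  rw [this]
  exact hf.comp (measurable_stopPath_raw t)

theorem measurableSet_raw_of_stopPath {t : ℝ≥0} {A : Set (PathSpace E)} (hA : MeasurableSet A)
    (h : ∀ ω, stopPath t ω ∈ A ↔ ω ∈ A) : MeasurableSet[rawFiltration E t] A := by
  have : A = stopPath t ⁻¹' A := by ext ω; exact (h ω).symm
  rw [this]
  exact measurable_stopPath_raw t hA

theorem stopPath_mem_iff {t : ℝ≥0} {A : Set (PathSpace E)} (hA : MeasurableSet[rawFiltration E t] A)
    (ω : PathSpace E) : stopPath t ω ∈ A ↔ ω ∈ A := by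
  rw [rawFiltration_eq_comap] at hA
  obtain ⟨B, -, rfl⟩ := hA
  simp [stopPath_stopPath]

/-- Stopping a concatenated path at `t + s` amounts to stopping its future at `s`. -/
theorem measurable_concatPath_raw (s t : ℝ≥0) (ω : PathSpace E) :
    Measurable[rawFiltration E s, rawFiltration E (t + s)] (concatPath t ω) := by
  intro A hA
  refine measurableSet_raw_of_stopPath ?_ fun ω' => ?_
  · exact measurable_concatPath_comp measurable_const measurable_const measurable_id
      ((rawFiltration E).le _ _ hA)
  · rw [mem_preimage, mem_preimage, ← stopPath_add_concatPath, stopPath_mem_iff hA]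

theorem measurableSet_hull_iff {t : ℝ≥0} {A : Set (PathSpace E)} :
    MeasurableSet[hullFiltration E t] A ↔ ∀ s > t, MeasurableSet[rawFiltration E s] A := by
  rw [hullFiltration, Filtration.rightCont_eq]
  simp only [MeasurableSpace.measurableSet_iInf]

theorem raw_le_hull (t : ℝ≥0) : rawFiltration E t ≤ hullFiltration E t :=
  (rawFiltration E).le_rightCont t

theorem hull_le_raw {s t : ℝ≥0} (h : s < t) : hullFiltration E s ≤ rawFiltration E t :=
  fun _ hA => measurableSet_hull_iff.1 hA t h

instance : (hullFiltration E).IsRightContinuous := by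
  unfold hullFiltration; infer_instance

theorem isStronglyProgressive_coord_hull : IsStronglyProgressive (hullFiltration E) (coord (E := E)) :=
  isStronglyProgressive_of_rightCont
    (fun t => (measurable_coord_raw le_rfl).mono (raw_le_hull t) le_rfl) coord_rightCont

/-- A strict inequality `τ < t` leaves room for a rational in between, and the hull at an earlier
time lies in the raw σ-algebra at `t`. -/
theorem measurableSet_inter_lt {τ : PathSpace E → WithTop ℝ≥0}
    (hτ : IsStoppingTime (hullFiltration E) τ) {A : Set (PathSpace E)}
    (hA : MeasurableSet[hτ.measurableSpace] A) (t : ℝ≥0) :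
    MeasurableSet[rawFiltration E t] (A ∩ {ω | τ ω < t}) := by
  have : A ∩ {ω | τ ω < t} = ⋃ q : ℚ≥0, ⋃ (_ : (q : ℝ≥0) < t), A ∩ {ω | τ ω ≤ (q : ℝ≥0)} := by
    ext ω
    simp only [mem_inter_iff, mem_ofPred_eq, mem_iUnion, exists_prop]
    constructor
    · rintro ⟨hA, h⟩
      lift τ ω to ℝ≥0 using (h.trans (WithTop.coe_lt_top t)).ne with s
      obtain ⟨q, hq, hq'⟩ := exists_nnrat_between (WithTop.coe_lt_coe.1 h)
      exact ⟨q, hq', hA, WithTop.coe_le_coe.2 hq.le⟩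
    · rintro ⟨q, hq, hA, h⟩
      exact ⟨hA, h.trans_lt (WithTop.coe_lt_coe.2 hq)⟩
  rw [this]
  exact MeasurableSet.iUnion fun q => MeasurableSet.iUnion fun hq => hull_le_raw hq _ (hA.2 q)

end Paths

end DPP

namespace DPP

/-! ### Optional sampling for closed right-continuous martingales -/

section Sampling

variable {Ω : Type*} {m : MeasurableSpace Ω} {P : Measure Ω} [IsFiniteMeasure P] {Y : Ω → ℝ}

/-- Conditional expectations of one integrable variable are uniformly integrable, so almost sure
convergence is convergence in L¹ and set integrals pass to the limit. The σ-algebras need not be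
monotone. -/
theorem setIntegral_eq_of_tendsto_condExp (hY : Integrable Y P) {G : ℕ → MeasurableSpace Ω}
    (hG : ∀ k, G k ≤ m) {L : ℕ → Ω → ℝ} {l : Ω → ℝ} (hL : ∀ k, L k =ᵐ[P] P[Y | G k])
    (hlim : ∀ᵐ ω ∂P, Tendsto (fun k => L k ω) atTop (𝓝 (l ω))) :
    Integrable l P ∧ ∀ A, (∀ k, MeasurableSet[G k] A) → ∫ ω in A, l ω ∂P = ∫ ω in A, Y ω ∂P := by
  have hui := hY.uniformIntegrable_condExp hG
  have hlim' : ∀ᵐ ω ∂P, Tendsto (fun k => (P[Y | G k]) ω) atTop (𝓝 (l ω)) := by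
    filter_upwards [hlim, ae_all_iff.2 hL] with ω h h'
    simpa only [h'] using h
  have hl : MemLp l 1 P := hui.memLp_of_ae_tendsto hlim'
  have hmeas : ∀ k, AEStronglyMeasurable (P[Y | G k]) P := fun k =>
    integrable_condExp.aestronglyMeasurable
  have h1 := tendsto_Lp_finite_of_tendsto_ae le_rfl ENNReal.one_ne_top hmeas hl hui.2.1 hlim'
  refine ⟨memLp_one_iff_integrable.1 hl, fun A hA => ?_⟩
  have h2 := tendsto_setIntegral_of_L1' l hl.aestronglyMeasurable
    (Eventually.of_forall fun k => integrable_condExp) h1 A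
  refine tendsto_nhds_unique h2 (tendsto_const_nhds.congr fun k => ?_)
  exact (setIntegral_condExp (hG k) hY (hA k)).symm

/-- The discretized time is at most `t` exactly when the original one is strictly below the last
dyadic `t'` not exceeding `t`. -/
theorem isStoppingTime_disc {ℱ : Filtration ℝ≥0 m} {τ : Ω → ℝ≥0}
    (hτ : IsStoppingTime ℱ fun ω => (τ ω : WithTop ℝ≥0)) (k : ℕ) :
    IsStoppingTime ℱ fun ω => ((disc k (τ ω) : ℝ≥0) : WithTop ℝ≥0) := by
  intro t
  set t' : ℝ≥0 := ⌊t * 2 ^ k⌋₊ / 2 ^ k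
  have ht' : t' ≤ t := by
    rw [div_le_iff₀ (by positivity)]
    exact Nat.floor_le (zero_le)
  have : {ω | ((disc k (τ ω) : ℝ≥0) : WithTop ℝ≥0) ≤ t} = {ω | (τ ω : WithTop ℝ≥0) < t'} := by
    ext ω
    simp only [mem_ofPred_eq, WithTop.coe_le_coe, WithTop.coe_lt_coe]
    rw [disc, div_le_iff₀ (by positivity), lt_div_iff₀ (by positivity), ← Nat.floor_lt (zero_le),
      ← Nat.add_one_le_iff, Nat.le_floor_iff (zero_le)]
    push_cast
    rfl
  rw [this]
  exact ℱ.mono ht' _ (hτ.measurableSet_lt t')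

/-- Optional sampling is immediate for the discretizations of `τ`, which take countably many values;
these decrease to `τ`, and right-continuity with uniform integrability gives the limit. -/
theorem setIntegral_stopped_eq {ℱ : Filtration ℝ≥0 m} (hY : Integrable Y P) {L : ℝ≥0 → Ω → ℝ}
    (hL : ∀ t, L t =ᵐ[P] P[Y | ℱ t])
    (hc : ∀ᵐ ω ∂P, ∀ t, ContinuousWithinAt (fun s => L s ω) (Ici t) t) {τ : Ω → ℝ≥0}
    (hτ : IsStoppingTime ℱ fun ω => (τ ω : WithTop ℝ≥0)) :
    Integrable (fun ω => L (τ ω) ω) P ∧ ∀ A, MeasurableSet[hτ.measurableSpace] A →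
      ∫ ω in A, L (τ ω) ω ∂P = ∫ ω in A, Y ω ∂P := by
  have hk := isStoppingTime_disc hτ
  have hLk : ∀ k, (fun ω => L (disc k (τ ω)) ω) =ᵐ[P] P[Y | (hk k).measurableSpace] := by
    intro k
    have huniv : (univ : Set Ω) = ⋃ n : ℕ, {ω | ((disc k (τ ω) : ℝ≥0) : WithTop ℝ≥0) =
        (((n + 1) / 2 ^ k : ℝ≥0) : WithTop ℝ≥0)} := by
      refine (eq_univ_of_forall fun ω => mem_iUnion.2 ⟨⌊τ ω * 2 ^ k⌋₊, rfl⟩).symm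
    suffices h : (fun ω => L (disc k (τ ω)) ω) =ᵐ[P.restrict (⋃ n : ℕ,
        {ω | ((disc k (τ ω) : ℝ≥0) : WithTop ℝ≥0) = (((n + 1) / 2 ^ k : ℝ≥0) : WithTop ℝ≥0)})]
        P[Y | (hk k).measurableSpace] by rwa [← huniv, Measure.restrict_univ] at h
    rw [ae_eq_restrict_iUnion_iff]
    intro n
    refine EventuallyEq.trans ?_ (condExp_stopping_time_ae_eq_restrict_eq (hk k) _).symm
    rw [EventuallyEq, ae_restrict_iff' (ℱ.le _ _ ((hk k).measurableSet_eq _))]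
    filter_upwards [hL ((n + 1) / 2 ^ k)] with ω hω hn
    rw [← hω, WithTop.coe_injective hn]
  have hlim : ∀ᵐ ω ∂P, Tendsto (fun k => L (disc k (τ ω)) ω) atTop (𝓝 (L (τ ω) ω)) := by
    filter_upwards [hc] with ω hω
    exact Tendsto.comp (hω (τ ω))
      ((tendsto_disc (τ ω)).mono_right (nhdsWithin_mono _ Ioi_subset_Ici_self))
  obtain ⟨h1, h2⟩ := setIntegral_eq_of_tendsto_condExp hY
    (fun k => (hk k).measurableSpace_le) hLk hlim
  exact ⟨h1, fun A hA => h2 A fun k => IsStoppingTime.measurableSpace_mono hτ (hk k)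
    (fun ω => WithTop.coe_le_coe.2 (lt_disc k _).le) _ hA⟩

/-- A right-continuous closed martingale remains one for the right-continuous hull: events of the
hull at `t` are known at all later dyadics, from which the limit is taken. -/
theorem condExp_rightCont_of_condExp {ℱ : Filtration ℝ≥0 m} (hY : Integrable Y P)
    {L : ℝ≥0 → Ω → ℝ} (hL : ∀ t, L t =ᵐ[P] P[Y | ℱ t])
    (hc : ∀ᵐ ω ∂P, ∀ t, ContinuousWithinAt (fun s => L s ω) (Ici t) t) (t : ℝ≥0) :
    L t =ᵐ[P] P[Y | ℱ.rightCont t] := by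
  have hlim : ∀ᵐ ω ∂P, Tendsto (fun k => L (disc k t) ω) atTop (𝓝 (L t ω)) := by
    filter_upwards [hc] with ω hω
    exact Tendsto.comp (hω t) ((tendsto_disc t).mono_right (nhdsWithin_mono _ Ioi_subset_Ici_self))
  obtain ⟨h1, h2⟩ := setIntegral_eq_of_tendsto_condExp hY (fun k => ℱ.le (disc k t))
    (fun k => hL _) hlim
  refine ae_eq_condExp_of_forall_setIntegral_eq (ℱ.rightCont.le t) hY (fun s _ _ => h1.integrableOn)
    (fun s hs _ => h2 s fun k => ?_) ?_
  · rw [Filtration.rightCont_eq] at hs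
    simp only [MeasurableSpace.measurableSet_iInf] at hs
    exact hs _ (lt_disc k t)
  · exact (stronglyMeasurable_condExp.mono (ℱ.le_rightCont t)).aestronglyMeasurable.congr (hL t).symm

end Sampling

end DPP

namespace DPP

/-! ### The exit times of the price from balls -/

section Exit

variable {d : ℕ} {F : Type*} [TopologicalSpace F]

theorem price_rightCont (ω : PathSpace (State d F)) (t : ℝ≥0) :
    ContinuousWithinAt (fun s => price s ω) (Ici t) t :=
  continuous_snd.fst.continuousAt.comp_continuousWithinAt (coord_rightCont ω t)

/-- The price has come arbitrarily close to leaving the ball of radius `n` up to time `t`. -/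
def Hit (n : ℕ) (ω : PathSpace (State d F)) (t : ℝ≥0) : Prop :=
  ∀ k : ℕ, ∃ r ≤ t, (n : ℝ) - 1 / (k + 1) < ‖price r ω‖

theorem Hit.mono {n : ℕ} {ω : PathSpace (State d F)} {s t : ℝ≥0} (h : Hit n ω s) (hst : s ≤ t) :
    Hit n ω t := fun k => let ⟨r, hr, h'⟩ := h k; ⟨r, hr.trans hst, h'⟩

theorem Hit.of_le {m n : ℕ} {ω : PathSpace (State d F)} {t : ℝ≥0} (h : Hit n ω t) (hmn : m ≤ n) :
    Hit m ω t := fun k => by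
  obtain ⟨r, hr, h'⟩ := h k
  have : (m : ℝ) ≤ n := by exact_mod_cast hmn
  exact ⟨r, hr, by linarith⟩

theorem hit_of_norm_ge {n : ℕ} {ω : PathSpace (State d F)} {r t : ℝ≥0} (hr : r ≤ t)
    (h : n ≤ ‖price r ω‖) : Hit n ω t := fun k => ⟨r, hr, by
  have : (0 : ℝ) < 1 / (k + 1) := by positivity
  linarith⟩

theorem norm_lt_of_not_hit {n : ℕ} {ω : PathSpace (State d F)} {t : ℝ≥0} (h : ¬ Hit n ω t) :
    ‖price t ω‖ < n := lt_of_not_ge fun h' => h (hit_of_norm_ge le_rfl h')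

/-- Right-continuity makes the set of times satisfying `Hit` contain its infimum. Since `Hit` speaks
of the supremum up to `t`, it also registers left limits, and the exit time is a stopping time for
the raw filtration. -/
theorem hit_of_forall_gt {n : ℕ} {ω : PathSpace (State d F)} {s : ℝ≥0}
    (h : ∀ t > s, Hit n ω t) : Hit n ω s := by
  by_contra hs
  obtain ⟨k, hk⟩ := not_forall.1 hs
  push Not at hk
  -- Moving to the next threshold leaves room above the bound at `s`, so right-continuity preserves
  -- the bound for a short while.
  have hlt : (n : ℝ) - 1 / (k + 1) < n - 1 / ((k + 1 : ℕ) + 1) := by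
    have : 1 / (((k + 1 : ℕ) : ℝ) + 1) < 1 / ((k : ℝ) + 1) := by
      apply one_div_lt_one_div_of_lt <;> push_cast <;> linarith [(Nat.cast_nonneg k : (0:ℝ) ≤ k)]
    linarith
  have hev : ∀ᶠ r in 𝓝[≥] s, ‖price r ω‖ < n - 1 / ((k + 1 : ℕ) + 1) :=
    (price_rightCont ω s).norm.eventually_lt continuousWithinAt_const ((hk s le_rfl).trans_lt hlt)
  rw [(nhdsGE_basis s).eventually_iff] at hev
  obtain ⟨b, hb, hb'⟩ := hev
  obtain ⟨t, hst, htb⟩ := exists_between hb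
  obtain ⟨r, hr, hr'⟩ := h t hst (k + 1)
  rcases le_total r s with h1 | h1
  · linarith [hk r h1]
  · linarith [hb' ⟨h1, hr.trans_lt htb⟩]

theorem hit_stopPath {n : ℕ} {ω : PathSpace (State d F)} {s t : ℝ≥0} (h : s ≤ t) :
    Hit n (stopPath t ω) s ↔ Hit n ω s := by
  refine forall_congr' fun k => exists_congr fun r => and_congr_right fun hr => ?_
  rw [price, coord_stopPath, min_eq_left (hr.trans h), price]

theorem exists_norm_le_of_isRCLL {V : Type*} [NormedAddCommGroup V] {f : ℝ≥0 → V} (hf : IsRCLL f)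
    (t : ℝ≥0) : ∃ C : ℝ, ∀ r ≤ t, ‖f r‖ ≤ C := by
  suffices h : ∃ C : ℝ, ∀ r ∈ Icc 0 t, ‖f r‖ ≤ C from
    h.imp fun C hC r hr => hC r ⟨zero_le, hr⟩
  refine isCompact_Icc.induction_on (p := fun s => ∃ C : ℝ, ∀ r ∈ s, ‖f r‖ ≤ C) ⟨0, by simp⟩
    (fun s s' hs ⟨C, hC⟩ => ⟨C, fun r hr => hC r (hs hr)⟩) ?_ ?_
  · rintro s s' ⟨C, hC⟩ ⟨C', hC'⟩
    exact ⟨max C C', fun r hr => hr.elim (fun h => (hC r h).trans (le_max_left _ _))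
      fun h => (hC' r h).trans (le_max_right _ _)⟩
  · intro s _
    obtain ⟨h1, l, h2⟩ := hf s
    have h1' : ∀ᶠ r in 𝓝[≥] s, ‖f r‖ < ‖f s‖ + 1 :=
      h1.norm.eventually_lt continuousWithinAt_const (by linarith)
    have h2' : ∀ᶠ r in 𝓝[<] s, ‖f r‖ < ‖l‖ + 1 :=
      h2.norm.eventually (gt_mem_nhds (by linarith))
    refine ⟨{r | ‖f r‖ ≤ max (‖f s‖ + 1) (‖l‖ + 1)}, mem_nhdsWithin_of_mem_nhds ?_, _, fun r hr => hr⟩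
    change ∀ᶠ r in 𝓝 s, _
    rw [← nhdsLT_sup_nhdsGE, eventually_sup]
    exact ⟨h2'.mono fun r hr => hr.le.trans (le_max_right _ _),
      h1'.mono fun r hr => hr.le.trans (le_max_left _ _)⟩

theorem isRCLL_price (ω : PathSpace (State d F)) : IsRCLL fun t => price t ω := fun t => by
  obtain ⟨-, l, hl⟩ := ω.2 t
  exact ⟨price_rightCont ω t, l.2.1, (continuous_snd.fst.tendsto l).comp hl⟩

theorem eventually_not_hit (ω : PathSpace (State d F)) (t : ℝ≥0) :
    ∀ᶠ n : ℕ in atTop, ¬ Hit n ω t := by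
  obtain ⟨C, hC⟩ := exists_norm_le_of_isRCLL (isRCLL_price ω) t
  filter_upwards [tendsto_natCast_atTop_atTop.eventually_gt_atTop (C + 1)] with n hn h
  obtain ⟨r, hr, h'⟩ := h 0
  have := hC r hr
  norm_num at h'
  linarith

/-- The minimum of `t` and the exit time. -/
def exitCap (n : ℕ) (t : ℝ≥0) (ω : PathSpace (State d F)) : ℝ≥0 :=
  open Classical in if Hit n ω t then sInf {s | Hit n ω s} else t

/-- Capping at `t` keeps the exit time finite. This equivalence is the working description:
equalities between capped exit times are proved by comparing their sublevel sets. -/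
theorem exitCap_le_iff {n : ℕ} {t r : ℝ≥0} {ω : PathSpace (State d F)} :
    exitCap n t ω ≤ r ↔ t ≤ r ∨ Hit n ω r := by
  have hmem : ∀ s, Hit n ω s → Hit n ω (sInf {s | Hit n ω s}) := fun s hs => by
    refine hit_of_forall_gt fun u hu => ?_
    obtain ⟨v, hv, hvu⟩ := exists_lt_of_csInf_lt ⟨s, hs⟩ hu
    exact Hit.mono hv hvu.le
  rw [exitCap]
  split_ifs with h
  · constructor
    · intro h'
      exact Or.inr ((hmem t h).mono h')
    · rintro (h' | h')
      · exact (csInf_le (OrderBot.bddBelow _) h).trans h'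
      · exact csInf_le (OrderBot.bddBelow _) h'
  · refine ⟨Or.inl, ?_⟩
    rintro (h' | h')
    · exact h'
    · exact le_of_not_ge fun h'' => h (h'.mono h'')

theorem exitCap_le (n : ℕ) (t : ℝ≥0) (ω : PathSpace (State d F)) : exitCap n t ω ≤ t :=
  exitCap_le_iff.2 (Or.inl le_rfl)

theorem exitCap_of_not_hit {n : ℕ} {t : ℝ≥0} {ω : PathSpace (State d F)} (h : ¬ Hit n ω t) :
    exitCap n t ω = t := if_neg h

theorem exitCap_eq_min {n : ℕ} {s t : ℝ≥0} (h : s ≤ t) (ω : PathSpace (State d F)) :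
    exitCap n s ω = min s (exitCap n t ω) := eq_of_forall_ge_iff fun r => by
  rw [min_le_iff, exitCap_le_iff, exitCap_le_iff, ← or_assoc]
  exact or_congr_left ⟨Or.inl, fun h' => h'.elim id h.trans⟩

theorem exitCap_of_hit {n : ℕ} {s t : ℝ≥0} {ω : PathSpace (State d F)} (hs : Hit n ω s)
    (h : s ≤ t) : exitCap n t ω = exitCap n s ω := eq_of_forall_ge_iff fun r => by
  rw [exitCap_le_iff, exitCap_le_iff]
  exact ⟨fun h' => Or.inr (h'.elim (fun h' => hs.mono (h.trans h')) id),
    fun h' => Or.inr (h'.elim hs.mono id)⟩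

theorem exitCap_stopPath {n : ℕ} {s t : ℝ≥0} (h : s ≤ t) (ω : PathSpace (State d F)) :
    exitCap n s (stopPath t ω) = exitCap n s ω := eq_of_forall_ge_iff fun r => by
  rw [exitCap_le_iff, exitCap_le_iff]
  rcases le_or_gt s r with h' | h'
  · simp [h']
  · rw [hit_stopPath (h'.le.trans h)]

/-- The price stopped at the exit time. -/
def stoppedPrice (n : ℕ) (t : ℝ≥0) (ω : PathSpace (State d F)) : EuclideanSpace ℝ (Fin d) :=
  price (exitCap n t ω) ω

theorem stoppedPrice_stopPath {n : ℕ} {s t : ℝ≥0} (h : s ≤ t) (ω : PathSpace (State d F)) :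
    stoppedPrice n s (stopPath t ω) = stoppedPrice n s ω := by
  rw [stoppedPrice, exitCap_stopPath h, price, coord_stopPath,
    min_eq_left ((exitCap_le n s ω).trans h)]
  rfl

theorem stoppedPrice_rightCont (n : ℕ) (ω : PathSpace (State d F)) (t : ℝ≥0) :
    ContinuousWithinAt (fun s => stoppedPrice n s ω) (Ici t) t := by
  have h : ContinuousWithinAt (fun s => price (min s (exitCap n (t + 1) ω)) ω) (Ici t) t :=
    ContinuousWithinAt.comp (f := fun s => min s (exitCap n (t + 1) ω)) (price_rightCont ω _)
      (continuous_id.min continuous_const).continuousWithinAt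
      fun s (hs : t ≤ s) => min_le_min_right _ hs
  refine h.congr_of_eventuallyEq ?_ ?_
  · filter_upwards [mem_nhdsWithin_of_mem_nhds (Iio_mem_nhds (show t < t + 1 by simp))] with s hs
    rw [stoppedPrice, exitCap_eq_min (le_of_lt hs)]
  · rw [stoppedPrice, exitCap_eq_min (show t ≤ t + 1 by simp)]

/-! ### Concatenated paths -/

variable {n : ℕ} {t v : ℝ≥0} {ω ω' : PathSpace (State d F)}

theorem hit_concatPath (h : coord t ω = coord 0 ω') {s : ℝ≥0} (hs : s ≤ t) :
    Hit n (concatPath t ω ω') s ↔ Hit n ω s := by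
  rw [← hit_stopPath hs, stopPath_concatPath h, hit_stopPath hs]

theorem hit_concatPath_add (h : coord t ω = coord 0 ω') :
    Hit n (concatPath t ω ω') (t + v) ↔ Hit n ω t ∨ Hit n ω' v := by
  have hmono : ∀ {k l : ℕ}, k ≤ l → (n : ℝ) - 1 / (k + 1) ≤ n - 1 / (l + 1) := fun {k l} hkl => by
    have : (1 : ℝ) / (l + 1) ≤ 1 / (k + 1) :=
      one_div_le_one_div_of_le (by positivity) (by have : (k : ℝ) ≤ l := by exact_mod_cast hkl
                                                   linarith)
    linarith
  constructor
  · intro hh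
    by_contra! hc
    obtain ⟨k, hk⟩ := not_forall.1 hc.1
    obtain ⟨l, hl⟩ := not_forall.1 hc.2
    push Not at hk hl
    obtain ⟨r, hr, hr'⟩ := hh (max k l)
    rcases lt_or_ge r t with h1 | h1
    · have := hk r h1.le
      rw [price, coord_concatPath, if_pos h1] at hr'
      have h3 := hmono (le_max_left k l)
      rw [price] at this
      linarith
    · obtain ⟨u, rfl⟩ := exists_add_of_le h1
      have := hl u (by simpa using hr)
      rw [price, coord_concatPath_add] at hr'
      have h3 := hmono (le_max_right k l)
      rw [price] at this
      linarith
  · rintro (h1 | h1)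
    · exact ((hit_concatPath h le_rfl).2 h1).mono (by simp)
    · intro k
      obtain ⟨r, hr, hr'⟩ := h1 k
      refine ⟨t + r, by simpa using hr, ?_⟩
      rw [price, coord_concatPath_add]
      exact hr'

theorem stoppedPrice_concatPath_of_le (h : coord t ω = coord 0 ω') {s : ℝ≥0} (hs : s ≤ t) :
    stoppedPrice n s (concatPath t ω ω') = stoppedPrice n s ω := by
  rw [← stoppedPrice_stopPath hs, stopPath_concatPath h, stoppedPrice_stopPath hs]

theorem stoppedPrice_of_hit {s : ℝ≥0} (hh : Hit n ω t) (hs : t ≤ s) :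
    stoppedPrice n s ω = stoppedPrice n t ω := by
  rw [stoppedPrice, exitCap_of_hit hh hs, stoppedPrice]

theorem stoppedPrice_concatPath_of_hit (h : coord t ω = coord 0 ω') (hh : Hit n ω t) {s : ℝ≥0}
    (hs : t ≤ s) : stoppedPrice n s (concatPath t ω ω') = stoppedPrice n t ω := by
  rw [stoppedPrice_of_hit ((hit_concatPath h le_rfl).2 hh) hs,
    stoppedPrice_concatPath_of_le h le_rfl]

/-- Without an exit by time `t`, the exit clock of the concatenated path is that of the second path,
delayed by `t`. -/
theorem stoppedPrice_concatPath_add (h : coord t ω = coord 0 ω') (hh : ¬ Hit n ω t) :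
    stoppedPrice n (t + v) (concatPath t ω ω') = stoppedPrice n v ω' := by
  have : exitCap n (t + v) (concatPath t ω ω') = t + exitCap n v ω' :=
    eq_of_forall_ge_iff fun r => by
      rw [exitCap_le_iff]
      rcases lt_or_ge r t with h1 | h1
      · rw [hit_concatPath h h1.le]
        refine iff_of_false ?_ fun h2 => (h1.trans_le ((le_self_add).trans h2)).false
        rintro (h2 | h2)
        · exact (h1.trans_le ((le_self_add).trans h2)).false
        · exact hh (h2.mono h1.le)
      · obtain ⟨u, rfl⟩ := exists_add_of_le h1
        rw [hit_concatPath_add h, add_le_add_iff_left, add_le_add_iff_left, exitCap_le_iff]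
        simp [hh]
  rw [stoppedPrice, this, price, coord_concatPath_add]
  rfl

/-! ### The exit time as a stopping time -/

/-- The exit time of the price from the ball of radius `n`. -/
def exitTime (n : ℕ) (ω : PathSpace (State d F)) : WithTop ℝ≥0 :=
  open Classical in if ∃ t, Hit n ω t then ((sInf {s | Hit n ω s} : ℝ≥0) : WithTop ℝ≥0) else ⊤

theorem min_exitTime (n : ℕ) (t : ℝ≥0) (ω : PathSpace (State d F)) :
    min (t : WithTop ℝ≥0) (exitTime n ω) = exitCap n t ω := by
  by_cases h : ∃ s, Hit n ω s
  · rw [exitTime, if_pos h, ← WithTop.coe_min]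
    obtain ⟨s, hs⟩ := h
    have h1 : exitCap n (max s t) ω = sInf {s | Hit n ω s} := by
      rw [exitCap, if_pos (hs.mono (le_max_left _ _))]
    rw [← h1, ← exitCap_eq_min (le_max_right _ _)]
  · rw [exitTime, if_neg h, min_eq_left le_top, exitCap_of_not_hit fun h' => h ⟨t, h'⟩]

theorem exitTime_le_iff : exitTime n ω ≤ (t : WithTop ℝ≥0) ↔ Hit n ω t := by
  have h1 := min_exitTime n (t + 1) ω
  have h2 : exitTime n ω ≤ (t : WithTop ℝ≥0) ↔ exitCap n (t + 1) ω ≤ t := by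
    rw [← WithTop.coe_le_coe (b := exitCap n (t + 1) ω), ← h1, min_le_iff, WithTop.coe_le_coe]
    simp
  rw [h2, exitCap_le_iff]
  simp

theorem stoppedProcess_exitTime (n : ℕ) (t : ℝ≥0) (ω : PathSpace (State d F)) :
    stoppedProcess price (exitTime n) t ω = stoppedPrice n t ω := by
  rw [stoppedProcess, min_exitTime, stoppedPrice]
  rfl

theorem exitTime_mono (ω : PathSpace (State d F)) : Monotone fun n => exitTime n ω := by
  intro m n hmn
  change exitTime m ω ≤ exitTime n ω
  rcases eq_or_ne (exitTime n ω) ⊤ with h | h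
  · rw [h]; exact le_top
  · lift exitTime n ω to ℝ≥0 using h with s hs
    exact exitTime_le_iff.2 ((exitTime_le_iff.1 hs.ge).of_le hmn)

theorem tendsto_exitTime (ω : PathSpace (State d F)) :
    Tendsto (fun n => exitTime n ω) atTop (𝓝 ⊤) := by
  refine tendsto_order.2 ⟨fun a ha => ?_, fun a ha => absurd ha (not_lt_of_ge le_top)⟩
  lift a to ℝ≥0 using ha.ne
  filter_upwards [eventually_not_hit ω a] with n hn
  exact lt_of_not_ge fun h => hn (exitTime_le_iff.1 h)

theorem exitCap_le_of_norm_ge {r : ℝ≥0} (h : n ≤ ‖price r ω‖) : exitCap n t ω ≤ r :=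
  exitCap_le_iff.2 (Or.inr (hit_of_norm_ge le_rfl h))

/-- The exit time never exceeds the first time at which the norm is at least `n`, because it also
reacts to left limits. A lower bound for the price stopped at the latter therefore bounds
`stoppedPrice`. -/
theorem stoppedProcess_priceHitting_exitCap (n : ℕ) (t : ℝ≥0) (ω : PathSpace (State d F)) :
    stoppedProcess price (priceHitting d F n) (exitCap n t ω) ω = stoppedPrice n t ω := by
  have h : (exitCap n t ω : WithTop ℝ≥0) ≤ priceHitting d F n ω := by
    by_cases h : ∃ j, 0 ≤ j ∧ price j ω ∈ {s : EuclideanSpace ℝ (Fin d) | (n : ℝ) ≤ ‖s‖}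
    · rw [priceHitting, hittingAfter, if_pos h, WithTop.coe_le_coe]
      exact le_csInf h fun r hr => exitCap_le_of_norm_ge hr.2
    · rw [priceHitting, hittingAfter, if_neg h]
      exact le_top
  rw [stoppedProcess, min_eq_left h]
  rfl

end Exit

/-! ### Measurability of exit times and stopped prices -/

section ExitMeasurable

variable {d : ℕ} {F : Type*} [TopologicalSpace F] [PolishSpace F] [MeasurableSpace F] [BorelSpace F]

theorem measurable_price_comp {α : Type*} [MeasurableSpace α] {t : α → ℝ≥0}
    {w : α → PathSpace (State d F)} (ht : Measurable t) (hw : Measurable w) :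
    Measurable fun a => price (t a) (w a) :=
  (measurable_coord_comp ht hw).snd.fst

theorem measurableSet_hit_aux (n : ℕ) (t : ℝ≥0) :
    MeasurableSet {ω : PathSpace (State d F) | Hit n ω t} := by
  -- By right-continuity a strict inequality before `t` persists at some rational; truncation at `t`
  -- lets larger rationals account for the endpoint.
  have : {ω : PathSpace (State d F) | Hit n ω t} = ⋂ k : ℕ, ⋃ q : ℚ≥0,
      {ω | (n : ℝ) - 1 / (k + 1) < ‖price (min (q : ℝ≥0) t) ω‖} := by
    ext ω
    simp only [mem_ofPred_eq, mem_iInter, mem_iUnion]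
    refine forall_congr' fun k => ⟨?_, fun ⟨q, hq⟩ => ⟨_, min_le_right _ _, hq⟩⟩
    rintro ⟨r, hr, h⟩
    rcases hr.eq_or_lt with rfl | hr
    · obtain ⟨q, hq, -⟩ := exists_nnrat_between (show r < r + 1 by simp)
      exact ⟨q, by rwa [min_eq_right hq.le]⟩
    · have hev : ∀ᶠ s in 𝓝[≥] r, (n : ℝ) - 1 / (k + 1) < ‖price s ω‖ :=
        continuousWithinAt_const.eventually_lt (price_rightCont ω r).norm h
      rw [(nhdsGE_basis r).eventually_iff] at hev
      obtain ⟨b, hb, hb'⟩ := hev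
      obtain ⟨q, hq, hq'⟩ := exists_nnrat_between (lt_min hb hr)
      refine ⟨q, ?_⟩
      rw [min_eq_left (hq'.le.trans (min_le_right _ _))]
      exact hb' ⟨hq.le, hq'.trans_le (min_le_left _ _)⟩
  rw [this]
  exact MeasurableSet.iInter fun k => MeasurableSet.iUnion fun q =>
    measurableSet_lt measurable_const (measurable_price_comp measurable_const measurable_id).norm

theorem measurableSet_hit {s t : ℝ≥0} (n : ℕ) (h : s ≤ t) :
    MeasurableSet[rawFiltration (State d F) t] {ω : PathSpace (State d F) | Hit n ω s} :=
  measurableSet_raw_of_stopPath (measurableSet_hit_aux n s) fun _ => hit_stopPath h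

theorem measurable_exitCap (n : ℕ) (t : ℝ≥0) : Measurable (exitCap (d := d) (F := F) n t) := by
  refine measurable_of_Iic fun r => ?_
  have : exitCap (d := d) (F := F) n t ⁻¹' Iic r = {ω | t ≤ r ∨ Hit n ω r} := by
    ext ω; exact exitCap_le_iff
  rw [this]
  by_cases h : t ≤ r
  · simp [h]
  · simp only [h, false_or]
    exact measurableSet_hit_aux n r

theorem measurable_stoppedPrice (n : ℕ) (t : ℝ≥0) :
    Measurable (stoppedPrice (d := d) (F := F) n t) :=
  measurable_price_comp (measurable_exitCap n t) measurable_id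

theorem measurable_stoppedPrice_raw (n : ℕ) {s t : ℝ≥0} (h : s ≤ t) :
    Measurable[rawFiltration (State d F) t] (stoppedPrice (d := d) (F := F) n s) :=
  measurable_raw_of_stopPath (measurable_stoppedPrice n s) fun ω => stoppedPrice_stopPath h ω

theorem isStoppingTime_exitTime (n : ℕ) :
    IsStoppingTime (rawFiltration (State d F)) (exitTime (d := d) (F := F) n) := fun t => by
  simp only [exitTime_le_iff]
  exact measurableSet_hit n le_rfl

end ExitMeasurable

end DPP

namespace DPP

/-! ### Local martingale measures in terms of Lebesgue integrals -/

section LocalMartingale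

variable {d : ℕ} {F : Type*} [TopologicalSpace F] [PolishSpace F] [MeasurableSpace F] [BorelSpace F]

/-- Either the exit has not happened by `s`, and the norm is below `n`, or the price is frozen
between `s` and `t`. This is the domination used in the limits below. -/
theorem abs_stoppedPrice_le {n : ℕ} {s t : ℝ≥0} (h : s ≤ t) (ω : PathSpace (State d F))
    (i : Fin d) : |stoppedPrice n s ω i| ≤ n + |stoppedPrice n t ω i| := by
  rw [stoppedPrice, exitCap_eq_min h]
  rcases lt_or_ge s (exitCap n t ω) with h' | h'
  · rw [min_eq_left h'.le]
    have hs : ¬ Hit n ω s := fun hs => h'.not_ge (exitCap_le_iff.2 (Or.inr hs))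
    have h1 := (PiLp.norm_apply_le (price s ω) i).trans (norm_lt_of_not_hit hs).le
    rw [Real.norm_eq_abs] at h1
    linarith [abs_nonneg (stoppedPrice n t ω i)]
  · rw [min_eq_right h', ← stoppedPrice]
    linarith [(Nat.cast_nonneg n : (0:ℝ) ≤ n)]

theorem measurable_eval (i : Fin d) : Measurable fun x : EuclideanSpace ℝ (Fin d) => x i := by
  fun_prop

theorem continuous_eval (i : Fin d) : Continuous fun x : EuclideanSpace ℝ (Fin d) => x i := by
  fun_prop

/-- The excess of a coordinate of the stopped price over the level `a`. -/
def slack (a : ℝ) (n : ℕ) (i : Fin d) (t : ℝ≥0) (ω : PathSpace (State d F)) : ℝ≥0∞ :=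
  ENNReal.ofReal (stoppedPrice n t ω i - a)

/-- The martingale property of the stopped price, in terms of its excess over a lower bound. -/
def SlackMartingale (a : ℝ) (n : ℕ) (Q : Measure (PathSpace (State d F))) : Prop :=
  ∀ (i : Fin d) (s t : ℝ≥0), s ≤ t → ∀ A, MeasurableSet[rawFiltration (State d F) s] A →
    ∫⁻ ω in A, slack a n i t ω ∂Q = ∫⁻ ω in A, slack a n i s ω ∂Q

/-- The paths of the stopped price are bounded below by `a`. -/
def BoundedBelow (a : ℝ) (n : ℕ) (Q : Measure (PathSpace (State d F))) : Prop :=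
  ∀ᵐ ω ∂Q, ∀ (t : ℝ≥0) (i : Fin d), a ≤ stoppedPrice n t ω i

theorem measurable_slack (a : ℝ) (n : ℕ) (i : Fin d) (t : ℝ≥0) :
    Measurable (slack (F := F) a n i t) :=
  (((measurable_eval i).comp (measurable_stoppedPrice n t)).sub_const a).ennreal_ofReal

theorem measurable_stoppedPrice_eval (n : ℕ) (i : Fin d) (t : ℝ≥0) :
    Measurable fun ω : PathSpace (State d F) => stoppedPrice n t ω i :=
  (measurable_eval i).comp (measurable_stoppedPrice n t)

variable {a : ℝ} {n : ℕ} {Q : Measure (PathSpace (State d F))} [IsProbabilityMeasure Q]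

theorem lintegral_slack (hb : BoundedBelow a n Q) (i : Fin d) (t : ℝ≥0)
    (h : Integrable (fun ω => stoppedPrice n t ω i) Q) (A : Set (PathSpace (State d F))) :
    ∫⁻ ω in A, slack a n i t ω ∂Q =
      ENNReal.ofReal (∫ ω in A, (stoppedPrice n t ω i - a) ∂Q) :=
  (ofReal_integral_eq_lintegral_ofReal (h.sub (integrable_const a)).integrableOn
    (ae_restrict_of_ae (hb.mono fun _ hω => sub_nonneg.2 (hω t i)))).symm

theorem integrable_stoppedPrice_iff (hb : BoundedBelow a n Q) (i : Fin d) (t : ℝ≥0) :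
    Integrable (fun ω => stoppedPrice n t ω i) Q ↔ ∫⁻ ω, slack a n i t ω ∂Q < ⊤ := by
  have h1 : Integrable (fun ω => stoppedPrice n t ω i - a) Q ↔ ∫⁻ ω, slack a n i t ω ∂Q < ⊤ := by
    have h2 : AEStronglyMeasurable (fun ω => stoppedPrice n t ω i - a) Q :=
      ((measurable_stoppedPrice_eval n i t).sub_const a).aestronglyMeasurable
    rw [Integrable, hasFiniteIntegral_iff_ofReal (hb.mono fun ω hω => sub_nonneg.2 (hω t i))]
    simp only [h2, true_and, slack]
  rw [← h1]
  exact ⟨fun h => h.sub (integrable_const a), fun h =>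
    (h.add (integrable_const a)).congr (Eventually.of_forall fun ω => by simp)⟩

theorem setIntegral_stoppedPrice_eq (hb : BoundedBelow a n Q) (i : Fin d) {s t : ℝ≥0}
    (hs : Integrable (fun ω => stoppedPrice n s ω i) Q)
    (ht : Integrable (fun ω => stoppedPrice n t ω i) Q) (A : Set (PathSpace (State d F))) :
    ∫⁻ ω in A, slack a n i t ω ∂Q = ∫⁻ ω in A, slack a n i s ω ∂Q ↔
      ∫ ω in A, stoppedPrice n t ω i ∂Q = ∫ ω in A, stoppedPrice n s ω i ∂Q := by
  have hnn : ∀ t, 0 ≤ ∫ ω in A, (stoppedPrice n t ω i - a) ∂Q := fun t =>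
    integral_nonneg_of_ae (ae_restrict_of_ae (hb.mono fun ω hω => sub_nonneg.2 (hω t i)))
  rw [lintegral_slack hb i t ht, lintegral_slack hb i s hs,
    ENNReal.ofReal_eq_ofReal_iff (hnn t) (hnn s),
    integral_sub ht.integrableOn (integrable_const a).integrableOn,
    integral_sub hs.integrableOn (integrable_const a).integrableOn, sub_left_inj]

theorem SlackMartingale.integrable (hm : SlackMartingale a n Q) (hb : BoundedBelow a n Q)
    (h0 : ∀ i, Integrable (fun ω => stoppedPrice n 0 ω i) Q) (i : Fin d) (t : ℝ≥0) :
    Integrable (fun ω => stoppedPrice n t ω i) Q := by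
  have h := hm i 0 t (zero_le) univ MeasurableSet.univ
  simp only [Measure.restrict_univ] at h
  rw [integrable_stoppedPrice_iff hb, h, ← integrable_stoppedPrice_iff hb]
  exact h0 i

theorem SlackMartingale.condExp_raw (hm : SlackMartingale a n Q) (hb : BoundedBelow a n Q)
    (h0 : ∀ i, Integrable (fun ω => stoppedPrice n 0 ω i) Q) (i : Fin d) (t r : ℝ≥0) :
    (fun ω => stoppedPrice n (min r t) ω i) =ᵐ[Q]
      Q[fun ω => stoppedPrice n t ω i | rawFiltration (State d F) r] := by
  have hi := hm.integrable hb h0 i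
  refine ae_eq_condExp_of_forall_setIntegral_eq ((rawFiltration _).le r) (hi t)
    (fun s _ _ => (hi _).integrableOn) (fun A hA _ => ?_) ?_
  · rcases le_total r t with h | h
    · rw [min_eq_left h]
      exact ((setIntegral_stoppedPrice_eq hb i (hi r) (hi t) A).1 (hm i r t h A hA)).symm
    · rw [min_eq_right h]
  · exact ((measurable_eval i).comp
      (measurable_stoppedPrice_raw n (min_le_left r t))).stronglyMeasurable.aestronglyMeasurable

theorem stoppedPrice_min_rightCont (n : ℕ) (i : Fin d) (t : ℝ≥0) (ω : PathSpace (State d F))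
    (r : ℝ≥0) : ContinuousWithinAt (fun s => stoppedPrice n (min s t) ω i) (Ici r) r := by
  refine (continuous_eval i).continuousAt.comp_continuousWithinAt
    (ContinuousWithinAt.comp (f := fun s => min s t) (t := Ici (min r t))
      (stoppedPrice_rightCont n ω _) (continuous_id.min continuous_const).continuousWithinAt
      fun s (hs : r ≤ s) => min_le_min_right t hs)

/-- Optional sampling for the stopped price. -/
theorem SlackMartingale.setIntegral_stopped (hm : SlackMartingale a n Q) (hb : BoundedBelow a n Q)
    (h0 : ∀ i, Integrable (fun ω => stoppedPrice n 0 ω i) Q) (i : Fin d) (t : ℝ≥0)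
    {τ : PathSpace (State d F) → ℝ≥0}
    (hτ : IsStoppingTime (hullFiltration (State d F)) fun ω => (τ ω : WithTop ℝ≥0)) :
    Integrable (fun ω => stoppedPrice n (min (τ ω) t) ω i) Q ∧
      ∀ A, MeasurableSet[hτ.measurableSpace] A →
        ∫ ω in A, stoppedPrice n (min (τ ω) t) ω i ∂Q = ∫ ω in A, stoppedPrice n t ω i ∂Q := by
  have hc : ∀ᵐ ω ∂Q, ∀ r, ContinuousWithinAt (fun s => stoppedPrice n (min s t) ω i) (Ici r) r :=
    Eventually.of_forall fun ω r => stoppedPrice_min_rightCont n i t ω r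
  exact setIntegral_stopped_eq (hm.integrable hb h0 i t)
    (L := fun r ω => stoppedPrice n (min r t) ω i)
    (condExp_rightCont_of_condExp (hm.integrable hb h0 i t) (hm.condExp_raw hb h0 i t) hc) hc hτ

theorem SlackMartingale.lintegral_stopped (hm : SlackMartingale a n Q) (hb : BoundedBelow a n Q)
    (h0 : ∀ i, Integrable (fun ω => stoppedPrice n 0 ω i) Q) (i : Fin d) (t : ℝ≥0)
    {τ : PathSpace (State d F) → ℝ≥0}
    (hτ : IsStoppingTime (hullFiltration (State d F)) fun ω => (τ ω : WithTop ℝ≥0))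
    {A : Set (PathSpace (State d F))} (hA : MeasurableSet[hτ.measurableSpace] A) :
    ∫⁻ ω in A, slack a n i (min (τ ω) t) ω ∂Q = ∫⁻ ω in A, slack a n i t ω ∂Q := by
  obtain ⟨h1, h2⟩ := hm.setIntegral_stopped hb h0 i t hτ
  have hi := hm.integrable hb h0 i t
  rw [lintegral_slack hb i t hi]
  have h3 : ∫ ω in A, (stoppedPrice n t ω i - a) ∂Q =
      ∫ ω in A, (stoppedPrice n (min (τ ω) t) ω i - a) ∂Q := by
    rw [integral_sub h1.integrableOn (integrable_const a).integrableOn,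
      integral_sub hi.integrableOn (integrable_const a).integrableOn, h2 A hA]
  rw [h3, ofReal_integral_eq_lintegral_ofReal (f := fun ω => stoppedPrice n (min (τ ω) t) ω i - a)
    (h1.sub (integrable_const a)).integrableOn
    (ae_restrict_of_ae (hb.mono fun ω hω => sub_nonneg.2 (hω (min (τ ω) t) i)))]
  rfl

/-- The exit times from the balls of radius at least `m` are a localizing sequence, and the stopped
coordinates are integrable because their slack keeps its finite initial integral. -/
theorem isLocalMartingalePrice_of_slackMartingale {a : ℕ → ℝ} {m : ℕ}
    (hm : ∀ n ≥ m, SlackMartingale (a n) n Q) (hb : ∀ n ≥ m, BoundedBelow (a n) n Q)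
    (h0 : ∀ᵐ ω ∂Q, ‖price 0 ω‖ < m) : IsLocalMartingalePrice Q := by
  have hint : ∀ n i, Integrable (fun ω => stoppedPrice n 0 ω i) Q := fun n i => by
    refine Integrable.of_bound (measurable_stoppedPrice_eval n i 0).aestronglyMeasurable m ?_
    filter_upwards [h0] with ω hω
    have : exitCap n 0 ω = 0 := le_antisymm (exitCap_le _ _ _) (zero_le)
    rw [stoppedPrice, this]
    exact (PiLp.norm_apply_le _ i).trans hω.le
  refine ⟨fun k => exitTime (m + k), ⟨⟨fun k => isStoppingTime_exitTime _,
    Eventually.of_forall fun ω => (tendsto_exitTime ω).comp (tendsto_atTop_mono (fun k => Nat.le_add_left k m) tendsto_id)⟩,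
    Eventually.of_forall fun ω k l h => exitTime_mono ω (by gcongr)⟩, fun k => ?_⟩
  set n := m + k
  have hn : m ≤ n := Nat.le_add_right _ _
  have hV : ∀ t ω, stoppedProcess (fun i => {ω | ⊥ < exitTime n ω}.indicator (price i))
      (exitTime n) t ω = {ω | ¬ Hit n ω 0}.indicator (stoppedPrice n t) ω := fun t ω => by
    rw [stoppedProcess_indicator_comm]
    have : {ω : PathSpace (State d F) | ⊥ < exitTime n ω} = {ω | ¬ Hit n ω 0} := by
      ext ω
      rw [mem_ofPred_eq, mem_ofPred_eq, ← exitTime_le_iff, not_le]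
      rfl
    rw [this]
    by_cases h : ω ∈ {ω : PathSpace (State d F) | ¬ Hit n ω 0}
    · rw [indicator_of_mem h, indicator_of_mem h, stoppedProcess_exitTime]
    · rw [indicator_of_notMem h, indicator_of_notMem h]
  have hae : ∀ t, stoppedProcess (fun i => {ω | ⊥ < exitTime n ω}.indicator (price i))
      (exitTime n) t =ᵐ[Q] stoppedPrice n t := fun t => by
    filter_upwards [h0] with ω hω
    rw [hV, indicator_of_mem]
    intro h
    -- The strict bound on the initial norm leaves a margin, so time `0` is not an exit and the
    -- indicator in the localized process is almost surely `1`.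
    obtain ⟨l, hl⟩ : ∃ l : ℕ, (1 : ℝ) / (l + 1) < m - ‖price 0 ω‖ :=
      exists_nat_one_div_lt (sub_pos.2 hω)
    obtain ⟨r, hr, hr'⟩ := h l
    rw [nonpos_iff_eq_zero.1 hr] at hr'
    have : (m : ℝ) ≤ n := by exact_mod_cast hn
    linarith
  have hi := fun i => (hm n hn).integrable (hb n hn) (hint n) i
  have hI : ∀ t, Integrable (stoppedPrice n t) Q := fun t =>
    integrable_piLp_iff.2 fun i => hi i t
  refine ⟨fun t => ?_, fun s t hst => ?_⟩
  · have : stoppedProcess (fun i => {ω | ⊥ < exitTime n ω}.indicator (price i)) (exitTime n) t =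
      {ω : PathSpace (State d F) | ¬ Hit n ω 0}.indicator (stoppedPrice n t) := funext (hV t)
    rw [this]
    exact (Measurable.indicator (measurable_stoppedPrice_raw n le_rfl)
      (measurableSet_hit n (zero_le)).compl).stronglyMeasurable
  · refine (condExp_congr_ae (hae t)).trans (EventuallyEq.trans ?_ (hae s).symm)
    refine (ae_eq_condExp_of_forall_setIntegral_eq ((rawFiltration _).le s) (hI t)
      (fun A _ _ => (hI s).integrableOn) (fun A hA _ => ?_)
      (measurable_stoppedPrice_raw n le_rfl).stronglyMeasurable.aestronglyMeasurable).symm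
    ext i
    rw [eval_integral_piLp (fun i => (hi i s).integrableOn),
      eval_integral_piLp (fun i => (hi i t).integrableOn)]
    exact ((setIntegral_stoppedPrice_eq (hb n hn) i (hi i s) (hi i t) A).1
      (hm n hn i s t hst A hA)).symm

/-- An arbitrary localizing sequence can be removed. The lower bound permits Fatou, giving
integrability of the stopped price; the estimate by `n` plus its value at the later time then gives
dominated convergence. -/
theorem slackMartingale_of_isLocalMartingalePrice (hQ : IsLocalMartingalePrice Q)
    (hb : BoundedBelow a n Q) (h0 : ∀ i, Integrable (fun ω => stoppedPrice n 0 ω i) Q) :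
    SlackMartingale a n Q := by
  obtain ⟨σ, hσ, hmart⟩ := hQ
  let V : ℕ → ℝ≥0 → PathSpace (State d F) → EuclideanSpace ℝ (Fin d) := fun k =>
    stoppedProcess (fun i => {ω | ⊥ < σ k ω}.indicator (price i)) (σ k)
  have hV : ∀ k t ω, ⊥ < σ k ω → V k t ω = price (min (t : WithTop ℝ≥0) (σ k ω)).untopA ω :=
    fun k t ω h => by
      change stoppedProcess (fun i => {ω | ⊥ < σ k ω}.indicator (price i)) (σ k) t ω = _
      rw [stoppedProcess_indicator_comm, indicator_of_mem (show ω ∈ {ω | ⊥ < σ k ω} from h),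
        stoppedProcess]
  -- the stopped price, stopped once more
  have hVM : ∀ k (t : ℝ≥0) ω, ⊥ < σ k ω → ∃ u ≤ t, (t ≤ σ k ω → u = t) ∧
      V k (exitCap n t ω) ω = stoppedPrice n u ω := fun k t ω h => by
    rw [hV k _ ω h]
    rcases le_total (t : WithTop ℝ≥0) (σ k ω) with h1 | h1
    · refine ⟨t, le_rfl, fun _ => rfl, ?_⟩
      rw [min_eq_left ((WithTop.coe_le_coe.2 (exitCap_le n t ω)).trans h1)]
      rfl
    · obtain ⟨u, hu⟩ := WithTop.ne_top_iff_exists.1 (h1.trans_lt (WithTop.coe_lt_top t)).ne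
      rw [← hu] at h1 ⊢
      have hut : u ≤ t := WithTop.coe_le_coe.1 h1
      refine ⟨u, hut, fun h2 => le_antisymm hut (WithTop.coe_le_coe.1 h2), ?_⟩
      rw [← WithTop.coe_min, stoppedPrice, exitCap_eq_min hut, min_comm]
      rfl
  have hrc : ∀ k ω t, ContinuousWithinAt (fun s => V k s ω) (Ici t) t := fun k ω t => by
    by_cases h : ⊥ < σ k ω
    · simp only [hV k _ ω h]
      rcases eq_or_ne (σ k ω) ⊤ with h1 | h1
      · simp only [h1, min_eq_left le_top]
        exact price_rightCont ω t
      · obtain ⟨u, hu⟩ := WithTop.ne_top_iff_exists.1 h1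
        simp only [← hu, ← WithTop.coe_min]
        exact ContinuousWithinAt.comp (f := fun s => min s u) (t := Ici (min t u))
          (price_rightCont ω _) (continuous_id.min continuous_const).continuousWithinAt
          fun s (hs : t ≤ s) => min_le_min_right u hs
    · have : ∀ s, V k s ω = 0 := fun s => by
        change stoppedProcess (fun i => {ω | ⊥ < σ k ω}.indicator (price i)) (σ k) s ω = _
        rw [stoppedProcess_indicator_comm, indicator_of_notMem (show ω ∉ {ω | ⊥ < σ k ω} from h)]
      simp only [this]
      exact continuousWithinAt_const
  have hcap : ∀ t, IsStoppingTime (rawFiltration (State d F)) fun ω =>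
      ((exitCap n t ω : ℝ≥0) : WithTop ℝ≥0) := fun t r => by
    simp only [WithTop.coe_le_coe, exitCap_le_iff]
    by_cases h : t ≤ r
    · simp [h]
    · simpa only [h, false_or] using measurableSet_hit n le_rfl
  have hσ0 : ∀ k s, MeasurableSet[rawFiltration (State d F) s] {ω | ⊥ < σ k ω} := fun k s =>
    (rawFiltration _).mono (zero_le) _ ((hσ.isStoppingTime k).measurableSet_gt 0)
  -- optional sampling of the localized martingales
  have hopt : ∀ k i t, Integrable (fun ω => V k (exitCap n t ω) ω i) Q ∧
      ∀ s ≤ t, ∀ A, MeasurableSet[rawFiltration (State d F) s] A →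
      ∫ ω in A, V k (exitCap n t ω) ω i ∂Q = ∫ ω in A, V k (exitCap n s ω) ω i ∂Q := by
    intro k i t
    have hY : Integrable (fun ω => V k t ω i) Q :=
      integrable_piLp_iff.1 ((hmart k).integrable t) i
    have hL : ∀ r, (fun ω => V k (min r t) ω i) =ᵐ[Q]
        Q[fun ω => V k t ω i | rawFiltration (State d F) r] := fun r => by
      have h1 := (EuclideanSpace.proj (𝕜 := ℝ) i).comp_condExp_comm
        (m := rawFiltration (State d F) r) ((hmart k).integrable t)
      rcases le_total r t with h | h
      · rw [min_eq_left h]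
        refine EventuallyEq.trans ?_ h1
        filter_upwards [(hmart k).2 r t h] with ω hω
        simp only [Function.comp_apply]
        rw [hω]
        rfl
      · rw [min_eq_right h, condExp_of_stronglyMeasurable ((rawFiltration _).le r) _ hY]
        exact ((continuous_eval i).comp_stronglyMeasurable ((hmart k).1 t)).mono
          ((rawFiltration _).mono h)
    have hc : ∀ᵐ ω ∂Q, ∀ r, ContinuousWithinAt (fun s => V k (min s t) ω i) (Ici r) r := by
      refine Eventually.of_forall fun ω r => ?_
      have h : ContinuousWithinAt (fun s => V k (min s t) ω) (Ici r) r :=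
        ContinuousWithinAt.comp (f := fun s => min s t) (t := Ici (min r t))
          (hrc k ω _) (continuous_id.min continuous_const).continuousWithinAt
          fun s (hs : r ≤ s) => min_le_min_right t hs
      exact (continuous_eval i).continuousAt.comp_continuousWithinAt h
    have hmain := fun s : ℝ≥0 => setIntegral_stopped_eq hY
      (L := fun r ω => V k (min r t) ω i) hL hc (hcap s)
    have hred : ∀ s ≤ t, ∀ ω : PathSpace (State d F), min (exitCap n s ω) t = exitCap n s ω := fun s hs ω =>
      min_eq_left ((exitCap_le n s ω).trans hs)
    have hmain' : ∀ s ≤ t, Integrable (fun ω => V k (exitCap n s ω) ω i) Q ∧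
        ∀ A, MeasurableSet[(hcap s).measurableSpace] A →
        ∫ ω in A, V k (exitCap n s ω) ω i ∂Q = ∫ ω in A, V k t ω i ∂Q := fun s hs => by
      have := hmain s
      simp only [hred s hs] at this
      exact this
    refine ⟨(hmain' t le_rfl).1, fun s hs A hA => ?_⟩
    have hAm := (rawFiltration (State d F)).le s A hA
    have hH : MeasurableSet {ω : PathSpace (State d F) | Hit n ω s} := measurableSet_hit_aux n s
    -- `A` itself need not belong to the past of the capped exit time. Off the exit event it does,
    -- so sampling applies; on the exit event the capped times at `s` and `t` coincide.
    have hB : MeasurableSet[(hcap s).measurableSpace] (A \ {ω | Hit n ω s}) := by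
      refine ⟨le_iSup (fun r => (rawFiltration (State d F)) r) s _
        (hA.diff (measurableSet_hit n le_rfl)), fun r => ?_⟩
      rcases le_or_gt s r with h | h
      · exact ((rawFiltration _).mono h _ (hA.diff (measurableSet_hit n le_rfl))).inter (hcap s r)
      · convert MeasurableSet.empty using 1
        refine eq_empty_of_forall_notMem ?_
        rintro ω ⟨⟨-, h1⟩, h2⟩
        rcases exitCap_le_iff.1 (WithTop.coe_le_coe.1 h2) with h3 | h3
        · exact h.not_ge h3
        · exact h1 (h3.mono h.le)
    have hmono : (hcap s).measurableSpace ≤ (hcap t).measurableSpace :=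
      IsStoppingTime.measurableSpace_mono _ _ fun ω => WithTop.coe_le_coe.2
        (exitCap_eq_min hs ω ▸ min_le_right _ _)
    rw [← integral_inter_add_sdiff (s := A) hH (hmain' t le_rfl).1.integrableOn,
      ← integral_inter_add_sdiff (s := A) hH (hmain' s hs).1.integrableOn,
      (hmain' t le_rfl).2 _ (hmono _ hB), (hmain' s hs).2 _ hB]
    congr 1
    refine setIntegral_congr_fun (hAm.inter hH) fun ω hω => ?_
    simp only [exitCap_of_hit hω.2 hs]
  -- passage to nonnegative functions
  let N : ℕ → Fin d → ℝ≥0 → PathSpace (State d F) → ℝ≥0∞ := fun k i t =>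
    {ω | ⊥ < σ k ω}.indicator fun ω => ENNReal.ofReal (V k (exitCap n t ω) ω i - a)
  have hNm : ∀ k i t, AEMeasurable (N k i t) Q := fun k i t =>
    ((((hopt k i t).1.aemeasurable.sub_const a)).ennreal_ofReal).indicator
      ((rawFiltration _).le _ _ (hσ0 k 0))
  have hN : ∀ k i s t, s ≤ t → ∀ A, MeasurableSet[rawFiltration (State d F) s] A →
      ∫⁻ ω in A, N k i t ω ∂Q = ∫⁻ ω in A, N k i s ω ∂Q := by
    intro k i s t hst A hA
    have h1 : ∀ t, ∫⁻ ω in A, N k i t ω ∂Q =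
        ENNReal.ofReal (∫ ω in A ∩ {ω | ⊥ < σ k ω}, (V k (exitCap n t ω) ω i - a) ∂Q) := fun t => by
      rw [setLIntegral_indicator ((rawFiltration _).le _ _ (hσ0 k 0)), inter_comm,
        ofReal_integral_eq_lintegral_ofReal (f := fun ω => V k (exitCap n t ω) ω i - a)
          ((hopt k i t).1.sub (integrable_const a)).integrableOn]
      rw [EventuallyLE, ae_restrict_iff' (((rawFiltration _).le _ _ hA).inter
        ((rawFiltration _).le _ _ (hσ0 k 0)))]
      filter_upwards [hb] with ω hω hω'
      obtain ⟨u, -, -, hu⟩ := hVM k t ω hω'.2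
      rw [hu]
      exact sub_nonneg.2 (hω u i)
    rw [h1, h1, integral_sub (hopt k i t).1.integrableOn (integrable_const a).integrableOn,
      integral_sub (hopt k i s).1.integrableOn (integrable_const a).integrableOn,
      (hopt k i t).2 s hst _ (hA.inter (hσ0 k s))]
  -- Passing from time `u` to time `t` costs `n`; one `|a|` comes from subtracting `a`, the other
  -- from replacing `|S_t|` by its excess over `a`.
  have hNle : ∀ k i t, ∀ᵐ ω ∂Q, N k i t ω ≤ ENNReal.ofReal (n + 2 * |a|) + slack a n i t ω := by
    intro k i t
    filter_upwards [hb] with ω hω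
    by_cases h : ω ∈ {ω | ⊥ < σ k ω}
    · simp only [N, indicator_of_mem h]
      obtain ⟨u, hut, -, hu⟩ := hVM k t ω h
      rw [hu, slack, ← ENNReal.ofReal_add (by positivity) (sub_nonneg.2 (hω t i))]
      refine ENNReal.ofReal_le_ofReal ?_
      have h1 := abs_stoppedPrice_le (n := n) hut ω i
      have h2 := le_abs_self (stoppedPrice n u ω i)
      have h3 : |stoppedPrice n t ω i| ≤ stoppedPrice n t ω i - a + |a| := by
        have h4 := abs_add_le (stoppedPrice n t ω i - a) a
        rwa [sub_add_cancel, abs_of_nonneg (sub_nonneg.2 (hω t i))] at h4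
      linarith [neg_abs_le a]
    · simp only [N, indicator_of_notMem h]
      exact zero_le
  have hNlim : ∀ i t, ∀ᵐ ω ∂Q, Tendsto (fun k => N k i t ω) atTop (𝓝 (slack a n i t ω)) := by
    intro i t
    filter_upwards [hσ.tendsto_top] with ω hω
    refine tendsto_const_nhds.congr' ?_
    filter_upwards [hω.eventually (lt_mem_nhds (WithTop.coe_lt_top t))] with k hk
    have h1 : ⊥ < σ k ω := bot_le.trans_lt hk
    obtain ⟨u, -, hu, hu'⟩ := hVM k t ω h1
    simp only [N, indicator_of_mem (show ω ∈ {ω | ⊥ < σ k ω} from h1)]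
    rw [hu', hu hk.le, slack]
  -- Fatou: the localized slacks have equal integrals at `t` and at `0`, and at `0` they are bounded
  -- by an integrable variable.
  have hfin : ∀ i t, ∫⁻ ω, slack a n i t ω ∂Q < ⊤ := by
    intro i t
    have h00 := (integrable_stoppedPrice_iff hb i 0).1 (h0 i)
    calc ∫⁻ ω, slack a n i t ω ∂Q = ∫⁻ ω, liminf (fun k => N k i t ω) atTop ∂Q :=
          lintegral_congr_ae ((hNlim i t).mono fun ω hω => hω.liminf_eq.symm)
      _ ≤ liminf (fun k => ∫⁻ ω, N k i t ω ∂Q) atTop := lintegral_liminf_le' fun k => hNm k i t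
      _ ≤ ∫⁻ ω, (ENNReal.ofReal (n + 2 * |a|) + slack a n i 0 ω) ∂Q := by
          refine (liminf_le_liminf (v := fun _ => ∫⁻ ω, (ENNReal.ofReal (n + 2 * |a|) +
            slack a n i 0 ω) ∂Q) (Eventually.of_forall fun k => ?_)).trans_eq (liminf_const _)
          have := hN k i 0 t (zero_le) univ MeasurableSet.univ
          simp only [Measure.restrict_univ] at this
          rw [this]
          exact lintegral_mono_ae (hNle k i 0)
      _ < ⊤ := by
          rw [lintegral_add_left measurable_const]
          exact ENNReal.add_lt_top.2 ⟨by simp, h00⟩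
  have hlim : ∀ i t A, Tendsto (fun k => ∫⁻ ω in A, N k i t ω ∂Q) atTop
      (𝓝 (∫⁻ ω in A, slack a n i t ω ∂Q)) := fun i t A => by
    refine tendsto_lintegral_of_dominated_convergence'
      (fun ω => ENNReal.ofReal (n + 2 * |a|) + slack a n i t ω)
      (fun k => (hNm k i t).restrict) (fun k => ae_restrict_of_ae (hNle k i t)) ?_
      (ae_restrict_of_ae (hNlim i t))
    refine ((setLIntegral_le_lintegral A _).trans_lt ?_).ne
    rw [lintegral_add_left measurable_const]
    exact ENNReal.add_lt_top.2 ⟨by simp, hfin i t⟩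
  intro i s t hst A hA
  refine tendsto_nhds_unique (hlim i t A) ((hlim i s A).congr fun k => ?_)
  exact (hN k i s t hst A hA).symm

/-! ### Countably many conditions -/

theorem exists_piSystem_nat (Ω : Type*) [mΩ : MeasurableSpace Ω] [StandardBorelSpace Ω] :
    ∃ b : ℕ → Set Ω, IsPiSystem (range b) ∧ mΩ = MeasurableSpace.generateFrom (range b) ∧
      univ ∈ range b := by
  obtain ⟨b, hb, hgen⟩ := exists_countable_piSystem Ω
  obtain ⟨b', hb'⟩ := ((countable_range b).insert univ).exists_eq_range (insert_nonempty _ _)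
  refine ⟨b', hb' ▸ hb.insert_univ, ?_, hb' ▸ mem_insert _ _⟩
  rw [← hb', MeasurableSpace.generateFrom_insert_univ]
  exact hgen

theorem exists_nnrat_eq_disc (k : ℕ) (t : ℝ≥0) : ∃ q : ℚ≥0, (q : ℝ≥0) = disc k t :=
  ⟨(⌊t * 2 ^ k⌋₊ + 1) / 2 ^ k, by rw [disc]; push_cast; rfl⟩

theorem disc_mono (k : ℕ) : Monotone (disc k) := fun s t h => by
  rw [disc, disc]
  gcongr

/-- At rational times, events before `s` are preimages under stopping at `s`, so two finite measures
need only agree on a π-system. Real times are reached from the right through dyadics. -/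
theorem slackMartingale_of_rat {b : ℕ → Set (PathSpace (State d F))} (hπ : IsPiSystem (range b))
    (hgen : (inferInstance : MeasurableSpace (PathSpace (State d F))) =
      MeasurableSpace.generateFrom (range b)) (huniv : univ ∈ range b)
    (hb : BoundedBelow a n Q) (h0 : ∀ i, Integrable (fun ω => stoppedPrice n 0 ω i) Q)
    (h : ∀ (i : Fin d) (s t : ℚ≥0), s ≤ t → ∀ k,
      ∫⁻ ω in stopPath (s : ℝ≥0) ⁻¹' b k, slack a n i t ω ∂Q =
        ∫⁻ ω in stopPath (s : ℝ≥0) ⁻¹' b k, slack a n i s ω ∂Q) :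
    SlackMartingale a n Q := by
  obtain ⟨k₀, hk₀⟩ := huniv
  have hbm : ∀ k, MeasurableSet (b k) := fun k => by
    have := MeasurableSpace.measurableSet_generateFrom (mem_range_self (f := b) k)
    rwa [← hgen] at this
  have hfin : ∀ i (t : ℚ≥0), ∫⁻ ω, slack a n i t ω ∂Q < ⊤ := fun i t => by
    have h1 := h i 0 t (zero_le) k₀
    rw [hk₀, preimage_univ, Measure.restrict_univ] at h1
    have h2 := (integrable_stoppedPrice_iff hb i 0).1 (h0 i)
    rw [h1]
    simpa using h2
  have hrat : ∀ i (s t : ℚ≥0), s ≤ t → ∀ A, MeasurableSet[rawFiltration (State d F) s] A →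
      ∫⁻ ω in A, slack a n i t ω ∂Q = ∫⁻ ω in A, slack a n i s ω ∂Q := by
    intro i s t hst A hA
    rw [rawFiltration_eq_comap] at hA
    obtain ⟨B, hB, rfl⟩ := hA
    have hms : Measurable (stopPath (E := State d F) s) := measurable_stopPath _
    have hval : ∀ (r : ℚ≥0) (B : Set (PathSpace (State d F))), MeasurableSet B →
        ((Q.withDensity (slack a n i r)).map (stopPath (s : ℝ≥0))) B =
        ∫⁻ ω in stopPath (s : ℝ≥0) ⁻¹' B, slack a n i r ω ∂Q := fun r B hB => by
      rw [Measure.map_apply hms hB, withDensity_apply _ (hms hB)]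
    rw [← hval t B hB, ← hval s B hB]
    have : IsFiniteMeasure ((Q.withDensity (slack a n i t)).map (stopPath (s : ℝ≥0))) := by
      refine ⟨?_⟩
      rw [hval t _ MeasurableSet.univ, preimage_univ, Measure.restrict_univ]
      exact hfin i t
    refine congrArg (fun m : Measure (PathSpace (State d F)) => m B) (ext_of_generate_finite _ hgen hπ ?_ ?_)
    · rintro _ ⟨k, rfl⟩
      rw [hval t _ (hbm k), hval s _ (hbm k)]
      exact h i s t hst k
    · rw [hval t _ MeasurableSet.univ, hval s _ MeasurableSet.univ, ← hk₀]
      exact h i s t hst k₀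
  have hlim : ∀ i (t : ℝ≥0) A, Tendsto (fun k => ∫⁻ ω in A, slack a n i (disc k t) ω ∂Q) atTop
      (𝓝 (∫⁻ ω in A, slack a n i t ω ∂Q)) := by
    intro i t A
    -- All discretizations of `t` are at most `t + 1`, so the slack at this one rational time serves
    -- in the majorant.
    obtain ⟨T, hT, -⟩ := exists_nnrat_between (show t + 1 < t + 2 by gcongr; norm_num)
    refine tendsto_lintegral_of_dominated_convergence
      (fun ω => ENNReal.ofReal (n + 2 * |a|) + slack a n i T ω)
      (fun k => measurable_slack _ _ _ _) (fun k => ae_restrict_of_ae ?_) ?_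
      (Eventually.of_forall fun ω => ?_)
    · filter_upwards [hb] with ω hω
      have hk : disc k t ≤ T := (disc_le k t).trans (le_trans (by
        gcongr
        rw [div_le_one (by positivity)]
        exact one_le_pow₀ (by norm_num)) hT.le)
      rw [slack, slack, ← ENNReal.ofReal_add (by positivity) (sub_nonneg.2 (hω _ i))]
      refine ENNReal.ofReal_le_ofReal ?_
      have h1 := abs_stoppedPrice_le (n := n) hk ω i
      have h2 := le_abs_self (stoppedPrice n (disc k t) ω i)
      have h3 : |stoppedPrice n T ω i| ≤ stoppedPrice n T ω i - a + |a| := by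
        have h4 := abs_add_le (stoppedPrice n T ω i - a) a
        rwa [sub_add_cancel, abs_of_nonneg (sub_nonneg.2 (hω _ i))] at h4
      linarith [neg_abs_le a]
    · refine ((setLIntegral_le_lintegral A _).trans_lt ?_).ne
      rw [lintegral_add_left measurable_const]
      exact ENNReal.add_lt_top.2 ⟨by simp, hfin i T⟩
    · refine ENNReal.tendsto_ofReal (Tendsto.sub_const ?_ a)
      have h1 : Tendsto (fun k => stoppedPrice n (disc k t) ω) atTop (𝓝 (stoppedPrice n t ω)) :=
        Tendsto.comp (g := fun s => stoppedPrice n s ω) (stoppedPrice_rightCont n ω t)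
          ((tendsto_disc t).mono_right (nhdsWithin_mono _ Ioi_subset_Ici_self))
      exact ((continuous_eval i).tendsto _).comp h1
  intro i s t hst A hA
  refine tendsto_nhds_unique (hlim i t A) ((hlim i s A).congr fun k => ?_)
  obtain ⟨p, hp⟩ := exists_nnrat_eq_disc k s
  obtain ⟨q, hq⟩ := exists_nnrat_eq_disc k t
  rw [← hp, ← hq]
  refine (hrat i p q ?_ A ((rawFiltration _).mono ?_ _ hA)).symm
  · have := disc_mono k hst
    rw [← hp, ← hq] at this
    exact_mod_cast this
  · rw [hp]
    exact (lt_disc k s).le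

end LocalMartingale

end DPP

namespace DPP

/-! ### Consequences of the strong Markov property -/

section StoppedPath

variable {E : Type*} [TopologicalSpace E] [PolishSpace E] [MeasurableSpace E] [BorelSpace E]
  {τ : PathSpace E → ℝ≥0}

theorem measurable_stoppingTime_nnreal
    (hτ : IsStoppingTime (hullFiltration E) fun ω => (τ ω : WithTop ℝ≥0)) :
    Measurable[hτ.measurableSpace] τ := by
  refine (measurable_of_Iic fun r => ?_)
  have h := hτ.measurableSet_le' r
  convert h using 1
  ext ω
  exact (WithTop.coe_le_coe (a := r) (b := τ ω)).symm

/-- The coordinate at `s` of the stopped path is the position at `min τ s`, to which progressive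
measurability applies. -/
theorem measurable_stoppedPath
    (hτ : IsStoppingTime (hullFiltration E) fun ω => (τ ω : WithTop ℝ≥0)) :
    Measurable[hτ.measurableSpace] fun ω => stopPath (τ ω) ω := by
  refine (measurable_pathSpace (mα := hτ.measurableSpace)).2 fun s => ?_
  have h1 := measurable_stoppedValue (isStronglyProgressive_coord_hull (E := E)) (hτ.min_const s)
  have h2 : (hτ.min_const s).measurableSpace ≤ hτ.measurableSpace :=
    IsStoppingTime.measurableSpace_mono _ _ fun ω => min_le_left _ _
  refine (congrArg (fun f => Measurable[hτ.measurableSpace] f) (funext fun ω => ?_)).mp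
    (h1.mono h2 le_rfl)
  rw [stoppedValue, coord_stopPath, min_comm, ← WithTop.coe_min]
  rfl

theorem measurable_of_stoppingTime {β : Type*} [MeasurableSpace β] {f : PathSpace E → β}
    (hτ : IsStoppingTime (hullFiltration E) fun ω => (τ ω : WithTop ℝ≥0))
    (hf : Measurable[hτ.measurableSpace] f) : Measurable f :=
  hf.mono hτ.measurableSpace_le le_rfl

theorem isStoppingTime_const_nnreal (t : ℝ≥0) :
    IsStoppingTime (hullFiltration E) fun _ => ((t : ℝ≥0) : WithTop ℝ≥0) :=
  isStoppingTime_const _ t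

end StoppedPath

section Markov

variable {d : ℕ} {F : Type*} [TopologicalSpace F] [PolishSpace F] [MeasurableSpace F] [BorelSpace F]
  {P : Kernel (State d F) (PathSpace (State d F))} [IsMarkovKernel P]

/-- The strong Markov property for joint laws. `U` may be any variable known at `τ` from which the
position at `τ` can be read off; later it is the entire past. -/
theorem map_prodMk_shift (hP : IsStrongMarkovFamily P) (x : State d F)
    {τ : PathSpace (State d F) → ℝ≥0}
    (hτ : IsStoppingTime (hullFiltration (State d F)) fun ω => (τ ω : WithTop ℝ≥0))
    (hC : ∃ C : ℝ≥0, ∀ ω, τ ω ≤ C) {𝒴 : Type*} [MeasurableSpace 𝒴] {U : PathSpace (State d F) → 𝒴}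
    (hU : Measurable[hτ.measurableSpace] U) {pos : 𝒴 → State d F} (hpos : Measurable pos)
    (h : ∀ ω, pos (U ω) = coord (τ ω) ω) :
    (P x).map (fun ω => (U ω, shift (τ ω) ω)) = ((P x).map U) ⊗ₘ (P.comap pos hpos) := by
  have hτm : Measurable τ := measurable_of_stoppingTime hτ (measurable_stoppingTime_nnreal hτ)
  have hUm : Measurable U := measurable_of_stoppingTime hτ hU
  have hθ : Measurable fun ω : PathSpace (State d F) => shift (τ ω) ω :=
    measurable_shift_comp hτm measurable_id
  have hUθ := hUm.prodMk hθ
  have : IsProbabilityMeasure ((P x).map fun ω => (U ω, shift (τ ω) ω)) :=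
    Measure.isProbabilityMeasure_map hUθ.aemeasurable
  have : IsProbabilityMeasure ((P x).map U) := Measure.isProbabilityMeasure_map hUm.aemeasurable
  refine Measure.ext_prod fun {B A} hB hA => ?_
  rw [Measure.map_apply hUθ (hB.prod hA), Measure.compProd_apply_prod hB hA,
    setLIntegral_map hB ((P.comap pos hpos).measurable_coe hA) hUm]
  simp only [Kernel.comap_apply, h]
  have hm := hP.markov _ hτ (hC.imp fun C hC ω => WithTop.coe_le_coe.2 (hC ω)) x (A.indicator 1)
    (measurable_one.indicator hA) ⟨1, fun ω => by
      by_cases hω : ω ∈ A <;> simp [hω]⟩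
  have hint : Integrable (fun ω => A.indicator (1 : PathSpace (State d F) → ℝ)
      (shift (τ ω) ω)) (P x) :=
    Integrable.of_bound ((measurable_one.indicator hA).comp hθ).aestronglyMeasurable 1
      (Eventually.of_forall fun ω => by by_cases hω : shift (τ ω) ω ∈ A <;> simp [hω])
  have h1 := setIntegral_condExp hτ.measurableSpace_le hint (hU hB)
  have h2 := setIntegral_congr_ae (s := U ⁻¹' B) (hUm hB) (hm.mono fun ω hω _ => hω)
  have h3 : ∫ ω in U ⁻¹' B, A.indicator (1 : PathSpace (State d F) → ℝ) (shift (τ ω) ω) ∂(P x) =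
      (P x).real (U ⁻¹' B ∩ (fun ω => shift (τ ω) ω) ⁻¹' A) := by
    have : (fun ω => A.indicator (1 : PathSpace (State d F) → ℝ) (shift (τ ω) ω)) =
        ((fun ω => shift (τ ω) ω) ⁻¹' A).indicator 1 := rfl
    rw [this, integral_indicator_one (hθ hA), measureReal_restrict_apply (hθ hA), inter_comm]
  have h4 : ∀ y, ∫ ω', A.indicator (1 : PathSpace (State d F) → ℝ) ω' ∂(P y) = (P y A).toReal :=
    fun y => by rw [integral_indicator_one hA]; rfl
  simp only [h4] at h2
  have h5 : ∫ ω in U ⁻¹' B, (P (coord (τ ω) ω) A).toReal ∂(P x) =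
      (∫⁻ ω in U ⁻¹' B, P (coord (τ ω) ω) A ∂(P x)).toReal :=
    integral_toReal ((P.measurable_coe hA).comp
      (measurable_coord_comp hτm measurable_id)).aemeasurable
      (Eventually.of_forall fun ω => measure_lt_top _ _)
  have h6 : (∫⁻ ω in U ⁻¹' B, P (coord (τ ω) ω) A ∂(P x)) ≠ ⊤ :=
    ((lintegral_mono fun ω => prob_le_one).trans_lt (by simp)).ne
  have h7 : (fun ω => (U ω, shift (τ ω) ω)) ⁻¹' B ×ˢ A =
      U ⁻¹' B ∩ (fun ω => shift (τ ω) ω) ⁻¹' A := rfl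
  rw [h7, ← ENNReal.toReal_eq_toReal_iff' (measure_ne_top _ _) h6, ← h5]
  change (P x).real _ = _
  rw [← h3]
  exact h1.symm.trans h2

theorem lintegral_shift (hP : IsStrongMarkovFamily P) (x : State d F)
    {τ : PathSpace (State d F) → ℝ≥0}
    (hτ : IsStoppingTime (hullFiltration (State d F)) fun ω => (τ ω : WithTop ℝ≥0))
    (hC : ∃ C : ℝ≥0, ∀ ω, τ ω ≤ C) {𝒴 : Type*} [MeasurableSpace 𝒴] {U : PathSpace (State d F) → 𝒴}
    (hU : Measurable[hτ.measurableSpace] U) {pos : 𝒴 → State d F} (hpos : Measurable pos)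
    (h : ∀ ω, pos (U ω) = coord (τ ω) ω) {f : 𝒴 × PathSpace (State d F) → ℝ≥0∞}
    (hf : Measurable f) :
    ∫⁻ ω, f (U ω, shift (τ ω) ω) ∂(P x) = ∫⁻ ω, ∫⁻ ω', f (U ω, ω') ∂P (coord (τ ω) ω) ∂(P x) := by
  have hUm : Measurable U := measurable_of_stoppingTime hτ hU
  have hθ : Measurable fun ω : PathSpace (State d F) => shift (τ ω) ω :=
    measurable_shift_comp (measurable_of_stoppingTime hτ (measurable_stoppingTime_nnreal hτ))
      measurable_id
  have : IsProbabilityMeasure ((P x).map U) := Measure.isProbabilityMeasure_map hUm.aemeasurable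
  rw [← lintegral_map hf (hUm.prodMk hθ), map_prodMk_shift hP x hτ hC hU hpos h,
    Measure.lintegral_compProd hf, lintegral_map hf.lintegral_kernel_prod_right' hUm]
  simp only [Kernel.comap_apply, h]

/-- At time `x.1` the clock shows zero, and the Markov property restarts the path from an absorbing
state. -/
theorem ae_stopPath_eq (hP : IsStrongMarkovFamily P) (hT : FiniteHorizon P) (x : State d F) :
    ∀ᵐ ω ∂P x, ∀ t ≥ x.1, stopPath t ω = ω := by
  set A : Set (PathSpace (State d F)) := {ω | constPath (coord 0 ω) = ω}
  have hA : MeasurableSet A :=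
    measurableSet_eq_fun (measurable_constPath.comp (measurable_coord 0)) measurable_id
  have h0 := lintegral_shift hP x (isStoppingTime_const_nnreal x.1) ⟨x.1, fun _ => le_rfl⟩
    (U := fun ω => coord x.1 ω)
    (by
      have := measurable_stoppedValue (isStronglyProgressive_coord_hull (E := State d F))
        (isStoppingTime_const_nnreal x.1)
      exact this) measurable_id (fun ω => rfl)
    (f := fun p => Aᶜ.indicator 1 p.2) ((measurable_one.indicator hA.compl).comp measurable_snd)
  have h1 : ∀ᵐ ω ∂P x, (coord x.1 ω).1 = 0 := by
    filter_upwards [hP.start x, hT.clock x] with ω h1 h2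
    have h3 := h2 x.1 (by rw [timeToGo, h1])
    rw [timeToGo, timeToGo, h1, tsub_self] at h3
    exact h3
  have h2 : ∫⁻ ω, ∫⁻ ω', Aᶜ.indicator 1 ω' ∂P (coord x.1 ω) ∂(P x) = 0 := by
    rw [lintegral_eq_zero_iff' (by
      exact ((measurable_one.indicator hA.compl).lintegral_kernel (κ := P)).comp
        (measurable_coord x.1) |>.aemeasurable)]
    filter_upwards [h1] with ω hω
    rw [hT.absorbing _ hω, lintegral_dirac' _ (measurable_one.indicator hA.compl)]
    have : constPath (coord x.1 ω) ∈ A := rfl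
    simp [this]
  replace h0 : ∫⁻ ω, Aᶜ.indicator 1 (shift x.1 ω) ∂(P x) = 0 := h0.trans h2
  rw [lintegral_eq_zero_iff (f := fun ω => Aᶜ.indicator 1 (shift x.1 ω))
    ((measurable_one.indicator hA.compl).comp
      (measurable_shift_comp measurable_const measurable_id))] at h0
  filter_upwards [h0] with ω hω t ht
  have h3 : shift x.1 ω ∈ A := by
    by_contra hc
    simp [hc] at hω
  have h4 : ∀ s ≥ x.1, coord s ω = coord x.1 ω := fun s hs => by
    have h5 := congrArg (coord (s - x.1)) h3
    rw [coord_constPath, coord_shift, coord_shift, tsub_add_cancel_of_le hs, zero_add] at h5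
    exact h5.symm
  refine path_ext fun s => ?_
  rw [coord_stopPath]
  rcases le_total s t with h | h
  · rw [min_eq_left h]
  · rw [min_eq_right h, h4 t ht, h4 s (ht.trans h)]

/-- Beyond the horizon the path equals its stopped version, so every variable is almost surely
known. -/
theorem condExp_ae_eq_of_ge (hP : IsStrongMarkovFamily P) (hT : FiniteHorizon P) (x : State d F)
    {D : PathSpace (State d F) → ℝ} (hD : Measurable D) (hi : Integrable D (P x)) {t : ℝ≥0}
    (ht : x.1 ≤ t) : (P x)[D | hullFiltration (State d F) t] =ᵐ[P x] D := by
  have h1 : (fun ω => D (stopPath t ω)) =ᵐ[P x] D := by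
    filter_upwards [ae_stopPath_eq hP hT x] with ω hω
    rw [hω t ht]
  refine (condExp_congr_ae h1.symm).trans (EventuallyEq.trans ?_ h1)
  rw [condExp_of_stronglyMeasurable ((hullFiltration _).le t) ?_ (hi.congr h1.symm)]
  exact ((hD.comp (measurable_stopPath_raw t)).mono (raw_le_hull t) le_rfl).stronglyMeasurable

/-- The density process is eventually equal to the density. -/
theorem IsDensityProcess.eq_rnDeriv (hP : IsStrongMarkovFamily P) (hT : FiniteHorizon P)
    {x : State d F} {Q : Measure (PathSpace (State d F))} [IsFiniteMeasure Q]
    {Z : PathSpace (State d F) → PathSpace ℝ≥0} (hZ : IsDensityProcess (P x) Q Z) :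
    ∀ᵐ ω ∂P x, ∀ t ≥ x.1, coord t (Z ω) = (Q.rnDeriv (P x) ω).toNNReal := by
  have h1 : ∀ t ≥ x.1, ∀ᵐ ω ∂P x, coord t (Z ω) = (Q.rnDeriv (P x) ω).toNNReal := fun t ht => by
    have h2 := condExp_ae_eq_of_ge hP hT x (Measure.measurable_rnDeriv Q (P x)).ennreal_toReal
      Measure.integrable_toReal_rnDeriv ht
    filter_upwards [(hZ.version t).trans h2] with ω hω
    exact NNReal.coe_injective hω
  have h2 : ∀ᵐ ω ∂P x, ∀ q : ℚ≥0, x.1 ≤ q →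
      coord (q : ℝ≥0) (Z ω) = (Q.rnDeriv (P x) ω).toNNReal :=
    ae_all_iff.2 fun q => ae_imp_of h1 q
  filter_upwards [h2] with ω hω t ht
  have h3 : Tendsto (fun k => coord (disc k t) (Z ω)) atTop (𝓝 (coord t (Z ω))) :=
    Tendsto.comp (g := fun s => coord s (Z ω)) (coord_rightCont (Z ω) t)
      ((tendsto_disc t).mono_right (nhdsWithin_mono _ Ioi_subset_Ici_self))
  refine tendsto_nhds_unique h3 (tendsto_const_nhds.congr fun k => ?_)
  obtain ⟨q, hq⟩ := exists_nnrat_eq_disc k t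
  rw [← hq, hω q (hq ▸ ht.trans (lt_disc k t).le)]
where
  ae_imp_of {x : State d F} {f : ℝ≥0 → PathSpace (State d F) → Prop}
      (h : ∀ t ≥ x.1, ∀ᵐ ω ∂P x, f t ω) (q : ℚ≥0) : ∀ᵐ ω ∂P x, x.1 ≤ q → f q ω := by
    by_cases hq : x.1 ≤ q
    · exact (h q hq).mono fun ω hω _ => hω
    · exact Eventually.of_forall fun ω h => absurd h hq

end Markov

/-! ### Augmented paths -/

section Augment

variable {E : Type*} [TopologicalSpace E]

theorem coord_augment (t z : ℝ≥0) (ω : PathSpace E) (ζ : PathSpace ℝ≥0) :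
    coord t (augment z ω ζ) = (coord t ω, z * coord t ζ) := rfl

variable [PolishSpace E] [MeasurableSpace E] [BorelSpace E]

theorem measurable_augment_comp {α : Type*} [MeasurableSpace α] {z : α → ℝ≥0}
    {w : α → PathSpace E} {ζ : α → PathSpace ℝ≥0} (hz : Measurable z) (hw : Measurable w)
    (hζ : Measurable ζ) : Measurable fun a => augment (z a) (w a) (ζ a) :=
  measurable_pathSpace.2 fun t => by
    simp only [coord_augment]
    exact ((measurable_coord t).comp hw).prodMk (hz.mul ((measurable_coord t).comp hζ))

/-- The shift-invariant payoff on a path, given the terminal value of the density process. -/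
def terminal (G : PathSpace (E × ℝ≥0) → EReal) (ω : PathSpace E) (w : ℝ≥0) : EReal :=
  G (augment 1 ω (constPath w))

theorem measurable_terminal {G : PathSpace (E × ℝ≥0) → EReal} (hG : Measurable G) :
    Measurable fun p : PathSpace E × ℝ≥0 => terminal G p.1 p.2 :=
  hG.comp (measurable_augment_comp measurable_const measurable_fst
    (measurable_constPath.comp measurable_snd))

theorem terminal_shift {G : PathSpace (E × ℝ≥0) → EReal}
    (h : ∀ (t : ℝ≥0) (ω : PathSpace (E × ℝ≥0)), G (shift t ω) = G ω) (t : ℝ≥0) (ω : PathSpace E)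
    (w : ℝ≥0) : terminal G (shift t ω) w = terminal G ω w := by
  rw [terminal, terminal, ← h t (augment 1 ω (constPath w))]
  rfl

/-- After a shift by `T` the augmented path and the path with constant weight `z * w` coincide. -/
theorem terminal_of_eventually {G : PathSpace (E × ℝ≥0) → EReal}
    (h : ∀ (t : ℝ≥0) (ω : PathSpace (E × ℝ≥0)), G (shift t ω) = G ω) {T z w : ℝ≥0}
    {ω : PathSpace E} {ζ : PathSpace ℝ≥0} (hw : ∀ t ≥ T, coord t ζ = w) :
    G (augment z ω ζ) = terminal G ω (z * w) := by
  rw [← terminal_shift h T, terminal, ← h T (augment z ω ζ)]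
  congr 1
  refine path_ext fun t => ?_
  rw [coord_shift, coord_augment, coord_augment, coord_shift, coord_constPath,
    hw _ (le_add_self), one_mul]

end Augment

end DPP

namespace DPP

/-! ### From stopping times of the augmented path to stopping times of the original path -/

section Transfer

variable {E : Type*} [TopologicalSpace E] [PolishSpace E] [MeasurableSpace E] [BorelSpace E]

/-- For a right-continuous filtration strict inequalities suffice to test membership in the past of
a stopping time. -/
theorem measurableSet_of_inter_lt {τ : PathSpace E → ℝ≥0}
    (hτ : IsStoppingTime (hullFiltration E) fun ω => (τ ω : WithTop ℝ≥0)) {A : Set (PathSpace E)}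
    (h : ∀ r, MeasurableSet[hullFiltration E r] (A ∩ {ω | τ ω < r})) :
    MeasurableSet[hτ.measurableSpace] A := by
  refine ⟨?_, fun t => measurableSet_hull_iff.2 fun s hs => ?_⟩
  · have : A = ⋃ n : ℕ, A ∩ {ω | τ ω < n} := by
      rw [← inter_iUnion, eq_comm, inter_eq_left]
      exact fun ω _ => mem_iUnion.2 (exists_nat_gt (τ ω))
    rw [this]
    exact MeasurableSet.iUnion fun n => le_iSup (fun t => (hullFiltration E) t) (n : ℝ≥0) _ (h n)
  · obtain ⟨r, htr, hrs⟩ := exists_between hs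
    -- The dyadics decrease to `t`, while the minimum with `r` keeps all events in the hull at `r`,
    -- hence in the raw σ-algebra at `s`.
    have : A ∩ {ω | (τ ω : WithTop ℝ≥0) ≤ t} = ⋂ k, A ∩ {ω | τ ω < min (disc k t) r} := by
      ext ω
      simp only [mem_inter_iff, mem_ofPred_eq, mem_iInter, WithTop.coe_le_coe]
      refine ⟨fun ⟨h1, h2⟩ k => ⟨h1, h2.trans_lt (lt_min (lt_disc k t) htr)⟩,
        fun h1 => ⟨(h1 0).1, ?_⟩⟩
      have h2 : Tendsto (fun k => disc k t) atTop (𝓝 t) :=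
        (tendsto_disc t).mono_right nhdsWithin_le_nhds
      exact ge_of_tendsto' h2 fun k => (h1 k).2.le.trans (min_le_left _ _)
    rw [this]
    exact MeasurableSet.iInter fun k => hull_le_raw hrs _
      ((hullFiltration E).mono (min_le_right _ _) _ (h _))

/-- A right-continuous process that is adapted up to null sets has, at a stopping time, a version
that is measurable with respect to the past of that stopping time. -/
theorem exists_measurable_stopped {P : Measure (PathSpace E)} {τ : PathSpace E → ℝ≥0}
    (hτ : IsStoppingTime (hullFiltration E) fun ω => (τ ω : WithTop ℝ≥0))
    {Z : PathSpace E → PathSpace ℝ≥0} {f : ℝ≥0 → PathSpace E → ℝ≥0}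
    (hf : ∀ t, Measurable[hullFiltration E t] (f t)) (hZ : ∀ t, ∀ᵐ ω ∂P, coord t (Z ω) = f t ω) :
    ∃ W : PathSpace E → ℝ≥0, Measurable[hτ.measurableSpace] W ∧
      ∀ᵐ ω ∂P, coord (τ ω) (Z ω) = W ω := by
  have hτm : Measurable τ := measurable_of_stoppingTime hτ (measurable_stoppingTime_nnreal hτ)
  obtain ⟨c, hc⟩ : ∃ c : ℕ → ℕ → ℝ≥0, ∀ k t, disc k t = c k ⌊t * 2 ^ k⌋₊ :=
    ⟨fun k n => (n + 1) / 2 ^ k, fun _ _ => rfl⟩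
  -- `g r` discards sampling times after `r`, hence is known at `r`; on `{τ < r}` only finitely many
  -- terms are affected and the limsup is unchanged.
  let g : ℝ≥0 → PathSpace E → ℝ≥0∞ := fun r ω => limsup (fun k =>
    if c k ⌊min (τ ω) r * 2 ^ k⌋₊ ≤ r then (f (c k ⌊min (τ ω) r * 2 ^ k⌋₊) ω : ℝ≥0∞) else 0) atTop
  let W : PathSpace E → ℝ≥0∞ := fun ω => limsup (fun k => (f (disc k (τ ω)) ω : ℝ≥0∞)) atTop
  have hmin : ∀ r, Measurable[hullFiltration E r] fun ω => min (τ ω) r := fun r => by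
    have h := measurable_stoppingTime_nnreal (τ := fun ω => min (τ ω) r) (hτ.min_const r)
    exact h.mono (IsStoppingTime.measurableSpace_le_of_le_const _ fun ω =>
      WithTop.coe_le_coe.2 (min_le_right _ _)) le_rfl
  have hg : ∀ r, Measurable[hullFiltration E r] (g r) := fun r => by
    let := (hullFiltration E) r
    refine Measurable.limsup fun k => ?_
    have h1 : Measurable fun p : ℕ × PathSpace E =>
        if c k p.1 ≤ r then (f (c k p.1) p.2 : ℝ≥0∞) else 0 := by
      refine measurable_from_prod_countable_right fun n => ?_
      by_cases h : c k n ≤ r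
      · simp only [h, if_true]
        exact ((hf (c k n)).mono ((hullFiltration E).mono h) le_rfl).coe_nnreal_ennreal
      · simp only [h, if_false]
        exact measurable_const
    exact h1.comp ((Nat.measurable_floor.comp ((hmin r).mul_const _)).prodMk measurable_id)
  have hWg : ∀ r ω, τ ω < r → W ω = g r ω := fun r ω h => by
    refine limsup_congr ?_
    have h1 : ∀ᶠ k in atTop, disc k (τ ω) < r :=
      ((tendsto_disc (τ ω)).mono_right nhdsWithin_le_nhds).eventually (gt_mem_nhds h)
    filter_upwards [h1] with k hk
    rw [min_eq_left h.le, ← hc, if_pos hk.le]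
  have hW : Measurable[hτ.measurableSpace] W := fun B hB => by
    refine measurableSet_of_inter_lt hτ fun r => ?_
    have : W ⁻¹' B ∩ {ω | τ ω < r} = g r ⁻¹' B ∩ {ω | τ ω < r} := by
      ext ω
      simp only [mem_inter_iff, mem_preimage, mem_ofPred_eq, and_congr_left_iff]
      intro h
      rw [hWg r ω h]
    rw [this]
    refine (hg r hB).inter ?_
    have h2 := hτ.measurableSet_lt r
    convert h2 using 1
    ext ω
    exact (WithTop.coe_lt_coe (a := r) (b := τ ω)).symm
  refine ⟨fun ω => (W ω).toNNReal, hW.ennreal_toNNReal, ?_⟩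
  have h1 : ∀ᵐ ω ∂P, ∀ k n, coord (c k n) (Z ω) = f (c k n) ω :=
    ae_all_iff.2 fun k => ae_all_iff.2 fun n => hZ _
  filter_upwards [h1] with ω hω
  have h2 : Tendsto (fun k => coord (disc k (τ ω)) (Z ω)) atTop (𝓝 (coord (τ ω) (Z ω))) :=
    Tendsto.comp (g := fun s => coord s (Z ω)) (coord_rightCont (Z ω) _)
      ((tendsto_disc _).mono_right (nhdsWithin_mono _ Ioi_subset_Ici_self))
  have h3 : Tendsto (fun k => (f (disc k (τ ω)) ω : ℝ≥0∞)) atTop (𝓝 (coord (τ ω) (Z ω) : ℝ≥0)) := by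
    refine (ENNReal.tendsto_coe.2 h2).congr fun k => ?_
    rw [hc, hω]
  have h4 : W ω = (coord (τ ω) (Z ω) : ℝ≥0) := h3.limsup_eq
  rw [h4, ENNReal.toNNReal_coe]

theorem isStoppingTime_of_lt {τ : PathSpace E → ℝ≥0}
    (h : ∀ r, MeasurableSet[hullFiltration E r] {ω | τ ω < r}) :
    IsStoppingTime (hullFiltration E) fun ω => (τ ω : WithTop ℝ≥0) := by
  refine isStoppingTime_of_measurableSet_lt_of_isRightContinuous fun r => ?_
  convert h r using 1
  ext ω
  exact WithTop.coe_lt_coe (a := r) (b := τ ω)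

/-- Since `Φ` is adapted up to null sets, each event `{τ < q}` pulls back, modulo a null set, to an
event known at `q`. Countably many of these events determine the stopping time. -/
theorem exists_stoppingTime_ae_eq {E' : Type*} [TopologicalSpace E'] [PolishSpace E']
    [MeasurableSpace E'] [BorelSpace E'] {P : Measure (PathSpace E)}
    {Φ : PathSpace E → PathSpace E'} {f : ℝ≥0 → PathSpace E → E'}
    (hf : ∀ t, Measurable[hullFiltration E t] (f t)) (hΦ : ∀ t, ∀ᵐ ω ∂P, coord t (Φ ω) = f t ω)
    {τ : PathSpace E' → WithTop ℝ≥0} (hτ : IsStoppingTime (hullFiltration E') τ) {C : ℝ≥0}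
    (hC : ∀ ω, τ ω ≤ C) :
    ∃ τ' : PathSpace E → ℝ≥0, IsStoppingTime (hullFiltration E) (fun ω => (τ' ω : WithTop ℝ≥0)) ∧
      (∀ ω, τ' ω ≤ C) ∧ ∀ᵐ ω ∂P, τ (Φ ω) = τ' ω := by
  have hraw : ∀ r B, MeasurableSet[rawFiltration E' r] B →
      ∃ A, MeasurableSet[hullFiltration E r] A ∧ Φ ⁻¹' B =ᵐ[P] A := by
    intro r B hB
    -- Sets whose preimage is almost surely equal to an event of the hull form a σ-algebra, so
    -- coordinates suffice.
    suffices h : rawFiltration E' r ≤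
        (@eventuallyMeasurableSpace _ (hullFiltration E r) (ae P) _).map Φ from h B hB
    refine iSup₂_le fun s hs => ?_
    rintro _ ⟨B, hB, rfl⟩
    refine ⟨f s ⁻¹' B, (hullFiltration E).mono hs _ (hf s hB), ?_⟩
    exact (hΦ s).mono fun ω hω => by
      change (coord s (Φ ω) ∈ B) = (f s ω ∈ B)
      rw [hω]
  have hq : ∀ q : ℚ≥0, ∃ A, MeasurableSet[hullFiltration E (q : ℝ≥0)] A ∧
      Φ ⁻¹' {ω | τ ω < (q : ℝ≥0)} =ᵐ[P] A := fun q => by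
    refine hraw q _ ?_
    have := measurableSet_inter_lt hτ (A := univ) (@MeasurableSet.univ _ hτ.measurableSpace) (q : ℝ≥0)
    rwa [univ_inter] at this
  choose A hA hA' using hq
  -- The infimum of the `q` with `ω ∈ A q`, capped at `C`. The chosen events need not be nested: `τ'
  -- < r` just asks for some `q < r`, apart from the cap.
  let τ' : PathSpace E → ℝ≥0 := fun ω =>
    open Classical in ⨅ q : ℚ≥0, if ω ∈ A q then min (q : ℝ≥0) C else C
  have hbdd : ∀ ω, BddBelow (range fun q : ℚ≥0 => open Classical in
      if ω ∈ A q then min (q : ℝ≥0) C else C) := fun ω => OrderBot.bddBelow _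
  have hlt : ∀ ω r, τ' ω < r ↔ C < r ∨ ∃ q : ℚ≥0, (q : ℝ≥0) < r ∧ ω ∈ A q := fun ω r => by
    rw [ciInf_lt_iff (hbdd ω)]
    constructor
    · rintro ⟨q, hq⟩
      split_ifs at hq with h
      · exact (min_lt_iff.1 hq).elim (fun h' => Or.inr ⟨q, h', h⟩) Or.inl
      · exact Or.inl hq
    · rintro (h | ⟨q, hq, h⟩)
      · refine ⟨0, ?_⟩
        split_ifs
        · exact (min_le_right _ _).trans_lt h
        · exact h
      · exact ⟨q, by rw [if_pos h]; exact (min_le_left _ _).trans_lt hq⟩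
  have hle : ∀ ω, τ' ω ≤ C := fun ω => le_of_forall_gt fun r hr => (hlt ω r).2 (Or.inl hr)
  refine ⟨τ', isStoppingTime_of_lt fun r => ?_, hle, ?_⟩
  · have : {ω | τ' ω < r} = {ω | C < r} ∪ ⋃ q : ℚ≥0, ⋃ (_ : (q : ℝ≥0) < r), A q := by
      ext ω
      simp only [mem_ofPred_eq, hlt, mem_union, mem_iUnion, exists_prop]
    rw [this]
    exact (MeasurableSet.const _).union (MeasurableSet.iUnion fun q => MeasurableSet.iUnion
      fun hq => (hullFiltration E).mono hq.le _ (hA q))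
  · filter_upwards [ae_all_iff.2 fun q => (hA' q).mem_iff] with ω hω
    have hne : τ (Φ ω) ≠ ⊤ := ((hC (Φ ω)).trans_lt (WithTop.coe_lt_top C)).ne
    obtain ⟨s, hs⟩ := WithTop.ne_top_iff_exists.1 hne
    rw [← hs]
    have hsC : s ≤ C := WithTop.coe_le_coe.1 (hs ▸ hC (Φ ω))
    have hω' : ∀ q : ℚ≥0, ω ∈ A q ↔ s < q := fun q => by
      rw [← hω q, mem_preimage, mem_ofPred_eq, ← hs, WithTop.coe_lt_coe]
    congr 1
    refine eq_of_forall_lt_iff fun r => ?_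
    rw [← not_le, ← not_le, not_iff_not]
    constructor
    · intro h
      refine le_of_forall_gt fun u hu => (hlt ω u).2 (Or.inr ?_)
      obtain ⟨q, hq, hq'⟩ := exists_nnrat_between (h.trans_lt hu)
      exact ⟨q, hq', (hω' q).2 hq⟩
    · intro h
      refine le_of_forall_gt fun u hu => ?_
      rcases (hlt ω u).1 (h.trans_lt hu) with h1 | ⟨q, hq, h1⟩
      · exact hsC.trans_lt h1
      · exact ((hω' q).1 h1).trans hq

end Transfer

/-! ### Density processes at stopping times -/

section Density

variable {d : ℕ} {F : Type*} [TopologicalSpace F] [PolishSpace F] [MeasurableSpace F] [BorelSpace F]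
  {P Q : Measure (PathSpace (State d F))} [IsProbabilityMeasure P] [IsProbabilityMeasure Q]
  {Z : PathSpace (State d F) → PathSpace ℝ≥0}

/-- An adapted version of the density process. -/
def densityVersion (P Q : Measure (PathSpace (State d F))) (t : ℝ≥0) (ω : PathSpace (State d F)) :
    ℝ≥0 :=
  (P[fun ω => (Q.rnDeriv P ω).toReal | hullFiltration (State d F) t] ω).toNNReal

theorem measurable_densityVersion (t : ℝ≥0) :
    Measurable[hullFiltration (State d F) t] (densityVersion P Q t) :=
  stronglyMeasurable_condExp.measurable.real_toNNReal

theorem IsDensityProcess.ae_eq (hZ : IsDensityProcess P Q Z) (t : ℝ≥0) :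
    ∀ᵐ ω ∂P, coord t (Z ω) = densityVersion P Q t ω := by
  filter_upwards [hZ.version t] with ω hω
  rw [densityVersion, ← hω, Real.toNNReal_coe]

/-- Optional sampling identifies the weight at `τ` with the density of `Q` on the past of `τ`, and
`W` is a version genuinely measurable there. -/
theorem IsDensityProcess.exists_stopped (hZ : IsDensityProcess P Q Z) (hQ : Q ≪ P)
    {τ : PathSpace (State d F) → ℝ≥0}
    (hτ : IsStoppingTime (hullFiltration (State d F)) fun ω => (τ ω : WithTop ℝ≥0)) :
    ∃ W : PathSpace (State d F) → ℝ≥0, Measurable[hτ.measurableSpace] W ∧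
      (∀ᵐ ω ∂P, coord (τ ω) (Z ω) = W ω) ∧
      ∀ A, MeasurableSet[hτ.measurableSpace] A → ∫⁻ ω in A, W ω ∂P = Q A := by
  obtain ⟨W, hW, hW'⟩ := exists_measurable_stopped hτ measurable_densityVersion hZ.ae_eq
  refine ⟨W, hW, hW', fun A hA => ?_⟩
  obtain ⟨h1, h2⟩ := setIntegral_stopped_eq (L := fun t ω => ((coord t (Z ω) : ℝ≥0) : ℝ))
    Measure.integrable_toReal_rnDeriv hZ.version
    (Eventually.of_forall fun ω t => NNReal.continuous_coe.continuousAt.comp_continuousWithinAt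
      (coord_rightCont (Z ω) t)) hτ
  have h3 := h2 A hA
  rw [Measure.setIntegral_toReal_rnDeriv hQ] at h3
  have h4 : ∫⁻ ω in A, W ω ∂P = ∫⁻ ω in A, ENNReal.ofReal (coord (τ ω) (Z ω) : ℝ≥0) ∂P := by
    refine lintegral_congr_ae (ae_restrict_of_ae ?_)
    filter_upwards [hW'] with ω hω
    rw [hω, ENNReal.ofReal_coe_nnreal]
  rw [h4, ← ofReal_integral_eq_lintegral_ofReal h1.integrableOn
    (Eventually.of_forall fun ω => NNReal.coe_nonneg _), h3]
  exact ENNReal.ofReal_toReal (measure_ne_top _ _)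

/-- A bounded stopping time of the augmented path, expressed through the original path. -/
theorem IsDensityProcess.exists_stoppingTime (hZ : IsDensityProcess P Q Z) (hQ : Q ≪ P) (z : ℝ≥0)
    {τ : PathSpace (State d F × ℝ≥0) → WithTop ℝ≥0}
    (hτ : τ ∈ boundedStoppingTimes (State d F × ℝ≥0)) :
    ∃ (τ' : PathSpace (State d F) → ℝ≥0)
      (hτ' : IsStoppingTime (hullFiltration (State d F)) fun ω => (τ' ω : WithTop ℝ≥0)),
      (∃ C : ℝ≥0, ∀ ω, τ' ω ≤ C) ∧ ∃ W : PathSpace (State d F) → ℝ≥0,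
      Measurable[hτ'.measurableSpace] W ∧
      (∀ A, MeasurableSet[hτ'.measurableSpace] A → ∫⁻ ω in A, W ω ∂P = Q A) ∧
      ∀ᵐ ω ∂P, τ (augment z ω (Z ω)) = τ' ω ∧
        positionAt τ (augment z ω (Z ω)) = (coord (τ' ω) ω, z * W ω) := by
  obtain ⟨hst, C, hC⟩ := hτ
  obtain ⟨τ', hτ', hC', h⟩ := exists_stoppingTime_ae_eq (P := P)
    (Φ := fun ω => augment z ω (Z ω)) (f := fun t ω => (coord t ω, z * densityVersion P Q t ω))
    (fun t => ((measurable_coord_raw le_rfl).mono (raw_le_hull t) le_rfl).prodMk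
      ((measurable_densityVersion t).const_mul z))
    (fun t => (hZ.ae_eq t).mono fun ω hω => by rw [coord_augment, hω]) hst hC
  obtain ⟨W, hW, hW', hW''⟩ := hZ.exists_stopped hQ hτ'
  refine ⟨τ', hτ', ⟨C, hC'⟩, W, hW, hW'', ?_⟩
  filter_upwards [h, hW'] with ω h1 h2
  refine ⟨h1, ?_⟩
  rw [positionAt, h1, WithTop.untopD_coe, coord_augment, h2]

end Density

end DPP

namespace DPP

/-! ### Pasting of local martingale measures -/

section Char

variable {d : ℕ} {F : Type*} [TopologicalSpace F] [PolishSpace F] [MeasurableSpace F] [BorelSpace F]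
  {P : Kernel (State d F) (PathSpace (State d F))} [IsMarkovKernel P]

/-- The constants `a n` are lower bounds for the stopped prices. -/
def LowerBounds (P : Kernel (State d F) (PathSpace (State d F))) (a : ℕ → ℝ) : Prop :=
  ∀ (n : ℕ) (x : State d F), ‖x.2.1‖ < n → BoundedBelow (a n) n (P x)

theorem UniformlyLocallyBoundedBelow.exists_lowerBounds (h : UniformlyLocallyBoundedBelow P) :
    ∃ a, LowerBounds P a := by
  choose a ha using h
  refine ⟨a, fun n x hx => ?_⟩
  filter_upwards [ha n x hx] with ω hω t i
  rw [← stoppedProcess_priceHitting_exitCap]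
  exact hω _ _

theorem stoppedPrice_zero (n : ℕ) (ω : PathSpace (State d F)) :
    stoppedPrice n 0 ω = price 0 ω := by
  rw [stoppedPrice, nonpos_iff_eq_zero.1 (exitCap_le n 0 ω)]

theorem integrable_stoppedPrice_zero (hP : IsStrongMarkovFamily P) {x : State d F}
    {Q : Measure (PathSpace (State d F))} [IsProbabilityMeasure Q] (hQ : Q ≪ P x) (n : ℕ)
    (i : Fin d) : Integrable (fun ω => stoppedPrice n 0 ω i) Q := by
  have h : (fun ω => stoppedPrice n 0 ω i) =ᵐ[Q] fun _ => x.2.1 i := by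
    filter_upwards [hQ.ae_le (hP.start x)] with ω hω
    rw [stoppedPrice_zero, price, hω]
  exact (integrable_const (x.2.1 i)).congr h.symm

theorem slackMartingale_of_mem (hP : IsStrongMarkovFamily P) {a : ℕ → ℝ} (ha : LowerBounds P a)
    {x : State d F} {Q : Measure (PathSpace (State d F))} (hQ : Q ∈ martingaleMeasures P x) {n : ℕ}
    (hn : ‖x.2.1‖ < n) : SlackMartingale (a n) n Q := by
  obtain ⟨h1, h2, -, h4⟩ := hQ
  exact slackMartingale_of_isLocalMartingalePrice h4 (h2.ae_le (ha n x hn))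
    (integrable_stoppedPrice_zero hP h2 n)

/-- Localization uses only large radii, so the test may fail for finitely many `n`. -/
theorem isLocalMartingalePrice_of_eventually (hP : IsStrongMarkovFamily P) {a : ℕ → ℝ}
    (ha : LowerBounds P a) {x : State d F} {Q : Measure (PathSpace (State d F))}
    [IsProbabilityMeasure Q] (hQ : Q ≪ P x) (h : ∀ᶠ n in atTop, SlackMartingale (a n) n Q) :
    IsLocalMartingalePrice Q := by
  obtain ⟨m, hm⟩ := (h.and (tendsto_natCast_atTop_atTop.eventually_gt_atTop
    (‖x.2.1‖))).exists_forall_of_atTop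
  refine isLocalMartingalePrice_of_slackMartingale (a := a) (m := m) (fun n hn => (hm n hn).1)
    (fun n hn => hQ.ae_le (ha n x (hm n hn).2)) ?_
  filter_upwards [hQ.ae_le (hP.start x)] with ω hω
  rw [price, hω]
  exact (hm m le_rfl).2

end Char

/-! ### Gluing a martingale measure with future martingale measures at a stopping time -/

section Pasting

variable {d : ℕ} {F : Type*} [TopologicalSpace F] [PolishSpace F] [MeasurableSpace F] [BorelSpace F]

/-- The past of a path up to a stopping time: the stopped path, the time, and a weight. -/
abbrev Past (d : ℕ) (F : Type*) [TopologicalSpace F] : Type _ :=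
  PathSpace (State d F) × ℝ≥0 × ℝ≥0

/-- The position at the end of the past. -/
def Past.pos (u : Past d F) : State d F := coord u.2.1 u.1

/-- The path with a given past and a given future. -/
def Past.paste (p : Past d F × PathSpace (State d F)) : PathSpace (State d F) :=
  concatPath p.1.2.1 p.1.1 p.2

theorem measurable_pos : Measurable (Past.pos (d := d) (F := F)) :=
  measurable_coord_comp measurable_snd.fst measurable_fst

theorem measurable_paste : Measurable (Past.paste (d := d) (F := F)) :=
  measurable_concatPath_comp measurable_fst.snd.fst measurable_fst.fst measurable_snd

/-- The past of a path up to `τ`. -/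
def pastOf (τ W : PathSpace (State d F) → ℝ≥0) (ω : PathSpace (State d F)) : Past d F :=
  (stopPath (τ ω) ω, τ ω, W ω)

theorem pos_pastOf (τ W : PathSpace (State d F) → ℝ≥0) (ω : PathSpace (State d F)) :
    (pastOf τ W ω).pos = coord (τ ω) ω := by
  rw [pastOf, Past.pos, coord_stopPath, min_self]

theorem paste_pastOf (τ W : PathSpace (State d F) → ℝ≥0) (ω : PathSpace (State d F)) :
    Past.paste (pastOf τ W ω, shift (τ ω) ω) = ω := concatPath_stopPath_shift _ _

theorem measurable_pastOf {τ W : PathSpace (State d F) → ℝ≥0}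
    (hτ : IsStoppingTime (hullFiltration (State d F)) fun ω => (τ ω : WithTop ℝ≥0))
    (hW : Measurable[hτ.measurableSpace] W) : Measurable[hτ.measurableSpace] (pastOf τ W) :=
  let := hτ.measurableSpace
  (measurable_stoppedPath hτ).prodMk ((measurable_stoppingTime_nnreal hτ).prodMk hW)

variable {P : Kernel (State d F) (PathSpace (State d F))} [IsMarkovKernel P] {x : State d F}
  {τ W : PathSpace (State d F) → ℝ≥0}
  {hτ : IsStoppingTime (hullFiltration (State d F)) fun ω => (τ ω : WithTop ℝ≥0)}
  {Q : Measure (PathSpace (State d F))} [IsProbabilityMeasure Q]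

/-- The past records `W`, which is the density of `Q` on events before `τ`. -/
theorem map_withDensity_pastOf (hW : Measurable[hτ.measurableSpace] W)
    (hWQ : ∀ A, MeasurableSet[hτ.measurableSpace] A → ∫⁻ ω in A, W ω ∂(P x) = Q A) :
    ((P x).map (pastOf τ W)).withDensity (fun u => (u.2.2 : ℝ≥0∞)) = Q.map (pastOf τ W) := by
  have hU := measurable_pastOf hτ hW
  have hUm := measurable_of_stoppingTime hτ hU
  ext B hB
  rw [withDensity_apply _ hB, setLIntegral_map hB (by fun_prop) hUm, Measure.map_apply hUm hB]
  exact hWQ _ (hU hB)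

/-- The law prescribed on pairs of past and future is absolutely continuous with respect to the law
of such pairs under `P x`; composing its density with the pair map defines the pasted measure. -/
theorem exists_density_paste (hP : IsStrongMarkovFamily P) (hC : ∃ C : ℝ≥0, ∀ ω, τ ω ≤ C)
    (hW : Measurable[hτ.measurableSpace] W)
    (Q' : Kernel (Past d F) (PathSpace (State d F))) [IsMarkovKernel Q']
    (hQ' : ∀ᵐ u ∂((P x).map (pastOf τ W)), Q' u ≪ P u.pos) (hQP : Q ≪ P x) :
    ∃ Qb : Measure (PathSpace (State d F)), IsProbabilityMeasure Qb ∧ Qb ≪ P x ∧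
      Qb.map (fun ω => (pastOf τ W ω, shift (τ ω) ω)) = (Q.map (pastOf τ W)) ⊗ₘ Q' := by
  have hU := measurable_pastOf hτ hW
  have hUm := measurable_of_stoppingTime hτ hU
  have hθ : Measurable fun ω : PathSpace (State d F) => shift (τ ω) ω :=
    measurable_shift_comp (measurable_of_stoppingTime hτ (measurable_stoppingTime_nnreal hτ))
      measurable_id
  have hUθ := hUm.prodMk hθ
  have : IsProbabilityMeasure ((P x).map (pastOf τ W)) :=
    Measure.isProbabilityMeasure_map hUm.aemeasurable
  have : IsProbabilityMeasure (Q.map (pastOf τ W)) :=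
    Measure.isProbabilityMeasure_map hUm.aemeasurable
  have hmap := map_prodMk_shift hP x hτ hC hU measurable_pos (pos_pastOf τ W)
  have hac : Q.map (pastOf τ W) ⊗ₘ Q' ≪ ((P x).map (pastOf τ W)) ⊗ₘ (P.comap _ measurable_pos) := by
    have h1 : Q.map (pastOf τ W) ≪ (P x).map (pastOf τ W) := hQP.map hUm
    refine Measure.AbsolutelyContinuous.compProd h1 (h1.ae_le ?_)
    filter_upwards [hQ'] with u hu
    rwa [Kernel.comap_apply]
  set R := Q.map (pastOf τ W) ⊗ₘ Q'
  rw [← hmap] at hac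
  set M := (P x).map fun ω => (pastOf τ W ω, shift (τ ω) ω)
  have : IsProbabilityMeasure M := Measure.isProbabilityMeasure_map hUθ.aemeasurable
  have hR : ((P x).withDensity fun ω => R.rnDeriv M (pastOf τ W ω, shift (τ ω) ω)).map
      (fun ω => (pastOf τ W ω, shift (τ ω) ω)) = R := by
    ext B hB
    rw [Measure.map_apply hUθ hB, withDensity_apply _ (hUθ hB),
      ← setLIntegral_map (g := fun ω => (pastOf τ W ω, shift (τ ω) ω)) hB
        (Measure.measurable_rnDeriv R M) hUθ]
    rw [← withDensity_apply _ hB, Measure.withDensity_rnDeriv_eq _ _ hac]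
  refine ⟨_, ⟨?_⟩, withDensity_absolutelyContinuous _ _, hR⟩
  have h2 := congrArg (fun m => m univ) hR
  simp only [Measure.map_apply hUθ MeasurableSet.univ, preimage_univ, measure_univ] at h2
  exact h2

theorem lintegral_paste (hW : Measurable[hτ.measurableSpace] W)
    {Q' : Kernel (Past d F) (PathSpace (State d F))} [IsMarkovKernel Q']
    {Qb : Measure (PathSpace (State d F))}
    (h : Qb.map (fun ω => (pastOf τ W ω, shift (τ ω) ω)) = (Q.map (pastOf τ W)) ⊗ₘ Q')
    {f : PathSpace (State d F) → ℝ≥0∞} (hf : Measurable f) :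
    ∫⁻ ω, f ω ∂Qb = ∫⁻ ω, ∫⁻ ω', f (Past.paste (pastOf τ W ω, ω')) ∂Q' (pastOf τ W ω) ∂Q := by
  have hU := measurable_pastOf hτ hW
  have hUm := measurable_of_stoppingTime hτ hU
  have hθ : Measurable fun ω : PathSpace (State d F) => shift (τ ω) ω :=
    measurable_shift_comp (measurable_of_stoppingTime hτ (measurable_stoppingTime_nnreal hτ))
      measurable_id
  have : IsProbabilityMeasure (Q.map (pastOf τ W)) :=
    Measure.isProbabilityMeasure_map hUm.aemeasurable
  have hfp : Measurable fun p : Past d F × PathSpace (State d F) => f (Past.paste p) :=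
    hf.comp measurable_paste
  calc ∫⁻ ω, f ω ∂Qb = ∫⁻ ω, f (Past.paste (pastOf τ W ω, shift (τ ω) ω)) ∂Qb := by
        simp only [paste_pastOf]
    _ = ∫⁻ p, f (Past.paste p) ∂(Qb.map (fun ω => (pastOf τ W ω, shift (τ ω) ω))) :=
        (lintegral_map hfp (hUm.prodMk hθ)).symm
    _ = _ := by
        rw [h, Measure.lintegral_compProd hfp, lintegral_map hfp.lintegral_kernel_prod_right' hUm]

/-- Domination holds between the laws of pairs, and pasting past and future recovers the path, so it
can be pushed forward. -/
theorem absolutelyContinuous_paste (hP : IsStrongMarkovFamily P) (hC : ∃ C : ℝ≥0, ∀ ω, τ ω ≤ C)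
    (hW : Measurable[hτ.measurableSpace] W)
    {Q' : Kernel (Past d F) (PathSpace (State d F))} [IsMarkovKernel Q']
    (hQ' : ∀ᵐ u ∂((P x).map (pastOf τ W)), P u.pos ≪ Q' u) (hQP : P x ≪ Q)
    {Qb : Measure (PathSpace (State d F))}
    (h : Qb.map (fun ω => (pastOf τ W ω, shift (τ ω) ω)) = (Q.map (pastOf τ W)) ⊗ₘ Q') :
    P x ≪ Qb := by
  have hU := measurable_pastOf hτ hW
  have hUm := measurable_of_stoppingTime hτ hU
  have hθ : Measurable fun ω : PathSpace (State d F) => shift (τ ω) ω :=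
    measurable_shift_comp (measurable_of_stoppingTime hτ (measurable_stoppingTime_nnreal hτ))
      measurable_id
  have hUθ := hUm.prodMk hθ
  have : IsProbabilityMeasure ((P x).map (pastOf τ W)) :=
    Measure.isProbabilityMeasure_map hUm.aemeasurable
  have : IsProbabilityMeasure (Q.map (pastOf τ W)) :=
    Measure.isProbabilityMeasure_map hUm.aemeasurable
  have hmap := map_prodMk_shift hP x hτ hC hU measurable_pos (pos_pastOf τ W)
  have hac : ((P x).map (pastOf τ W)) ⊗ₘ (P.comap _ measurable_pos) ≪ Q.map (pastOf τ W) ⊗ₘ Q' :=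
    Measure.AbsolutelyContinuous.compProd (hQP.map hUm) (by
      filter_upwards [hQ'] with u hu
      rwa [Kernel.comap_apply])
  rw [← hmap, ← h] at hac
  have hid : ∀ m : Measure (PathSpace (State d F)),
      (m.map fun ω => (pastOf τ W ω, shift (τ ω) ω)).map Past.paste = m := fun m => by
    rw [Measure.map_map measurable_paste hUθ]
    have : Past.paste ∘ (fun ω => (pastOf τ W ω, shift (τ ω) ω)) = id :=
      funext fun ω => paste_pastOf τ W ω
    rw [this, Measure.map_id]
  have h3 := hac.map measurable_paste
  rwa [hid, hid] at h3

/-- The effect of the pasted future on the stopped price. -/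
theorem lintegral_slack_future (hP : IsStrongMarkovFamily P) {a : ℕ → ℝ} (ha : LowerBounds P a)
    {n : ℕ} {i : Fin d} {ω : PathSpace (State d F)} {t₀ s t : ℝ≥0} (hst : s ≤ t) (hs : t₀ ≤ s)
    {Q' : Measure (PathSpace (State d F))} (hQ' : Q' ∈ martingaleMeasures P (coord t₀ ω))
    {A : Set (PathSpace (State d F))} (hA : MeasurableSet[rawFiltration (State d F) s] A) :
    ∫⁻ ω', A.indicator (slack (a n) n i t) (concatPath t₀ ω ω') ∂Q' =
      ∫⁻ ω', A.indicator (slack (a n) n i s) (concatPath t₀ ω ω') ∂Q' := by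
  have := hQ'.1
  have hstart : ∀ᵐ ω' ∂Q', coord t₀ ω = coord 0 ω' :=
    hQ'.2.1.ae_le ((hP.start _).mono fun _ h => h.symm)
  -- After an exit the stopped price is frozen. Otherwise it restarts from a position of norm below
  -- `n`, so the constant `a n` is valid for the future and the martingale test applies to it.
  by_cases hh : Hit n ω t₀
  · refine lintegral_congr_ae ?_
    filter_upwards [hstart] with ω' h
    by_cases hA' : concatPath t₀ ω ω' ∈ A
    · rw [indicator_of_mem hA', indicator_of_mem hA', slack, slack,
        stoppedPrice_concatPath_of_hit h hh (hs.trans hst), stoppedPrice_concatPath_of_hit h hh hs]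
    · rw [indicator_of_notMem hA', indicator_of_notMem hA']
  · obtain ⟨u, rfl⟩ := exists_add_of_le hs
    obtain ⟨v, rfl⟩ := exists_add_of_le (hs.trans hst)
    have huv : u ≤ v := by simpa using hst
    have hm := slackMartingale_of_mem hP ha hQ' (norm_lt_of_not_hit hh) i u v huv
      (concatPath t₀ ω ⁻¹' A) (measurable_concatPath_raw u t₀ ω hA)
    have hAm : MeasurableSet (concatPath t₀ ω ⁻¹' A) :=
      (rawFiltration _).le u _ (measurable_concatPath_raw u t₀ ω hA)
    have key : ∀ w, ∫⁻ ω', A.indicator (slack (a n) n i (t₀ + w)) (concatPath t₀ ω ω') ∂Q' =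
        ∫⁻ ω' in concatPath t₀ ω ⁻¹' A, slack (a n) n i w ω' ∂Q' := fun w => by
      rw [← lintegral_indicator hAm]
      refine lintegral_congr_ae ?_
      filter_upwards [hstart] with ω' h
      by_cases hA' : concatPath t₀ ω ω' ∈ A
      · rw [indicator_of_mem hA', indicator_of_mem (show ω' ∈ concatPath t₀ ω ⁻¹' A from hA'),
          slack, slack, stoppedPrice_concatPath_add h hh]
      · rw [indicator_of_notMem hA', indicator_of_notMem
          (show ω' ∉ concatPath t₀ ω ⁻¹' A from hA')]
    rw [key, key, hm]

/-- On `{τ < s}` the step from `s` to `t` lies in the future and is handled by `Q'`. On the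
complement, integrating out the future replaces time `r` by `min τ r`, and optional sampling under
`Q` concludes. -/
theorem slackMartingale_paste (hP : IsStrongMarkovFamily P) {a : ℕ → ℝ} (ha : LowerBounds P a)
    (hW : Measurable[hτ.measurableSpace] W) (hQ : Q ∈ martingaleMeasures P x)
    {Q' : Kernel (Past d F) (PathSpace (State d F))} [IsMarkovKernel Q']
    (hQ' : ∀ᵐ u ∂((P x).map (pastOf τ W)), Q' u ∈ martingaleMeasures P u.pos)
    {Qb : Measure (PathSpace (State d F))}
    (h : Qb.map (fun ω => (pastOf τ W ω, shift (τ ω) ω)) = (Q.map (pastOf τ W)) ⊗ₘ Q') {n : ℕ}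
    (hn : ‖x.2.1‖ < n) : SlackMartingale (a n) n Qb := by
  intro i s t hst A hA
  have hUm := measurable_of_stoppingTime hτ (measurable_pastOf hτ hW)
  have hτm : Measurable τ := measurable_of_stoppingTime hτ (measurable_stoppingTime_nnreal hτ)
  have hAm := (rawFiltration _).le s _ hA
  have hgood : ∀ᵐ ω ∂Q, Q' (pastOf τ W ω) ∈ martingaleMeasures P (coord (τ ω) ω) := by
    filter_upwards [hQ.2.1.ae_le (ae_of_ae_map hUm.aemeasurable hQ')] with ω hω
    rwa [pos_pastOf] at hω
  let J : ℝ≥0 → PathSpace (State d F) → ℝ≥0∞ := fun r ω =>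
    ∫⁻ ω', A.indicator (slack (a n) n i r) (Past.paste (pastOf τ W ω, ω')) ∂Q' (pastOf τ W ω)
  have hpaste : ∀ ω ω', Past.paste (pastOf τ W ω, ω') = concatPath (τ ω) (stopPath (τ ω) ω) ω' :=
    fun _ _ => rfl
  have hself : ∀ ω : PathSpace (State d F), coord (τ ω) (stopPath (τ ω) ω) = coord (τ ω) ω :=
    fun ω => by rw [coord_stopPath, min_self]
  have hJ : ∀ r, ∫⁻ ω in A, slack (a n) n i r ω ∂Qb = ∫⁻ ω, J r ω ∂Q := fun r => by
    rw [← lintegral_indicator hAm, lintegral_paste hW h ((measurable_slack _ _ _ _).indicator hAm)]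
  have hset : MeasurableSet {ω : PathSpace (State d F) | τ ω < s} :=
    measurableSet_lt hτm measurable_const
  have hraw : MeasurableSet[rawFiltration (State d F) s] {ω : PathSpace (State d F) | τ ω < s} := by
    have := measurableSet_inter_lt hτ (A := univ) (@MeasurableSet.univ _ hτ.measurableSpace) s
    rw [univ_inter] at this
    convert this using 1
    ext ω
    exact (WithTop.coe_lt_coe (a := s) (b := τ ω)).symm
  rw [hJ, hJ, ← lintegral_add_compl _ hset, ← lintegral_add_compl (fun ω => J s ω) hset]
  congr 1
  · refine setLIntegral_congr_fun_ae hset ?_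
    filter_upwards [hgood] with ω hω hs
    simp only [J, hpaste]
    exact lintegral_slack_future hP ha hst (le_of_lt hs) (by rwa [hself]) hA
  · have hJt : ∀ r, s ≤ r → ∀ᵐ ω ∂Q, ω ∈ {ω : PathSpace (State d F) | τ ω < s}ᶜ → J r ω =
        A.indicator (fun ω => slack (a n) n i (min (τ ω) r) ω) ω := by
      intro r hr
      filter_upwards [hgood] with ω hω hs
      have hs' : s ≤ τ ω := not_lt.1 hs
      have := hω.1
      have hstart : ∀ᵐ ω' ∂Q' (pastOf τ W ω), coord (τ ω) (stopPath (τ ω) ω) = coord 0 ω' := by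
        rw [hself]
        exact hω.2.1.ae_le ((hP.start _).mono fun _ h => h.symm)
      -- For `s ≤ τ` membership in `A` is decided by the path up to `s`, which the concatenation
      -- does not alter.
      have hmemA : ∀ᵐ ω' ∂Q' (pastOf τ W ω),
          (concatPath (τ ω) (stopPath (τ ω) ω) ω' ∈ A ↔ ω ∈ A) := by
        filter_upwards [hstart] with ω' h'
        have h5 := congrArg (stopPath s) (stopPath_concatPath h')
        simp only [stopPath_stopPath, min_eq_left hs', min_self] at h5
        rw [← stopPath_mem_iff hA, h5, stopPath_mem_iff hA]
      have h2 : ∀ u, ∫⁻ ω', A.indicator (slack (a n) n i u)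
            (concatPath (τ ω) (stopPath (τ ω) ω) ω') ∂Q' (pastOf τ W ω) =
          A.indicator (fun ω => ∫⁻ ω', slack (a n) n i u
            (concatPath (τ ω) (stopPath (τ ω) ω) ω') ∂Q' (pastOf τ W ω)) ω := fun u => by
        by_cases hA' : ω ∈ A
        · rw [indicator_of_mem hA']
          refine lintegral_congr_ae ?_
          filter_upwards [hmemA] with ω' h'
          rw [indicator_of_mem (h'.2 hA')]
        · rw [indicator_of_notMem hA']
          refine (lintegral_congr_ae ?_).trans lintegral_zero
          filter_upwards [hmemA] with ω' h'
          rw [indicator_of_notMem fun hc => hA' (h'.1 hc)]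
      have h3 : ∀ u ≤ τ ω, ∫⁻ ω', slack (a n) n i u
          (concatPath (τ ω) (stopPath (τ ω) ω) ω') ∂Q' (pastOf τ W ω) = slack (a n) n i u ω := by
        intro u hu
        have h4 : ∀ᵐ ω' ∂Q' (pastOf τ W ω), slack (a n) n i u
            (concatPath (τ ω) (stopPath (τ ω) ω) ω') = slack (a n) n i u ω := by
          filter_upwards [hstart] with ω' h'
          rw [slack, slack, stoppedPrice_concatPath_of_le h' hu, stoppedPrice_stopPath hu]
        rw [lintegral_congr_ae h4, lintegral_const, measure_univ, mul_one]
      have h6 : ∫⁻ ω', slack (a n) n i r (concatPath (τ ω) (stopPath (τ ω) ω) ω')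
          ∂Q' (pastOf τ W ω) = slack (a n) n i (min (τ ω) r) ω := by
        rcases le_total r (τ ω) with h7 | h7
        · rw [min_eq_right h7, h3 r h7]
        · have h8 := lintegral_slack_future hP ha (n := n) (i := i) h7 le_rfl
            (ω := stopPath (τ ω) ω) (Q' := Q' (pastOf τ W ω)) (by rwa [hself])
            (MeasurableSet.univ (m := rawFiltration (State d F) (τ ω)))
          simp only [indicator_univ] at h8
          rw [h8, h3 _ le_rfl, min_eq_left h7]
      simp only [J, hpaste]
      rw [h2]
      by_cases hA' : ω ∈ A
      · rw [indicator_of_mem hA', indicator_of_mem hA', h6]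
      · rw [indicator_of_notMem hA', indicator_of_notMem hA']
    have hB : MeasurableSet[rawFiltration (State d F) s] (A \ {ω | τ ω < s}) := hA.diff hraw
    have hBτ : MeasurableSet[hτ.measurableSpace] (A \ {ω | τ ω < s}) := by
      refine measurableSet_of_inter_lt hτ fun r => ?_
      rcases le_or_gt s r with hr | hr
      · refine (raw_le_hull r _ ((rawFiltration _).mono hr _ hB)).inter ?_
        convert hτ.measurableSet_lt r using 1
        ext ω
        exact (WithTop.coe_lt_coe (a := r) (b := τ ω)).symm
      · convert MeasurableSet.empty using 1
        refine eq_empty_of_forall_notMem ?_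
        rintro ω ⟨⟨-, h1⟩, h2⟩
        exact h1 (lt_trans h2 hr)
    have hJ' : ∀ r, s ≤ r → ∫⁻ ω in {ω | τ ω < s}ᶜ, J r ω ∂Q =
        ∫⁻ ω in A \ {ω | τ ω < s}, slack (a n) n i r ω ∂Q := fun r hr => by
      rw [setLIntegral_congr_fun_ae hset.compl (hJt r hr), setLIntegral_indicator hAm,
        ← sdiff_eq, (slackMartingale_of_mem hP ha hQ hn).lintegral_stopped
        (hQ.2.1.ae_le (ha n x hn)) (integrable_stoppedPrice_zero hP hQ.2.1 n) i r hτ hBτ]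
    rw [hJ' t hst, hJ' s le_rfl]
    exact slackMartingale_of_mem hP ha hQ hn i s t hst _ hB

/-- Local martingale measures can be pasted at a bounded stopping time. -/
theorem exists_paste_mem (hP : IsStrongMarkovFamily P) {a : ℕ → ℝ} (ha : LowerBounds P a)
    (hC : ∃ C : ℝ≥0, ∀ ω, τ ω ≤ C) (hW : Measurable[hτ.measurableSpace] W)
    (hQ : Q ∈ martingaleMeasures P x)
    (Q' : Kernel (Past d F) (PathSpace (State d F))) [IsMarkovKernel Q']
    (hQ' : ∀ᵐ u ∂((P x).map (pastOf τ W)), Q' u ∈ martingaleMeasures P u.pos) :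
    ∃ Qb ∈ martingaleMeasures P x,
      Qb.map (fun ω => (pastOf τ W ω, shift (τ ω) ω)) = (Q.map (pastOf τ W)) ⊗ₘ Q' := by
  obtain ⟨Qb, h1, h2, h3⟩ := exists_density_paste hP hC hW Q' (hQ'.mono fun u hu => hu.2.1)
    hQ.2.1
  refine ⟨Qb, ⟨h1, h2, absolutelyContinuous_paste hP hC hW (hQ'.mono fun u hu => hu.2.2.1)
    hQ.2.2.1 h3, isLocalMartingalePrice_of_eventually hP ha h2 ?_⟩, h3⟩
  filter_upwards [tendsto_natCast_atTop_atTop.eventually_gt_atTop ‖x.2.1‖] with n hn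
  exact slackMartingale_paste hP ha hW hQ hQ' h3 hn

end Pasting

end DPP

namespace DPP

/-! ### Conditioning a local martingale measure on the past -/

section Shifted

variable {E : Type*} [TopologicalSpace E] [PolishSpace E] [MeasurableSpace E] [BorelSpace E]
  {τ : PathSpace E → ℝ≥0}

theorem isStoppingTime_add (s : ℝ≥0)
    (hτ : IsStoppingTime (hullFiltration E) fun ω => (τ ω : WithTop ℝ≥0)) :
    IsStoppingTime (hullFiltration E) fun ω => ((τ ω + s : ℝ≥0) : WithTop ℝ≥0) := fun r => by
  by_cases h : s ≤ r
  · have := (hullFiltration E).mono (tsub_le_self (a := r) (b := s)) _ (hτ (r - s))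
    convert this using 1
    ext ω
    rw [mem_ofPred_eq, mem_ofPred_eq, WithTop.coe_le_coe, WithTop.coe_le_coe, le_tsub_iff_right h]
  · convert MeasurableSet.empty using 1
    refine eq_empty_of_forall_notMem fun ω hω => h ?_
    exact le_add_self.trans (WithTop.coe_le_coe.1 hω)

/-- The first `s` units of the future after `τ` are a function of the path stopped at `τ + s`. -/
theorem measurable_shift_stopPath (s : ℝ≥0)
    (hτ : IsStoppingTime (hullFiltration E) fun ω => (τ ω : WithTop ℝ≥0)) :
    Measurable[(isStoppingTime_add s hτ).measurableSpace] fun ω => stopPath s (shift (τ ω) ω) := by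
  have h1 : (fun ω : PathSpace E => stopPath s (shift (τ ω) ω)) =
      fun ω => shift (τ ω) (stopPath (τ ω + s) ω) := funext fun ω => path_ext fun r => by
    rw [coord_stopPath, coord_shift, coord_shift, coord_stopPath, ← min_add_add_right, add_comm s]
  rw [h1]
  have h2 : hτ.measurableSpace ≤ (isStoppingTime_add s hτ).measurableSpace :=
    IsStoppingTime.measurableSpace_mono _ _ fun ω => WithTop.coe_le_coe.2 le_self_add
  let := (isStoppingTime_add s hτ).measurableSpace
  exact measurable_shift_comp ((measurable_stoppingTime_nnreal hτ).mono h2 le_rfl)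
    (measurable_stoppedPath (isStoppingTime_add s hτ))

end Shifted

/-! ### Bayes' formula for the future -/

section Conditioning

variable {d : ℕ} {F : Type*} [TopologicalSpace F] [PolishSpace F] [MeasurableSpace F] [BorelSpace F]
  {P : Kernel (State d F) (PathSpace (State d F))} [IsMarkovKernel P] {x : State d F}
  {τ W : PathSpace (State d F) → ℝ≥0}
  {hτ : IsStoppingTime (hullFiltration (State d F)) fun ω => (τ ω : WithTop ℝ≥0)}
  {D : PathSpace (State d F) → ℝ≥0∞}

/-- The integral of a functional of the future weighted by the density. -/
def futureIntegral (P : Kernel (State d F) (PathSpace (State d F)))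
    (D f : PathSpace (State d F) → ℝ≥0∞) (u : Past d F) : ℝ≥0∞ :=
  ∫⁻ ω', D (Past.paste (u, ω')) * f ω' ∂P u.pos

theorem measurable_futureIntegral (hD : Measurable D) {f : PathSpace (State d F) → ℝ≥0∞}
    (hf : Measurable f) : Measurable (futureIntegral P D f) := by
  have h : Measurable fun p : Past d F × PathSpace (State d F) => D (Past.paste p) * f p.2 :=
    (hD.comp measurable_paste).mul (hf.comp measurable_snd)
  exact h.lintegral_kernel_prod_right' (κ := P.comap _ measurable_pos)

/-- The strong Markov property integrates out the future under `P x`, with the density `D` of the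
measure to be conditioned still attached. -/
theorem setLIntegral_futureIntegral (hP : IsStrongMarkovFamily P) (hC : ∃ C : ℝ≥0, ∀ ω, τ ω ≤ C)
    (hW : Measurable[hτ.measurableSpace] W) (hD : Measurable D)
    {f : PathSpace (State d F) → ℝ≥0∞} (hf : Measurable f) {B : Set (Past d F)}
    (hB : MeasurableSet B) :
    ∫⁻ u in B, futureIntegral P D f u ∂((P x).map (pastOf τ W)) =
      ∫⁻ ω in pastOf τ W ⁻¹' B, f (shift (τ ω) ω) ∂((P x).withDensity D) := by
  have hU := measurable_pastOf hτ hW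
  have hUm := measurable_of_stoppingTime hτ hU
  have hθ : Measurable fun ω : PathSpace (State d F) => shift (τ ω) ω :=
    measurable_shift_comp (measurable_of_stoppingTime hτ (measurable_stoppingTime_nnreal hτ))
      measurable_id
  have hUθ := hUm.prodMk hθ
  have : IsProbabilityMeasure ((P x).map (pastOf τ W)) :=
    Measure.isProbabilityMeasure_map hUm.aemeasurable
  have hmap := map_prodMk_shift hP x hτ hC hU measurable_pos (pos_pastOf τ W)
  have h : Measurable fun p : Past d F × PathSpace (State d F) => D (Past.paste p) * f p.2 :=
    (hD.comp measurable_paste).mul (hf.comp measurable_snd)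
  have h1 := Measure.setLIntegral_compProd (μ := (P x).map (pastOf τ W))
    (κ := P.comap _ measurable_pos) h hB MeasurableSet.univ
  rw [← hmap, setLIntegral_map (hB.prod MeasurableSet.univ) h hUθ] at h1
  simp only [Measure.restrict_univ, Kernel.comap_apply, paste_pastOf] at h1
  change _ = ∫⁻ u in B, futureIntegral P D f u ∂((P x).map (pastOf τ W)) at h1
  have h2 := setLIntegral_withDensity_eq_setLIntegral_mul (P x) hD
    (g := fun ω => f (shift (τ ω) ω)) (hf.comp hθ) (hUm hB)
  rw [← h1, h2]
  congr 2
  ext ω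
  simp

/-- The normalising constant in Bayes' formula is the weight at `τ`. -/
theorem ae_futureIntegral_one (hP : IsStrongMarkovFamily P) (hC : ∃ C : ℝ≥0, ∀ ω, τ ω ≤ C)
    (hW : Measurable[hτ.measurableSpace] W) (hD : Measurable D)
    (hWD : ∀ A, MeasurableSet[hτ.measurableSpace] A →
      ∫⁻ ω in A, W ω ∂(P x) = (P x).withDensity D A) :
    ∀ᵐ u ∂((P x).map (pastOf τ W)), futureIntegral P D 1 u = u.2.2 := by
  have hU := measurable_pastOf hτ hW
  have hUm := measurable_of_stoppingTime hτ hU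
  have : IsProbabilityMeasure ((P x).map (pastOf τ W)) :=
    Measure.isProbabilityMeasure_map hUm.aemeasurable
  refine ae_eq_of_forall_setLIntegral_eq_of_sigmaFinite (measurable_futureIntegral hD
    measurable_one) (by fun_prop) fun B hB _ => ?_
  rw [setLIntegral_futureIntegral hP hC hW hD measurable_one hB,
    setLIntegral_map hB (by fun_prop) hUm]
  simp only [Pi.one_apply, setLIntegral_one]
  exact (hWD _ (hU hB)).symm

/-- The conditional law of the future given the past. -/
def futureLaw (P : Kernel (State d F) (PathSpace (State d F))) (D : PathSpace (State d F) → ℝ≥0∞)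
    (u : Past d F) : Measure (PathSpace (State d F)) :=
  (P u.pos).withDensity fun ω' => (u.2.2 : ℝ≥0∞)⁻¹ * D (Past.paste (u, ω'))

theorem measurable_futureLaw_density (hD : Measurable D) (u : Past d F) :
    Measurable fun ω' => (u.2.2 : ℝ≥0∞)⁻¹ * D (Past.paste (u, ω')) :=
  (hD.comp (measurable_paste.comp measurable_prodMk_left)).const_mul _

theorem lintegral_futureLaw (hD : Measurable D) {f : PathSpace (State d F) → ℝ≥0∞}
    (hf : Measurable f) (u : Past d F) :
    ∫⁻ ω, f ω ∂futureLaw P D u = (u.2.2 : ℝ≥0∞)⁻¹ * futureIntegral P D f u := by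
  have h : Measurable fun ω' => D (Past.paste (u, ω')) :=
    hD.comp (measurable_paste.comp measurable_prodMk_left)
  rw [futureLaw, lintegral_withDensity_eq_lintegral_mul _ (measurable_futureLaw_density hD u) hf,
    futureIntegral, ← lintegral_const_mul (f := fun ω' => D (Past.paste (u, ω')) * f ω') _
      (h.mul hf)]
  simp only [Pi.mul_apply, mul_assoc]

/-- Tested against events of the past without an exit, future slacks at `s` and `t` become slacks at
`τ + s` and `τ + t` of the whole path, and optional sampling compares both with one later time. -/
theorem ae_slack_future (hP : IsStrongMarkovFamily P) {a : ℕ → ℝ} (ha : LowerBounds P a)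
    (hC : ∃ C : ℝ≥0, ∀ ω, τ ω ≤ C) (hW : Measurable[hτ.measurableSpace] W) (hD : Measurable D)
    (hQ : (P x).withDensity D ∈ martingaleMeasures P x) {n : ℕ} (hn : ‖x.2.1‖ < n) (i : Fin d)
    {s t : ℝ≥0} (hst : s ≤ t) {A : Set (PathSpace (State d F))} (hA : MeasurableSet A) :
    ∀ᵐ u ∂((P x).map (pastOf τ W)), ¬ Hit n u.1 u.2.1 →
      futureIntegral P D ((stopPath s ⁻¹' A).indicator (slack (a n) n i t)) u =
        futureIntegral P D ((stopPath s ⁻¹' A).indicator (slack (a n) n i s)) u := by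
  have hU := measurable_pastOf hτ hW
  have hUm := measurable_of_stoppingTime hτ hU
  have hτm : Measurable τ := measurable_of_stoppingTime hτ (measurable_stoppingTime_nnreal hτ)
  have hQp := hQ.1
  have : IsProbabilityMeasure ((P x).map (pastOf τ W)) :=
    Measure.isProbabilityMeasure_map hUm.aemeasurable
  have hAs : MeasurableSet (stopPath (E := State d F) s ⁻¹' A) := measurable_stopPath s hA
  have hS : MeasurableSet {u : Past d F | ¬ Hit n u.1 u.2.1} := by
    -- The time is itself a variable here; capped exit times at integers give joint measurability.
    have : {u : Past d F | ¬ Hit n u.1 u.2.1} = ⋃ k : ℕ, {u | u.2.1 < exitCap n k u.1} := by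
      ext u
      simp only [mem_ofPred_eq, mem_iUnion, ← not_le, exitCap_le_iff, not_or]
      refine ⟨fun h => ?_, fun ⟨k, hk⟩ => hk.2⟩
      obtain ⟨k, hk⟩ := exists_nat_gt u.2.1
      exact ⟨k, not_le.2 hk, h⟩
    rw [this]
    exact MeasurableSet.iUnion fun k => measurableSet_lt measurable_snd.fst
      ((measurable_exitCap n k).comp measurable_fst)
  have hm := slackMartingale_of_mem hP ha hQ hn
  obtain ⟨C, hC'⟩ := hC
  refine (ae_restrict_iff' hS).1 ?_
  refine ae_eq_of_forall_setLIntegral_eq_of_sigmaFinite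
    (measurable_futureIntegral hD ((measurable_slack _ _ _ _).indicator hAs))
    (measurable_futureIntegral hD ((measurable_slack _ _ _ _).indicator hAs)) fun B hB _ => ?_
  rw [Measure.restrict_restrict hB]
  have hBS := hB.inter hS
  have hθA : MeasurableSet ((fun ω => shift (τ ω) ω) ⁻¹' (stopPath (E := State d F) s ⁻¹' A)) :=
    measurable_shift_comp hτm measurable_id hAs
  have hset : MeasurableSet[(isStoppingTime_add s hτ).measurableSpace]
      ((fun ω => shift (τ ω) ω) ⁻¹' (stopPath (E := State d F) s ⁻¹' A) ∩
        pastOf τ W ⁻¹' (B ∩ {u : Past d F | ¬ Hit n u.1 u.2.1})) := by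
    have h2 : hτ.measurableSpace ≤ (isStoppingTime_add s hτ).measurableSpace :=
      IsStoppingTime.measurableSpace_mono _ _ fun ω => WithTop.coe_le_coe.2 le_self_add
    exact (measurable_shift_stopPath s hτ hA).inter (h2 _ (hU hBS))
  -- The right side does not depend on `r`: time `C + t` dominates every `τ + r`, so both times are
  -- compared with it.
  have key : ∀ r, s ≤ r → r ≤ t →
      ∫⁻ u in B ∩ {u : Past d F | ¬ Hit n u.1 u.2.1},
        futureIntegral P D ((stopPath s ⁻¹' A).indicator (slack (a n) n i r)) u
          ∂((P x).map (pastOf τ W)) =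
      ∫⁻ ω in (fun ω => shift (τ ω) ω) ⁻¹' (stopPath (E := State d F) s ⁻¹' A) ∩
        pastOf τ W ⁻¹' (B ∩ {u : Past d F | ¬ Hit n u.1 u.2.1}), slack (a n) n i (C + t) ω
          ∂((P x).withDensity D) := by
    intro r hsr hrt
    rw [setLIntegral_futureIntegral hP ⟨C, hC'⟩ hW hD ((measurable_slack _ _ _ _).indicator hAs) hBS]
    have h3 : ∀ ω, ω ∈ pastOf τ W ⁻¹' (B ∩ {u : Past d F | ¬ Hit n u.1 u.2.1}) →
        (stopPath s ⁻¹' A).indicator (slack (a n) n i r) (shift (τ ω) ω) =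
        ((fun ω => shift (τ ω) ω) ⁻¹' (stopPath s ⁻¹' A)).indicator
          (fun ω => slack (a n) n i (min (τ ω + r) (C + t)) ω) ω := by
      intro ω hω
      by_cases h4 : shift (τ ω) ω ∈ stopPath s ⁻¹' A
      · rw [indicator_of_mem h4, indicator_of_mem (by exact h4),
          min_eq_left (add_le_add (hC' ω) hrt), slack, slack]
        have h5 := stoppedPrice_concatPath_add (n := n) (t := τ ω) (v := r)
          (ω := stopPath (τ ω) ω) (ω' := shift (τ ω) ω)
          (by rw [coord_stopPath, coord_shift, min_self, zero_add]) hω.2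
        rw [concatPath_stopPath_shift] at h5
        rw [h5]
      · rw [indicator_of_notMem h4, indicator_of_notMem (by exact h4)]
    rw [setLIntegral_congr_fun (hUm hBS) h3, setLIntegral_indicator hθA]
    have h6 : (isStoppingTime_add s hτ).measurableSpace ≤
        (isStoppingTime_add r hτ).measurableSpace :=
      IsStoppingTime.measurableSpace_mono _ _ fun ω => WithTop.coe_le_coe.2 (by gcongr)
    exact hm.lintegral_stopped (hQ.2.1.ae_le (ha n x hn)) (integrable_stoppedPrice_zero hP hQ.2.1 n)
      i (C + t) (isStoppingTime_add r hτ) (h6 _ hset)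
  rw [key t hst le_rfl, key s le_rfl hst]

/-- Conditioning on the past yields local martingale measures. -/
theorem ae_futureLaw_mem (hP : IsStrongMarkovFamily P) {a : ℕ → ℝ} (ha : LowerBounds P a)
    (hC : ∃ C : ℝ≥0, ∀ ω, τ ω ≤ C) (hW : Measurable[hτ.measurableSpace] W) (hD : Measurable D)
    (hQ : (P x).withDensity D ∈ martingaleMeasures P x)
    (hWD : ∀ A, MeasurableSet[hτ.measurableSpace] A →
      ∫⁻ ω in A, W ω ∂(P x) = (P x).withDensity D A) :
    ∀ᵐ u ∂((P x).map (pastOf τ W)), u.2.2 ≠ 0 ∧ futureLaw P D u ∈ martingaleMeasures P u.pos := by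
  have hU := measurable_pastOf hτ hW
  have hUm := measurable_of_stoppingTime hτ hU
  have hθ : Measurable fun ω : PathSpace (State d F) => shift (τ ω) ω :=
    measurable_shift_comp (measurable_of_stoppingTime hτ (measurable_stoppingTime_nnreal hτ))
      measurable_id
  have hUθ := hUm.prodMk hθ
  have : IsProbabilityMeasure ((P x).map (pastOf τ W)) :=
    Measure.isProbabilityMeasure_map hUm.aemeasurable
  have hD0 : ∀ᵐ ω ∂P x, D ω ≠ 0 :=
    hQ.2.2.1.ae_le ((ae_withDensity_iff hD).2 (Eventually.of_forall fun ω h => h))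
  have hW0 : ∀ᵐ u ∂((P x).map (pastOf τ W)), u.2.2 ≠ 0 := by
    have hm : MeasurableSet {u : Past d F | u.2.2 ≠ 0} :=
      measurable_snd.snd (measurableSet_singleton (0 : ℝ≥0)).compl
    refine (ae_map_iff hUm.aemeasurable hm).2 ?_
    have h0 : MeasurableSet[hτ.measurableSpace] {ω | W ω = 0} := hW (measurableSet_singleton 0)
    -- Where the weight at `τ` vanishes the martingale measure has no mass, and by equivalence
    -- neither has `P x`.
    have h1 : (P x).withDensity D {ω | W ω = 0} = 0 := by
      rw [← hWD _ h0, setLIntegral_congr_fun (g := fun _ => 0) (hτ.measurableSpace_le _ h0)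
        fun ω (hω : W ω = 0) => by simp [hω]]
      simp
    exact measure_eq_zero_iff_ae_notMem.1 (hQ.2.2.1 h1)
  have hDu : ∀ᵐ u ∂((P x).map (pastOf τ W)), ∀ᵐ ω' ∂P u.pos, D (Past.paste (u, ω')) ≠ 0 := by
    have hmap := map_prodMk_shift hP x hτ hC hU measurable_pos (pos_pastOf τ W)
    have h1 : ∀ᵐ p ∂((P x).map (pastOf τ W) ⊗ₘ P.comap _ measurable_pos),
        D (Past.paste p) ≠ 0 := by
      have hm : MeasurableSet {p : Past d F × PathSpace (State d F) | D (Past.paste p) ≠ 0} :=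
        (hD.comp measurable_paste) (measurableSet_singleton (0 : ℝ≥0∞)).compl
      rw [← hmap]
      refine (ae_map_iff hUθ.aemeasurable hm).2 ?_
      simpa only [paste_pastOf] using hD0
    filter_upwards [Measure.ae_ae_of_ae_compProd h1] with u hu
    rwa [Kernel.comap_apply] at hu
  obtain ⟨b, hπ, hgen, huniv⟩ := exists_piSystem_nat (PathSpace (State d F))
  have hbm : ∀ k, MeasurableSet (b k) := fun k => by
    have := MeasurableSpace.measurableSet_generateFrom (mem_range_self (f := b) k)
    rwa [← hgen] at this
  have hslack : ∀ᵐ u ∂((P x).map (pastOf τ W)), ∀ n : ℕ, ‖x.2.1‖ < n → ∀ (i : Fin d) (s t : ℚ≥0),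
      s ≤ t → ∀ k, ¬ Hit n u.1 u.2.1 →
      futureIntegral P D ((stopPath s ⁻¹' b k).indicator (slack (a n) n i t)) u =
        futureIntegral P D ((stopPath s ⁻¹' b k).indicator (slack (a n) n i s)) u := by
    simp only [ae_all_iff]
    exact fun n hn i s t hst k => ae_slack_future hP ha hC hW hD hQ hn i (by exact_mod_cast hst)
      (hbm k)
  filter_upwards [hW0, hDu, hslack, ae_futureIntegral_one hP hC hW hD hWD] with u h1 h2 h3 h4
  have hprob : IsProbabilityMeasure (futureLaw P D u) := ⟨by
    rw [← lintegral_one]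
    rw [show (fun _ => 1 : PathSpace (State d F) → ℝ≥0∞) = 1 from rfl,
      lintegral_futureLaw hD measurable_one, h4, ENNReal.inv_mul_cancel] <;> simp [h1]⟩
  have hac : futureLaw P D u ≪ P u.pos := withDensity_absolutelyContinuous _ _
  refine ⟨h1, hprob, hac, ?_, ?_⟩
  · refine withDensity_absolutelyContinuous' (measurable_futureLaw_density hD u).aemeasurable ?_
    filter_upwards [h2] with ω' hω'
    exact mul_ne_zero (ENNReal.inv_ne_zero.2 ENNReal.coe_ne_top) hω'
  · refine isLocalMartingalePrice_of_eventually hP ha hac ?_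
    -- For a given past, large radii exceed both initial norms and are not reached before `τ`, as
    -- paths are bounded on bounded intervals.
    filter_upwards [tendsto_natCast_atTop_atTop.eventually_gt_atTop ‖x.2.1‖,
      tendsto_natCast_atTop_atTop.eventually_gt_atTop ‖u.pos.2.1‖,
      eventually_not_hit u.1 u.2.1] with n hn hn' hh
    refine slackMartingale_of_rat hπ hgen huniv (hac.ae_le (ha n _ hn'))
      (integrable_stoppedPrice_zero hP hac n) fun i s t hst k => ?_
    have hAs : MeasurableSet (stopPath (E := State d F) (s : ℝ≥0) ⁻¹' b k) :=
      measurable_stopPath _ (hbm k)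
    rw [← lintegral_indicator hAs, ← lintegral_indicator hAs,
      lintegral_futureLaw hD ((measurable_slack _ _ _ _).indicator hAs),
      lintegral_futureLaw hD ((measurable_slack _ _ _ _).indicator hAs), h3 n hn i s t hst k hh]

end Conditioning

end DPP

namespace DPP

/-! ### Regularity of nonnegative martingales along the rationals -/

theorem measure_le_of_eventually_mem {Ω : Type*} [MeasurableSpace Ω] {μ : Measure Ω} {S : Set Ω}
    {E : ℕ → Set Ω} {c : ℝ≥0∞} (hS : ∀ ω ∈ S, ∀ᶠ k in atTop, ω ∈ E k) (hE : ∀ k, μ (E k) ≤ c) :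
    μ S ≤ c := by
  have h1 : S ⊆ ⋃ K, ⋂ k ≥ K, E k := fun ω hω => by
    obtain ⟨K, hK⟩ := eventually_atTop.1 (hS ω hω)
    exact mem_iUnion.2 ⟨K, mem_iInter₂.2 hK⟩
  refine (measure_mono h1).trans ?_
  rw [Monotone.measure_iUnion]
  · exact iSup_le fun K => (measure_mono (iInter₂_subset K le_rfl)).trans (hE K)
  · exact fun K L h => biInter_mono (fun k (hk : L ≤ k) => h.trans hk) fun _ _ => le_rfl

/-- `n` successive upcrossings of `[a, b]` before `T`. -/
def UpChain (a b : ℝ) (f : ℚ≥0 → ℝ≥0) : ℕ → ℚ≥0 → Prop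
  | 0, _ => True
  | n + 1, T => ∃ q₁ q₂, q₁ < q₂ ∧ q₂ < T ∧ UpChain a b f n q₁ ∧ (f q₁ : ℝ) < a ∧ b < f q₂

theorem UpChain.mono {a b : ℝ} {f : ℚ≥0 → ℝ≥0} {n : ℕ} {S T : ℚ≥0} (h : UpChain a b f n S)
    (hST : S ≤ T) : UpChain a b f n T := by
  cases n with
  | zero => trivial
  | succ n =>
    obtain ⟨q₁, q₂, h1, h2, h3⟩ := h
    exact ⟨q₁, q₂, h1, h2.trans_le hST, h3⟩

theorem upChain_of_frequently_right {a b : ℝ} {f : ℚ≥0 → ℝ≥0} {t : ℝ≥0}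
    (ha : ∃ᶠ q in rightFilter t, (f q : ℝ) < a) (hb : ∃ᶠ q in rightFilter t, b < f q) (n : ℕ)
    (T : ℚ≥0) (hT : t < T) : UpChain a b f n T := by
  have key : ∀ {p : ℚ≥0 → Prop}, (∃ᶠ q in rightFilter t, p q) → ∀ T : ℚ≥0, t < T →
      ∃ q : ℚ≥0, t < q ∧ q < T ∧ p q := fun {p} hp T hT => by
    obtain ⟨q, hq, h1, h2⟩ := (hp.and_eventually (mem_rightFilter.2 ⟨(T : ℝ≥0), hT,
      fun q h1 h2 => (show q ∈ {q : ℚ≥0 | t < q ∧ q < T} from ⟨h1, by exact_mod_cast h2⟩)⟩)).exists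
    exact ⟨q, h1, h2, hq⟩
  induction n generalizing T with
  | zero => trivial
  | succ n ih =>
    obtain ⟨q₂, h1, h2, h3⟩ := key hb T hT
    obtain ⟨q₁, h4, h5, h6⟩ := key ha q₂ h1
    exact ⟨q₁, q₂, h5, h2, ih q₁ h4, h6, h3⟩

theorem upChain_of_frequently_left {a b : ℝ} {f : ℚ≥0 → ℝ≥0} {t : ℝ≥0} (ht : 0 < t)
    (ha : ∃ᶠ q in leftFilter t, (f q : ℝ) < a) (hb : ∃ᶠ q in leftFilter t, b < f q) (n : ℕ) :
    ∃ T : ℚ≥0, (T : ℝ≥0) < t ∧ UpChain a b f n T := by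
  have key : ∀ {p : ℚ≥0 → Prop}, (∃ᶠ q in leftFilter t, p q) → ∀ T : ℚ≥0, (T : ℝ≥0) < t →
      ∃ q : ℚ≥0, T < q ∧ (q : ℝ≥0) < t ∧ p q := fun {p} hp T hT => by
    obtain ⟨q, hq, h1, h2⟩ := (hp.and_eventually ((mem_leftFilter ht).2 ⟨(T : ℝ≥0), hT,
      fun q h1 h2 => (show q ∈ {q : ℚ≥0 | T < q ∧ (q : ℝ≥0) < t} from
        ⟨by exact_mod_cast h1, h2⟩)⟩)).exists
    exact ⟨q, h1, h2, hq⟩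
  induction n with
  | zero => exact ⟨0, by simpa using ht, trivial⟩
  | succ n ih =>
    obtain ⟨T, hT, hn⟩ := ih
    obtain ⟨q₁, h1, h2, h3⟩ := key ha T hT
    obtain ⟨q₂, h4, h5, h6⟩ := key hb q₁ h2
    obtain ⟨T', h7, h8, -⟩ := key hb q₂ h5
    exact ⟨T', h8, q₁, q₂, h4, h7, hn.mono h1.le, h3, h6⟩

theorem exists_nat_eq_mul {q : ℚ≥0} {N : ℕ} (h : q.den ∣ N) : ∃ m : ℕ, (m : ℚ≥0) = q * N := by
  obtain ⟨c, rfl⟩ := h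
  refine ⟨q.num * c, ?_⟩
  push_cast
  rw [← mul_assoc, NNRat.mul_den_eq_num]

/-- A chain uses finitely many rationals; every grid whose fineness is divisible by their
denominators contains them all, and sees the chain as genuine upcrossings. -/
theorem UpChain.le_upcrossingsBefore {Ω : Type*} {a b : ℝ} (hab : a < b) {f : ℚ≥0 → Ω → ℝ≥0}
    {ω : Ω} {n : ℕ} {T : ℚ≥0} (h : UpChain a b (fun q => f q ω) n T) :
    ∃ K : ℕ, 0 < K ∧ ∀ N, K ∣ N → 0 < N → ∀ M : ℕ, T * N ≤ M →
      n ≤ upcrossingsBefore a b (fun (j : ℕ) ω => ((f (j / N) ω : ℝ≥0) : ℝ)) M ω := by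
  induction n generalizing T with
  | zero => exact ⟨1, one_pos, fun _ _ _ _ _ => Nat.zero_le _⟩
  | succ n ih =>
    obtain ⟨q₁, q₂, h1, h2, h3, h4, h5⟩ := h
    obtain ⟨K, hK, hK'⟩ := ih h3
    refine ⟨K * (q₁.den * q₂.den), by have := q₁.den_pos; have := q₂.den_pos; positivity,
      fun N hN hN0 M hM => ?_⟩
    obtain ⟨N₁, hN₁⟩ := exists_nat_eq_mul (q := q₁) (N := N)
      (((Dvd.intro _ rfl).trans (Dvd.intro_left _ rfl)).trans hN)
    obtain ⟨N₂, hN₂⟩ := exists_nat_eq_mul (q := q₂) (N := N)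
      (((Dvd.intro_left _ rfl).trans (Dvd.intro_left _ rfl)).trans hN)
    have hN' : (0 : ℚ≥0) < N := by exact_mod_cast hN0
    have e₁ : (N₁ : ℚ≥0) / N = q₁ := by rw [hN₁, mul_div_cancel_right₀ _ hN'.ne']
    have e₂ : (N₂ : ℚ≥0) / N = q₂ := by rw [hN₂, mul_div_cancel_right₀ _ hN'.ne']
    have h12 : N₁ ≤ N₂ := by
      have : (N₁ : ℚ≥0) ≤ N₂ := by rw [hN₁, hN₂]; gcongr
      exact_mod_cast this
    have h2M : N₂ + 1 ≤ M := by
      have : (N₂ : ℚ≥0) < M := by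
        rw [hN₂]; exact (mul_lt_mul_of_pos_right h2 hN').trans_le hM
      exact_mod_cast this
    have := hK' N ((Dvd.intro _ rfl).trans hN) hN0 N₁ hN₁.ge
    have hlt := upcrossingsBefore_lt_of_exists_upcrossing (ω := ω)
      (f := fun (j : ℕ) ω => ((f (j / N) ω : ℝ≥0) : ℝ)) hab (N := N₁) le_rfl
      (by simpa only [e₁] using h4) h12 (by simpa only [e₂] using h5)
    exact (Nat.succ_le_of_lt (this.trans_lt hlt)).trans (upcrossingsBefore_mono hab h2M ω)

/-! ### Doob's inequalities on refining grids -/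

section Regularity

variable {Ω : Type*} {m : MeasurableSpace Ω} {P : Measure Ω} [IsProbabilityMeasure P]
  {ℱ : Filtration ℝ≥0 m} {f : ℚ≥0 → Ω → ℝ≥0} {D : Ω → ℝ}

/-- The restriction of a filtration to the grid of mesh `1 / N`. -/
def gridFiltration (ℱ : Filtration ℝ≥0 m) (N : ℕ) : Filtration ℕ m where
  seq j := ℱ (j / N)
  mono' i j h := ℱ.mono (by gcongr)
  le' _ := ℱ.le _

theorem martingale_grid (hf : ∀ q : ℚ≥0, Measurable[ℱ q] (f q))
    (hfD : ∀ q : ℚ≥0, (fun ω => (f q ω : ℝ)) =ᵐ[P] P[D | ℱ q]) (N : ℕ) :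
    Martingale (fun (j : ℕ) ω => ((f (j / N) ω : ℝ≥0) : ℝ)) (gridFiltration ℱ N) P := by
  have hq : ∀ j : ℕ, (((j / N : ℚ≥0) : ℚ≥0) : ℝ≥0) = j / N := fun j => by push_cast; rfl
  refine ⟨fun j => ?_, fun i j hij => ?_⟩
  · have := hf (j / N)
    rw [hq] at this
    exact (measurable_coe_nnreal_real.comp this).stronglyMeasurable
  · have h1 := hfD (j / N)
    have h2 := hfD (i / N)
    rw [hq] at h1 h2
    refine (condExp_congr_ae h1).trans (EventuallyEq.trans ?_ h2.symm)
    exact condExp_condExp_of_le ((gridFiltration ℱ N).mono hij) (ℱ.le _)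

theorem integral_grid (hfD : ∀ q : ℚ≥0, (fun ω => (f q ω : ℝ)) =ᵐ[P] P[D | ℱ q]) (q : ℚ≥0) :
    ∫ ω, (f q ω : ℝ) ∂P = ∫ ω, D ω ∂P := by
  rw [integral_congr_ae (hfD q), integral_condExp (ℱ.le _)]

/-- Doob's upcrossing inequality bounds the expected number of upcrossings uniformly over grids, and
Markov's inequality finishes. Factorial grids are used because `k!` is eventually divisible by any
given integer. -/
theorem measure_upChain_eq_zero (hf : ∀ q : ℚ≥0, Measurable[ℱ q] (f q))
    (hfD : ∀ q : ℚ≥0, (fun ω => (f q ω : ℝ)) =ᵐ[P] P[D | ℱ q]) {a b : ℝ}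
    (ha : 0 ≤ a) (hab : a < b) (T : ℕ) :
    P {ω | ∀ n, UpChain a b (fun q => f q ω) n T} = 0 := by
  set C : ℝ := (∫ ω, D ω ∂P) / (b - a)
  have hba : 0 < b - a := sub_pos.2 hab
  have hC : 0 ≤ C := by
    refine div_nonneg ?_ hba.le
    rw [← integral_grid hfD 0]
    exact integral_nonneg fun ω => NNReal.coe_nonneg _
  have hn : ∀ n : ℕ, P {ω | ∀ n, UpChain a b (fun q => f q ω) n T} ≤
      ENNReal.ofReal (C / (n + 1)) := fun n => by
    refine measure_le_of_eventually_mem (E := fun k => {ω | n + 1 ≤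
      upcrossingsBefore a b (fun (j : ℕ) ω => ((f (j / (k.factorial : ℕ)) ω : ℝ≥0) : ℝ)) (T * k.factorial) ω})
      (fun ω hω => ?_) fun k => ?_
    · obtain ⟨K, hK, h⟩ := (hω (n + 1)).le_upcrossingsBefore hab
      filter_upwards [eventually_ge_atTop K] with k hk
      exact h _ (Nat.dvd_factorial hK hk) (Nat.factorial_pos k) _ (by push_cast; rfl)
    · have hM := martingale_grid hf hfD k.factorial
      have h1 := hM.submartingale.mul_integral_upcrossingsBefore_le_integral_pos_part a b (T * k.factorial)
      have h2 : ∫ ω, ((((f ((T * k.factorial : ℕ) / (k.factorial : ℕ)) ω : ℝ≥0) : ℝ) - a)⁺) ∂P ≤ ∫ ω, D ω ∂P := by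
        rw [← integral_grid hfD ((T * k.factorial : ℕ) / (k.factorial : ℕ))]
        refine integral_mono_of_nonneg (Eventually.of_forall fun ω => posPart_nonneg _)
          (hM.integrable (T * k.factorial)) (Eventually.of_forall fun ω => ?_)
        exact sup_le (sub_le_self _ ha) (NNReal.coe_nonneg _)
      have h3 := mul_meas_ge_le_integral_of_nonneg (μ := P) (Eventually.of_forall fun ω => by
          positivity) (hM.stronglyAdapted.integrable_upcrossingsBefore hab (N := T * k.factorial)) (n + 1 : ℝ)
      refine (ENNReal.le_ofReal_iff_toReal_le (measure_ne_top _ _) (by positivity)).2 ?_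
      rw [le_div_iff₀ (by positivity), le_div_iff₀ hba]
      have h4 : {ω | n + 1 ≤ upcrossingsBefore a b
          (fun (j : ℕ) ω => ((f (j / (k.factorial : ℕ)) ω : ℝ≥0) : ℝ)) (T * k.factorial) ω} =
          {ω | (n + 1 : ℝ) ≤ (upcrossingsBefore a b
          (fun (j : ℕ) ω => ((f (j / (k.factorial : ℕ)) ω : ℝ≥0) : ℝ)) (T * k.factorial) ω : ℝ)} := by
        ext ω; simp only [mem_ofPred_eq]; norm_cast
      rw [h4]
      refine le_trans ?_ (h1.trans h2)
      rw [mul_comm, mul_comm _ (n + 1 : ℝ)]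
      exact mul_le_mul_of_nonneg_left h3 hba.le
  refine le_antisymm (ge_of_tendsto' (x := atTop) ?_ hn) (zero_le)
  rw [← ENNReal.ofReal_zero]
  refine ENNReal.tendsto_ofReal ?_
  exact tendsto_const_nhds.div_atTop (tendsto_atTop_add_const_right _ _ tendsto_natCast_atTop_atTop)

/-- Doob's maximal inequality on factorial grids, with a bound independent of the grid. -/
theorem ae_bddAbove_of_martingale (hf : ∀ q : ℚ≥0, Measurable[ℱ q] (f q))
    (hfD : ∀ q : ℚ≥0, (fun ω => (f q ω : ℝ)) =ᵐ[P] P[D | ℱ q]) (T : ℕ) :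
    ∀ᵐ ω ∂P, ∃ n : ℕ, ∀ q ≤ (T : ℚ≥0), f q ω ≤ n := by
  have hC : 0 ≤ ∫ ω, D ω ∂P := by
    rw [← integral_grid hfD 0]
    exact integral_nonneg fun ω => NNReal.coe_nonneg _
  have hn : ∀ n : ℕ, P {ω | ¬ ∃ n : ℕ, ∀ q ≤ (T : ℚ≥0), f q ω ≤ n} ≤
      ENNReal.ofReal (∫ ω, D ω ∂P) / ((n + 1 : ℕ) : ℝ≥0∞) := fun n => by
    refine measure_le_of_eventually_mem (E := fun k => {ω | (((n + 1 : ℕ) : ℝ≥0) : ℝ) ≤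
      (Finset.range (T * k.factorial + 1)).sup' Finset.nonempty_range_add_one
        fun (j : ℕ) => ((f (j / (k.factorial : ℕ)) ω : ℝ≥0) : ℝ)}) (fun ω hω => ?_) fun k => ?_
    · simp only [mem_ofPred_eq, not_exists, not_forall, not_le] at hω
      obtain ⟨q, hq, hq'⟩ := hω (n + 1)
      filter_upwards [eventually_ge_atTop q.den] with k hk
      obtain ⟨j, hj⟩ := exists_nat_eq_mul (Nat.dvd_factorial q.den_pos hk)
      have hk0 : (0 : ℚ≥0) < (k.factorial : ℕ) := by exact_mod_cast Nat.factorial_pos k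
      have e : (j : ℚ≥0) / (k.factorial : ℕ) = q := by rw [hj, mul_div_cancel_right₀ _ hk0.ne']
      have hjT : j < T * k.factorial + 1 := by
        have : (j : ℚ≥0) ≤ (T * k.factorial : ℕ) := by rw [hj]; push_cast; gcongr
        exact Nat.lt_succ_of_le (by exact_mod_cast this)
      refine le_trans ?_ (Finset.le_sup' (fun (j : ℕ) => ((f (j / (k.factorial : ℕ)) ω : ℝ≥0) : ℝ))
        (Finset.mem_range.2 hjT))
      simp only [e]
      exact_mod_cast hq'.le
    · have hM := martingale_grid hf hfD k.factorial
      have h1 := maximal_ineq hM.submartingale (fun j ω => NNReal.coe_nonneg _)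
        (ε := ((n + 1 : ℕ) : ℝ≥0)) (T * k.factorial)
      rw [ENNReal.le_div_iff_mul_le (Or.inl (by simp)) (Or.inl (by simp)), mul_comm]
      refine le_trans (by exact_mod_cast h1) (ENNReal.ofReal_le_ofReal ?_)
      rw [← integral_grid hfD ((T * k.factorial : ℕ) / (k.factorial : ℕ))]
      exact setIntegral_le_integral (hM.integrable (T * k.factorial))
        (Eventually.of_forall fun ω => NNReal.coe_nonneg _)
  refine le_antisymm (ge_of_tendsto' (x := atTop) ?_ hn) (zero_le)
  refine Tendsto.comp (g := fun n : ℕ => ENNReal.ofReal (∫ ω, D ω ∂P) / (n : ℝ≥0∞)) ?_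
    (tendsto_add_atTop_nat 1)
  simpa [div_eq_mul_inv] using ENNReal.Tendsto.const_mul ENNReal.tendsto_inv_nat_nhds_zero
    (Or.inr ENNReal.ofReal_ne_top)

/-- A version of a closed nonnegative martingale has one-sided limits along the rationals. -/
theorem ae_isReg_of_martingale (hf : ∀ q : ℚ≥0, Measurable[ℱ q] (f q))
    (hfD : ∀ q : ℚ≥0, (fun ω => (f q ω : ℝ)) =ᵐ[P] P[D | ℱ q]) :
    ∀ᵐ ω ∂P, IsReg fun q => f q ω := by
  have h1 : ∀ᵐ ω ∂P, ∀ (T : ℕ) (a b : ℚ≥0), a < b →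
      ¬ ∀ n, UpChain a b (fun q => f q ω) n T := by
    refine ae_all_iff.2 fun T => ae_all_iff.2 fun a => ae_all_iff.2 fun b => ?_
    by_cases hab : a < b
    · have := measure_upChain_eq_zero hf hfD (a := a) (b := b) (by positivity)
        (by exact_mod_cast hab) T
      filter_upwards [measure_eq_zero_iff_ae_notMem.1 this] with ω hω _ using hω
    · exact Eventually.of_forall fun ω h => absurd h hab
  filter_upwards [h1, ae_all_iff.2 fun T : ℕ => ae_bddAbove_of_martingale hf hfD T] with ω hω hω'
  have hdense : Dense (range ((↑) : ℚ≥0 → ℝ≥0)) := by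
    refine dense_of_exists_between fun a b hab => ?_
    obtain ⟨q, h1, h2⟩ := exists_nnrat_between hab
    exact ⟨q, ⟨q, rfl⟩, h1, h2⟩
  have hcast : ∀ (x : ℝ≥0) (a : ℚ≥0), (x : ℝ≥0) < a ↔ (x : ℝ) < a := fun x a => by
    rw [← NNReal.coe_lt_coe]; rfl
  have hcast' : ∀ (x : ℝ≥0) (a : ℚ≥0), (a : ℝ≥0) < x ↔ (a : ℝ) < x := fun x a => by
    rw [← NNReal.coe_lt_coe]; rfl
  intro t
  obtain ⟨T, hT⟩ := exists_nat_gt t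
  obtain ⟨n, hn⟩ := hω' T
  refine ⟨tendsto_of_no_upcrossings hdense ?_ ?_ (isBoundedUnder_of ⟨0, fun _ => zero_le⟩),
    ?_⟩
  · rintro _ ⟨a, rfl⟩ _ ⟨b, rfl⟩ hab ⟨ha, hb⟩
    refine hω T a b (by exact_mod_cast hab) fun n => upChain_of_frequently_right (t := t)
      (by simpa only [hcast] using ha) (by simpa only [hcast'] using hb) n T (by exact_mod_cast hT)
  · refine ⟨n, ?_⟩
    exact mem_rightFilter.2 ⟨T, hT, fun q _ h => hn q (by exact_mod_cast h.le)⟩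
  rcases eq_or_lt_of_le (zero_le (a := t)) with rfl | ht
  · rw [leftFilter_zero]
    exact ⟨0, tendsto_bot⟩
  refine tendsto_of_no_upcrossings hdense ?_ ?_ (isBoundedUnder_of ⟨0, fun _ => zero_le⟩)
  · rintro _ ⟨a, rfl⟩ _ ⟨b, rfl⟩ hab ⟨ha, hb⟩
    refine hω T a b (by exact_mod_cast hab) fun n => ?_
    obtain ⟨S, hS, h⟩ := upChain_of_frequently_left ht
      (by simpa only [hcast] using ha) (by simpa only [hcast'] using hb) n
    exact h.mono (by exact_mod_cast (hS.trans hT).le)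
  · refine ⟨n, ?_⟩
    exact (mem_leftFilter ht).2 ⟨0, ht, fun q _ h => hn q (by exact_mod_cast (h.trans hT).le)⟩

end Regularity

/-! ### Existence of density processes, jointly in a parameter -/

section DensityKernel

variable {X : Type*} [MeasurableSpace X] {d : ℕ} {F : Type*} [TopologicalSpace F] [PolishSpace F]
  [MeasurableSpace F] [BorelSpace F]

/-- The density of two kernels on the paths stopped at the time `q`. -/
def stoppedDensity (κ η : Kernel X (PathSpace (State d F))) (q : ℚ≥0)
    (p : X × PathSpace (State d F)) : ℝ≥0 :=
  (Kernel.rnDeriv (κ.map (stopPath q)) (η.map (stopPath q)) p.1 (stopPath q p.2)).toNNReal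

/-- A version of the density processes of two kernels that is jointly measurable. -/
def densityPath (κ η : Kernel X (PathSpace (State d F))) (p : X × PathSpace (State d F)) :
    PathSpace ℝ≥0 :=
  regularize fun q => stoppedDensity κ η q p

theorem measurable_stoppedDensity (κ η : Kernel X (PathSpace (State d F))) (q : ℚ≥0) :
    Measurable (stoppedDensity κ η q) :=
  ((Kernel.measurable_rnDeriv _ _).comp
    (measurable_fst.prodMk ((measurable_stopPath _).comp measurable_snd))).ennreal_toNNReal

theorem measurable_stoppedDensity_raw (κ η : Kernel X (PathSpace (State d F))) (q : ℚ≥0) (x : X) :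
    Measurable[rawFiltration (State d F) q] fun ω => stoppedDensity κ η q (x, ω) :=
  ((Kernel.measurable_rnDeriv_right _ _ x).comp (measurable_stopPath_raw _)).ennreal_toNNReal

theorem measurable_densityPath (κ η : Kernel X (PathSpace (State d F))) :
    Measurable (densityPath κ η) :=
  measurable_regularize.comp (measurable_pi_lambda _ fun q => measurable_stoppedDensity κ η q)

variable (κ η : Kernel X (PathSpace (State d F))) [IsMarkovKernel κ] [IsMarkovKernel η]

/-- The raw past at `q` is generated by the path stopped at `q`, so the density between the laws of
stopped paths is the conditional expectation of the density. -/
theorem stoppedDensity_ae_eq_condExp {x : X} (hx : κ x ≪ η x) (q : ℚ≥0) :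
    (fun ω => (stoppedDensity κ η q (x, ω) : ℝ)) =ᵐ[η x]
      (η x)[fun ω => ((κ x).rnDeriv (η x) ω).toReal | rawFiltration (State d F) q] := by
  have hm := measurable_stopPath (E := State d F) (q : ℝ≥0)
  have : IsMarkovKernel (κ.map (stopPath (q : ℝ≥0))) := Kernel.IsMarkovKernel.map _ hm
  have : IsMarkovKernel (η.map (stopPath (q : ℝ≥0))) := Kernel.IsMarkovKernel.map _ hm
  have : IsProbabilityMeasure ((η x).map (stopPath (q : ℝ≥0))) :=
    Measure.isProbabilityMeasure_map hm.aemeasurable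
  have h1 := Kernel.rnDeriv_eq_rnDeriv_measure (κ := κ.map (stopPath (q : ℝ≥0)))
    (η := η.map (stopPath (q : ℝ≥0))) (a := x)
  simp only [Kernel.map_apply _ hm] at h1
  have h2 := ae_of_ae_map hm.aemeasurable h1
  rw [rawFiltration_eq_comap]
  refine EventuallyEq.trans ?_ (toReal_rnDeriv_map hx hm)
  filter_upwards [h2] with ω hω
  rw [stoppedDensity, ENNReal.coe_toNNReal_eq_toReal]
  exact congrArg ENNReal.toReal hω

/-- The densities at rational times are a non-negative closed martingale, so their right limits
exist almost surely and, by uniform integrability, are conditional expectations given the hull. -/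
theorem isDensityProcess_densityPath {x : X} (hx : κ x ≪ η x) :
    IsDensityProcess (η x) (κ x) fun ω => densityPath κ η (x, ω) := by
  refine ⟨(measurable_densityPath κ η).comp measurable_prodMk_left, fun t => ?_⟩
  have hreg : ∀ᵐ ω ∂η x, IsReg fun q => stoppedDensity κ η q (x, ω) :=
    ae_isReg_of_martingale (ℱ := rawFiltration (State d F))
      (fun q => measurable_stoppedDensity_raw κ η q x) fun q => stoppedDensity_ae_eq_condExp κ η hx q
  choose q hq using fun k => exists_nnrat_eq_disc k t
  have hqt : Tendsto q atTop (rightFilter t) := by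
    intro s hs
    obtain ⟨u, hu, h⟩ := mem_rightFilter.1 hs
    change ∀ᶠ k in atTop, q k ∈ s
    filter_upwards [(tendsto_disc t).eventually (Ioo_mem_nhdsGT hu)] with k hk
    rw [← hq] at hk
    exact h _ hk.1 hk.2
  have hY : Integrable (fun ω => ((κ x).rnDeriv (η x) ω).toReal) (η x) :=
    Measure.integrable_toReal_rnDeriv
  have hlim : ∀ᵐ ω ∂η x, Tendsto (fun k => stoppedDensity κ η (q k) (x, ω)) atTop
      (𝓝 (coord t (densityPath κ η (x, ω)))) := by
    filter_upwards [hreg] with ω hω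
    exact (tendsto_regularize hω t).comp hqt
  obtain ⟨h1, h2⟩ := setIntegral_eq_of_tendsto_condExp hY
    (fun k => (rawFiltration (State d F)).le (q k))
    (fun k => stoppedDensity_ae_eq_condExp κ η hx (q k))
    (hlim.mono fun ω hω => (NNReal.continuous_coe.tendsto _).comp hω)
  refine ae_eq_condExp_of_forall_setIntegral_eq ((hullFiltration (State d F)).le t) hY
    (fun s _ _ => h1.integrableOn) (fun s hs _ => h2 s fun k => ?_) ?_
  · rw [hq]
    exact hull_le_raw (lt_disc k t) _ hs
  -- A limsup is insensitive to its first terms: for each `s > t` it can be formed from times below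
  -- `s` only, so it is known in the hull at `t`.
  · set l : PathSpace (State d F) → ℝ := fun ω =>
      (limsup (fun k => (stoppedDensity κ η (q k) (x, ω) : ℝ≥0∞)) atTop).toReal
    have hl : Measurable[hullFiltration (State d F) t] l := fun A hA => by
      refine measurableSet_hull_iff.2 fun s hs => ?_
      obtain ⟨K, hK⟩ := eventually_atTop.1 ((tendsto_disc t).eventually (Ioo_mem_nhdsGT hs))
      have hl' : l = fun ω =>
          (limsup (fun k => (stoppedDensity κ η (q (k + K)) (x, ω) : ℝ≥0∞)) atTop).toReal := by
        ext ω
        exact congrArg ENNReal.toReal (Filter.limsup_nat_add (fun k =>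
          (stoppedDensity κ η (q k) (x, ω) : ℝ≥0∞)) K).symm
      rw [hl']
      refine Measurable.ennreal_toReal (Measurable.limsup fun k => ?_) hA
      refine ((measurable_stoppedDensity_raw κ η (q (k + K)) x).mono
        ((rawFiltration (State d F)).mono ?_) le_rfl).coe_nnreal_ennreal
      rw [hq]
      exact (hK _ (Nat.le_add_left _ _)).2.le
    refine ⟨l, hl.stronglyMeasurable, ?_⟩
    filter_upwards [hlim] with ω hω
    have : Tendsto (fun k => (stoppedDensity κ η (q k) (x, ω) : ℝ≥0∞)) atTop
        (𝓝 ((coord t (densityPath κ η (x, ω)) : ℝ≥0) : ℝ≥0∞)) := ENNReal.tendsto_coe.2 hω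
    simp only [l, this.limsup_eq, ENNReal.coe_toReal]

end DensityKernel

end DPP

namespace DPP

/-! ### Concatenation of laws and shift-invariant functionals -/

section Concat

variable {E : Type*} [TopologicalSpace E] [PolishSpace E] [MeasurableSpace E] [BorelSpace E]

variable {τ : PathSpace E → WithTop ℝ≥0}

theorem ne_top_of_mem_boundedStoppingTimes (hτ : τ ∈ boundedStoppingTimes E) (ω : PathSpace E) :
    τ ω ≠ ⊤ := by
  obtain ⟨-, C, hC⟩ := hτ
  exact ((hC ω).trans_lt (WithTop.coe_lt_top C)).ne

theorem measurable_untopD (hτ : τ ∈ boundedStoppingTimes E) :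
    Measurable fun ω => (τ ω).untopD 0 := by
  refine measurable_of_Iic fun t => ?_
  have h : (fun ω => (τ ω).untopD 0) ⁻¹' Iic t = {ω | τ ω ≤ t} := by
    ext ω
    obtain ⟨r, hr⟩ := WithTop.ne_top_iff_exists.1 (ne_top_of_mem_boundedStoppingTimes hτ ω)
    rw [mem_preimage, mem_Iic, mem_ofPred_eq, ← hr, WithTop.untopD_coe, WithTop.coe_le_coe]
  rw [h]
  exact (hullFiltration E).le t _ (hτ.1 t)

theorem measurable_positionAt (hτ : τ ∈ boundedStoppingTimes E) : Measurable (positionAt τ) :=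
  measurable_coord_comp (measurable_untopD hτ) measurable_id

/-- Shifting by `τ` erases the first path from a concatenation, so only the law of the second path
enters. -/
theorem lintegral_concatLaw {μ : Measure (PathSpace E)} [IsProbabilityMeasure μ]
    (hτ : τ ∈ boundedStoppingTimes E) {ν : E → Measure (PathSpace E)}
    (hp : ∀ x, IsProbabilityMeasure (ν x))
    (hν : ∀ A, MeasurableSet A → UniversallyMeasurable fun x => ν x A)
    {f : PathSpace E → ℝ≥0∞} (hf : Measurable f) (hs : ∀ t ω, f (shift t ω) = f ω) :
    AEMeasurable (fun ω => ∫⁻ ω', f ω' ∂ν (positionAt τ ω)) μ ∧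
      ∫⁻ ω, f ω ∂(concatLaw μ τ ν) = ∫⁻ ω, ∫⁻ ω', f ω' ∂ν (positionAt τ ω) ∂μ := by
  have hpos := measurable_positionAt hτ
  have : IsProbabilityMeasure (μ.map (positionAt τ)) :=
    Measure.isProbabilityMeasure_map hpos.aemeasurable
  -- Only values of `ν` at the random position matter, so a genuine kernel agreeing with it under
  -- the law of that position may replace it.
  obtain ⟨κ, hκ, hκν⟩ := exists_kernel_ae_eq hp hν (μ.map (positionAt τ))
  replace hκν := ae_of_ae_map hpos.aemeasurable hκν
  let φ : PathSpace E × PathSpace E → PathSpace E := fun p => concatPath ((τ p.1).untopD 0) p.1 p.2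
  have hφ : Measurable φ := measurable_concatPath_comp ((measurable_untopD hτ).comp measurable_fst)
    measurable_fst measurable_snd
  let η : Kernel (PathSpace E) (PathSpace E) :=
    ((Kernel.id : Kernel (PathSpace E) (PathSpace E)) ×ₖ κ.comap _ hpos).map φ
  have hη : ∀ ω, η ω = (κ (positionAt τ ω)).map (concatPath ((τ ω).untopD 0) ω) := fun ω => by
    have h1 : Measurable (concatPath ((τ ω).untopD 0) ω) := hφ.comp measurable_prodMk_left
    rw [Kernel.map_apply _ hφ, Kernel.prod_apply, Kernel.id_apply, Kernel.comap_apply,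
      Measure.dirac_prod, Measure.map_map hφ measurable_prodMk_left]
    rfl
  have hbind : concatLaw μ τ ν = μ.bind η := by
    refine Measure.bind_congr_right ?_
    filter_upwards [hκν] with ω hω
    rw [if_neg (ne_top_of_mem_boundedStoppingTimes hτ ω), hη, hω]
  have hint : ∀ ω, ∫⁻ ω', f ω' ∂η ω = ∫⁻ ω', f ω' ∂κ (positionAt τ ω) := fun ω => by
    have h1 : Measurable (concatPath ((τ ω).untopD 0) ω) := hφ.comp measurable_prodMk_left
    rw [hη, lintegral_map hf h1]
    refine lintegral_congr fun ω' => ?_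
    rw [← hs ((τ ω).untopD 0), shift_concatPath]
  have hae : (fun ω => ∫⁻ ω', f ω' ∂κ (positionAt τ ω)) =ᵐ[μ]
      fun ω => ∫⁻ ω', f ω' ∂ν (positionAt τ ω) := hκν.mono fun ω hω => by
    change ∫⁻ ω', f ω' ∂κ (positionAt τ ω) = _
    rw [hω]
  refine ⟨((hf.lintegral_kernel (κ := κ)).comp hpos).aemeasurable.congr hae, ?_⟩
  rw [hbind, Measure.lintegral_bind η.measurable.aemeasurable hf.aemeasurable]
  simp only [hint]
  exact lintegral_congr_ae hae

/-- Concatenation of extended expectations of a shift-invariant functional. -/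
theorem expect_concatLaw {μ : Measure (PathSpace E)} [IsProbabilityMeasure μ]
    (hτ : τ ∈ boundedStoppingTimes E) {ν : E → Measure (PathSpace E)}
    (hp : ∀ x, IsProbabilityMeasure (ν x))
    (hν : ∀ A, MeasurableSet A → UniversallyMeasurable fun x => ν x A)
    {G : PathSpace E → EReal} (hG : Measurable G) (hs : ∀ t ω, G (shift t ω) = G ω)
    (hfin : ∫⁻ ω, ∫⁻ ω', (-G ω').toENNReal ∂ν (positionAt τ ω) ∂μ < ⊤) :
    NegPartIntegrable (concatLaw μ τ ν) G ∧ NegPartIntegrable μ (tailValue τ ν G) ∧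
      expect (concatLaw μ τ ν) G = expect μ (tailValue τ ν G) := by
  obtain ⟨h1, h2⟩ := lintegral_concatLaw (μ := μ) hτ hp hν hG.ereal_toENNReal fun t ω => by rw [hs]
  obtain ⟨h3, h4⟩ := lintegral_concatLaw (μ := μ) hτ hp hν (f := fun ω => (-G ω).toENNReal)
    (continuous_neg.measurable.comp hG).ereal_toENNReal fun t ω => by rw [hs]
  have htail : tailValue τ ν G = fun ω => ((∫⁻ ω', (G ω').toENNReal ∂ν (positionAt τ ω) : ℝ≥0∞) : EReal) -
      ((∫⁻ ω', (-G ω').toENNReal ∂ν (positionAt τ ω) : ℝ≥0∞) : EReal) := funext fun ω => by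
    rw [tailValue, if_neg (ne_top_of_mem_boundedStoppingTimes hτ ω), expect]
  obtain ⟨h5, h6⟩ := expect_sub h1 h3 hfin
  rw [htail]
  refine ⟨?_, h5, ?_⟩
  · rw [NegPartIntegrable, h4]; exact hfin
  · rw [h6, expect, h2, h4]

end Concat

/-! ### Laws of augmented paths -/

section AugmentedLaw

variable {d : ℕ} {F : Type*} [TopologicalSpace F] [PolishSpace F] [MeasurableSpace F] [BorelSpace F]
  {P : Kernel (State d F) (PathSpace (State d F))} [IsMarkovKernel P]
  {G : PathSpace (State d F × ℝ≥0) → EReal}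

theorem IsDensityProcess.measurable_augment {Px Q : Measure (PathSpace (State d F))}
    {Z : PathSpace (State d F) → PathSpace ℝ≥0} (hZ : IsDensityProcess Px Q Z) (z : ℝ≥0) :
    Measurable fun ω => augment z ω (Z ω) :=
  measurable_augment_comp measurable_const measurable_id hZ.measurable

/-- Expectations under the laws of augmented paths only depend on the density. -/
theorem IsDensityProcess.lintegral_augment (hP : IsStrongMarkovFamily P) (hT : FiniteHorizon P)
    {x : State d F} {Q : Measure (PathSpace (State d F))} [IsFiniteMeasure Q]
    {Z : PathSpace (State d F) → PathSpace ℝ≥0} (hZ : IsDensityProcess (P x) Q Z)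
    (hG : Measurable G) (hs : ∀ t ω, G (shift t ω) = G ω) (z : ℝ≥0) {φ : EReal → ℝ≥0∞}
    (hφ : Measurable φ) :
    ∫⁻ ω, φ (G ω) ∂((P x).map fun ω => augment z ω (Z ω)) =
      ∫⁻ ω, φ (terminal G ω (z * (Q.rnDeriv (P x) ω).toNNReal)) ∂(P x) := by
  rw [lintegral_map (f := fun ω => φ (G ω)) (hφ.comp hG) (hZ.measurable_augment z)]
  refine lintegral_congr_ae ?_
  filter_upwards [hZ.eq_rnDeriv hP hT] with ω hω
  rw [terminal_of_eventually hs hω]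

theorem exists_isDensityProcess {Px Q : Measure (PathSpace (State d F))} [IsProbabilityMeasure Px]
    [IsProbabilityMeasure Q] (h : Q ≪ Px) : ∃ Z, IsDensityProcess Px Q Z :=
  ⟨_, isDensityProcess_densityPath (Kernel.const Unit Q) (Kernel.const Unit Px) (x := ())
    (by simpa using h)⟩

theorem isProbabilityMeasure_of_mem_augmentedFamily {y : State d F × ℝ≥0}
    {μ : Measure (PathSpace (State d F × ℝ≥0))} (h : μ ∈ augmentedFamily P y) :
    IsProbabilityMeasure μ := by
  obtain ⟨Q, -, Z, hZ, rfl⟩ := h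
  exact Measure.isProbabilityMeasure_map (hZ.measurable_augment _).aemeasurable

/-- The first component of an augmented path. -/
def fstPath {E E' : Type*} [TopologicalSpace E] [TopologicalSpace E'] (ω : PathSpace (E × E')) :
    PathSpace E :=
  ⟨fun t => (ω.1 t).1, fun t => by
    obtain ⟨h, l, hl⟩ := ω.2 t
    exact ⟨h.fst, l.1, (continuous_fst.tendsto _).comp hl⟩⟩

theorem measurable_fstPath :
    Measurable (fstPath : PathSpace (State d F × ℝ≥0) → PathSpace (State d F)) :=
  measurable_pathSpace.2 fun t => (measurable_coord t).fst

/-- The weight of an augmented path at the horizon, relative to its initial weight. -/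
def relativeWeight (y : State d F × ℝ≥0) (ω : PathSpace (State d F × ℝ≥0)) : ℝ≥0∞ :=
  (coord y.1.1 ω).2 / y.2

theorem measurable_relativeWeight :
    Measurable (Function.uncurry (relativeWeight (d := d) (F := F))) := by
  have h : Measurable fun p : (State d F × ℝ≥0) × PathSpace (State d F × ℝ≥0) =>
      coord p.1.1.1 p.2 := measurable_coord_comp measurable_fst.fst.fst measurable_snd
  exact h.snd.coe_nnreal_ennreal.div measurable_fst.snd.coe_nnreal_ennreal

/-- The martingale measure is recovered from the law of the augmented path. -/
theorem IsDensityProcess.map_fstPath (hP : IsStrongMarkovFamily P) (hT : FiniteHorizon P)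
    {y : State d F × ℝ≥0} (hy : y.2 ≠ 0) {Q : Measure (PathSpace (State d F))}
    [IsProbabilityMeasure Q] (hQ : Q ≪ P y.1) {Z : PathSpace (State d F) → PathSpace ℝ≥0}
    (hZ : IsDensityProcess (P y.1) Q Z) :
    (((P y.1).map fun ω => augment y.2 ω (Z ω)).withDensity (relativeWeight y)).map fstPath = Q := by
  ext A hA
  have hw : Measurable (relativeWeight (d := d) (F := F) y) :=
    measurable_relativeWeight.comp measurable_prodMk_left
  rw [Measure.map_apply measurable_fstPath hA, withDensity_apply _ (measurable_fstPath hA),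
    setLIntegral_map (measurable_fstPath hA) hw (hZ.measurable_augment _)]
  change ∫⁻ ω in A, _ ∂(P y.1) = _
  rw [← Measure.setLIntegral_rnDeriv hQ]
  refine lintegral_congr_ae (ae_restrict_of_ae ?_)
  filter_upwards [hZ.eq_rnDeriv hP hT, Q.rnDeriv_lt_top (P y.1)] with ω hω hω'
  rw [relativeWeight, coord_augment, hω _ le_rfl]
  push_cast
  rw [mul_comm, ENNReal.mul_div_cancel_right (by simpa using hy) ENNReal.coe_ne_top,
    ENNReal.coe_toNNReal hω'.ne]

/-- A selector of the augmented family agrees almost everywhere with a kernel of martingale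
measures. -/
theorem exists_kernel_of_selector (hP : IsStrongMarkovFamily P) (hT : FiniteHorizon P)
    (hG : Measurable G) (hs : ∀ t ω, G (shift t ω) = G ω)
    {ν : State d F × ℝ≥0 → Measure (PathSpace (State d F × ℝ≥0))}
    (hν : ν ∈ Selectors (augmentedFamily P)) (m : Measure (State d F × ℝ≥0))
    [IsProbabilityMeasure m] :
    ∃ Q : Kernel (State d F × ℝ≥0) (PathSpace (State d F)), IsMarkovKernel Q ∧
      ∀ᵐ y ∂m, y.2 ≠ 0 → Q y ∈ martingaleMeasures P y.1 ∧ ∀ φ : EReal → ℝ≥0∞, Measurable φ →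
        ∫⁻ ω, φ (G ω) ∂ν y =
          ∫⁻ ω, φ (terminal G ω (y.2 * ((Q y).rnDeriv (P y.1) ω).toNNReal)) ∂(P y.1) := by
  classical
  obtain ⟨κ, hκ, hκν⟩ := exists_kernel_ae_eq
    (fun y => isProbabilityMeasure_of_mem_augmentedFamily (hν.1 y)) hν.2 m
  -- Reweighting by the terminal weight over `y.2` and projecting recovers the martingale measure
  -- measurably in `y`; this breaks down at zero weight.
  let Q₀ : Kernel (State d F × ℝ≥0) (PathSpace (State d F)) :=
    (κ.withDensity relativeWeight).map fstPath
  have hB : MeasurableSet {y | Q₀ y univ = 1} :=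
    (Q₀.measurable_coe MeasurableSet.univ) (measurableSet_singleton 1)
  -- `Q₀ y` is known to be a probability only almost everywhere with non-zero weight; `P` is a
  -- harmless substitute elsewhere.
  refine ⟨Kernel.piecewise hB Q₀ (P.comap _ measurable_fst), ⟨fun y => ?_⟩, ?_⟩
  · rw [Kernel.piecewise_apply]
    split_ifs with h
    · exact ⟨h⟩
    · infer_instance
  · filter_upwards [hκν] with y hy hy0
    obtain ⟨Q, hQ, Z, hZ, hZν⟩ := hν.1 y
    have := hQ.1
    have h0 : Q₀ y = Q := by
      rw [Kernel.map_apply _ measurable_fstPath,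
        Kernel.withDensity_apply _ measurable_relativeWeight, hy, hZν,
        hZ.map_fstPath hP hT hy0 hQ.2.1]
    have h1 : Kernel.piecewise hB Q₀ (P.comap _ measurable_fst) y = Q := by
      rw [Kernel.piecewise_apply, if_pos (show y ∈ {y | Q₀ y univ = 1} by
        rw [mem_ofPred_eq, h0, measure_univ]), h0]
    rw [h1, hZν]
    exact ⟨hQ, fun φ hφ => hZ.lintegral_augment hP hT hG hs y.2 hφ⟩

end AugmentedLaw

/-! ### Densities of pasted measures -/

section PasteDensity

variable {d : ℕ} {F : Type*} [TopologicalSpace F] [PolishSpace F] [MeasurableSpace F] [BorelSpace F]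
  {P : Kernel (State d F) (PathSpace (State d F))} [IsMarkovKernel P] {x : State d F}
  {τ W : PathSpace (State d F) → ℝ≥0}
  {hτ : IsStoppingTime (hullFiltration (State d F)) fun ω => (τ ω : WithTop ℝ≥0)}
  {Q : Measure (PathSpace (State d F))} [IsProbabilityMeasure Q]

/-- The density of the future, jointly in the past. -/
def futureDensity (P : Kernel (State d F) (PathSpace (State d F)))
    (Q' : Kernel (Past d F) (PathSpace (State d F))) (p : Past d F × PathSpace (State d F)) : ℝ≥0∞ :=
  Kernel.rnDeriv Q' (P.comap _ measurable_pos) p.1 p.2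

theorem measurable_futureDensity (Q' : Kernel (Past d F) (PathSpace (State d F))) :
    Measurable (futureDensity P Q') := Kernel.measurable_rnDeriv _ _

/-- Densities multiply under pasting: the weight at `τ` times the density of the future. -/
theorem withDensity_paste (hP : IsStrongMarkovFamily P) (hC : ∃ C : ℝ≥0, ∀ ω, τ ω ≤ C)
    (hW : Measurable[hτ.measurableSpace] W)
    (hWQ : ∀ A, MeasurableSet[hτ.measurableSpace] A → ∫⁻ ω in A, W ω ∂(P x) = Q A)
    {Q' : Kernel (Past d F) (PathSpace (State d F))} [IsMarkovKernel Q']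
    (hQ' : ∀ᵐ u ∂((P x).map (pastOf τ W)), Q' u ≪ P u.pos)
    {Qb : Measure (PathSpace (State d F))}
    (h : Qb.map (fun ω => (pastOf τ W ω, shift (τ ω) ω)) = (Q.map (pastOf τ W)) ⊗ₘ Q') :
    (P x).withDensity (fun ω => W ω * futureDensity P Q' (pastOf τ W ω, shift (τ ω) ω)) = Qb := by
  have hU := measurable_pastOf hτ hW
  have hUm := measurable_of_stoppingTime hτ hU
  have hθ : Measurable fun ω : PathSpace (State d F) => shift (τ ω) ω :=
    measurable_shift_comp (measurable_of_stoppingTime hτ (measurable_stoppingTime_nnreal hτ))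
      measurable_id
  have hUθ := hUm.prodMk hθ
  have : IsProbabilityMeasure ((P x).map (pastOf τ W)) :=
    Measure.isProbabilityMeasure_map hUm.aemeasurable
  have : IsProbabilityMeasure (Q.map (pastOf τ W)) :=
    Measure.isProbabilityMeasure_map hUm.aemeasurable
  have hmap := map_prodMk_shift hP x hτ hC hU measurable_pos (pos_pastOf τ W)
  have hD := measurable_futureDensity (P := P) Q'
  ext A hA
  have hA' := measurable_paste hA
  have hg : Measurable fun p : Past d F × PathSpace (State d F) =>
      (p.1.2.2 : ℝ≥0∞) * (Past.paste ⁻¹' A).indicator (futureDensity P Q') p :=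
    measurable_fst.snd.snd.coe_nnreal_ennreal.mul (hD.indicator hA')
  have hQbA : Qb A = (Q.map (pastOf τ W) ⊗ₘ Q') (Past.paste ⁻¹' A) := by
    rw [← h, Measure.map_apply hUθ hA']
    congr 1
    ext ω
    simp only [mem_preimage, paste_pastOf]
  have h1 : (P x).withDensity
      (fun ω => W ω * futureDensity P Q' (pastOf τ W ω, shift (τ ω) ω)) A =
      ∫⁻ ω, (fun p : Past d F × PathSpace (State d F) => (p.1.2.2 : ℝ≥0∞) *
        (Past.paste ⁻¹' A).indicator (futureDensity P Q') p) (pastOf τ W ω, shift (τ ω) ω) ∂(P x) := by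
    rw [withDensity_apply _ hA, ← lintegral_indicator hA]
    refine lintegral_congr fun ω => ?_
    have hmem : (pastOf τ W ω, shift (τ ω) ω) ∈ Past.paste ⁻¹' A ↔ ω ∈ A := by
      rw [mem_preimage, paste_pastOf]
    beta_reduce
    by_cases hω : ω ∈ A
    · rw [indicator_of_mem hω, indicator_of_mem (hmem.2 hω)]
      rfl
    · rw [indicator_of_notMem hω, indicator_of_notMem (mt hmem.1 hω), mul_zero]
  rw [h1, ← lintegral_map hg hUθ, hmap, Measure.lintegral_compProd hg, hQbA,
    Measure.compProd_apply hA', ← map_withDensity_pastOf hW hWQ,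
    lintegral_withDensity_eq_lintegral_mul _ (by fun_prop)
      (Kernel.measurable_kernel_prodMk_left hA')]
  refine lintegral_congr_ae ?_
  filter_upwards [hQ'] with u hu
  have hr : futureDensity P Q' = fun p => futureDensity P Q' (p.1, p.2) := rfl
  have hmu : Measurable fun ω' => (Past.paste ⁻¹' A).indicator (futureDensity P Q') (u, ω') :=
    (hD.indicator hA').comp measurable_prodMk_left
  rw [Pi.mul_apply, lintegral_const_mul (f := fun ω' =>
    (Past.paste ⁻¹' A).indicator (futureDensity P Q') (u, ω')) _ hmu]
  congr 1
  have h2 : ∀ ω', (Past.paste ⁻¹' A).indicator (futureDensity P Q') (u, ω') =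
      (Prod.mk u ⁻¹' (Past.paste ⁻¹' A)).indicator (fun ω' => futureDensity P Q' (u, ω')) ω' :=
    fun ω' => rfl
  simp only [h2]
  rw [lintegral_indicator (measurable_prodMk_left hA'), Kernel.comap_apply,
    ← Measure.setLIntegral_rnDeriv hu]
  refine lintegral_congr_ae (ae_restrict_of_ae ?_)
  exact Kernel.rnDeriv_eq_rnDeriv_measure (κ := Q') (η := P.comap _ measurable_pos) (a := u)

/-- Expectations of functionals of the shifted path and the density of a pasted measure. -/
theorem lintegral_paste_density (hP : IsStrongMarkovFamily P) (hC : ∃ C : ℝ≥0, ∀ ω, τ ω ≤ C)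
    (hW : Measurable[hτ.measurableSpace] W)
    (hWQ : ∀ A, MeasurableSet[hτ.measurableSpace] A → ∫⁻ ω in A, W ω ∂(P x) = Q A)
    {Q' : Kernel (Past d F) (PathSpace (State d F))} [IsMarkovKernel Q']
    (hQ' : ∀ᵐ u ∂((P x).map (pastOf τ W)), Q' u ≪ P u.pos)
    {Qb : Measure (PathSpace (State d F))}
    (h : Qb.map (fun ω => (pastOf τ W ω, shift (τ ω) ω)) = (Q.map (pastOf τ W)) ⊗ₘ Q')
    {ψ : PathSpace (State d F) × ℝ≥0 → ℝ≥0∞} (hψ : Measurable ψ)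
    (hs : ∀ t ω w, ψ (shift t ω, w) = ψ (ω, w)) :
    ∫⁻ ω, ψ (ω, (Qb.rnDeriv (P x) ω).toNNReal) ∂(P x) =
      ∫⁻ ω, ∫⁻ ω', ψ (ω', W ω * ((Q' (pastOf τ W ω)).rnDeriv (P (coord (τ ω) ω)) ω').toNNReal)
        ∂P (coord (τ ω) ω) ∂(P x) := by
  have hU := measurable_pastOf hτ hW
  have hUm := measurable_of_stoppingTime hτ hU
  have hWm := measurable_of_stoppingTime hτ hW
  have hθ : Measurable fun ω : PathSpace (State d F) => shift (τ ω) ω :=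
    measurable_shift_comp (measurable_of_stoppingTime hτ (measurable_stoppingTime_nnreal hτ))
      measurable_id
  have hD := measurable_futureDensity (P := P) Q'
  have hDU : Measurable fun ω => (W ω : ℝ≥0∞) * futureDensity P Q' (pastOf τ W ω, shift (τ ω) ω) :=
    hWm.coe_nnreal_ennreal.mul (hD.comp (hUm.prodMk hθ))
  let f : Past d F × PathSpace (State d F) → ℝ≥0∞ := fun p =>
    ψ (p.2, p.1.2.2 * (futureDensity P Q' p).toNNReal)
  have hf : Measurable f :=
    hψ.comp (measurable_snd.prodMk (measurable_fst.snd.snd.mul hD.ennreal_toNNReal))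
  have h1 : ∫⁻ ω, ψ (ω, (Qb.rnDeriv (P x) ω).toNNReal) ∂(P x) =
      ∫⁻ ω, f (pastOf τ W ω, shift (τ ω) ω) ∂(P x) := by
    refine lintegral_congr_ae ?_
    have h2 := Measure.rnDeriv_withDensity (P x) hDU
    rw [withDensity_paste hP hC hW hWQ hQ' h] at h2
    filter_upwards [h2] with ω hω
    simp only [f]
    rw [hω, hs, ENNReal.toNNReal_mul, ENNReal.toNNReal_coe]
    rfl
  rw [h1, lintegral_shift hP x hτ hC hU measurable_pos (pos_pastOf τ W) hf]
  refine lintegral_congr fun ω => ?_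
  have h3 := Kernel.rnDeriv_eq_rnDeriv_measure (κ := Q') (η := P.comap _ measurable_pos)
    (a := pastOf τ W ω)
  rw [Kernel.comap_apply, pos_pastOf] at h3
  refine lintegral_congr_ae ?_
  filter_upwards [h3] with ω' hω'
  simp only [f, futureDensity]
  rw [hω']
  rfl

end PasteDensity

end DPP

namespace DPP

/-! ### The tail property -/

section Tail

variable {d : ℕ} {F : Type*} [TopologicalSpace F] [PolishSpace F] [MeasurableSpace F] [BorelSpace F]
  {P : Kernel (State d F) (PathSpace (State d F))} [IsMarkovKernel P]
  {G : PathSpace (State d F × ℝ≥0) → EReal}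

/-- The state of the augmented process at the end of the past. -/
def augmentedPos (z : ℝ≥0) (u : Past d F) : State d F × ℝ≥0 := (u.pos, z * u.2.2)

theorem measurable_augmentedPos (z : ℝ≥0) : Measurable (augmentedPos (d := d) (F := F) z) :=
  measurable_pos.prodMk (measurable_snd.snd.const_mul z)

theorem augmentedPos_pastOf (z : ℝ≥0) (τ W : PathSpace (State d F) → ℝ≥0)
    (ω : PathSpace (State d F)) : augmentedPos z (pastOf τ W ω) = (coord (τ ω) ω, z * W ω) := by
  rw [augmentedPos, pos_pastOf]; rfl

/-- The iterated integral is an integral of `φ ∘ G` under a member of the augmented family, obtained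
by pasting, where finiteness is assumed. -/
theorem lintegral_selector_lt_top (hP : IsStrongMarkovFamily P) (hT : FiniteHorizon P) {a : ℕ → ℝ}
    (ha : LowerBounds P a) (hG : Measurable G) (hs : ∀ t ω, G (shift t ω) = G ω)
    {φ : EReal → ℝ≥0∞} (hφ : Measurable φ)
    (hfin : ∀ y, ∀ μ ∈ augmentedFamily P y, ∫⁻ ω, φ (G ω) ∂μ < ⊤) {y : State d F × ℝ≥0}
    {μ : Measure (PathSpace (State d F × ℝ≥0))} (hμ : μ ∈ augmentedFamily P y)
    {ν : State d F × ℝ≥0 → Measure (PathSpace (State d F × ℝ≥0))}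
    (hν : ν ∈ Selectors (augmentedFamily P)) {τ : PathSpace (State d F × ℝ≥0) → WithTop ℝ≥0}
    (hτ : τ ∈ boundedStoppingTimes (State d F × ℝ≥0)) :
    ∫⁻ ω, ∫⁻ ω', φ (G ω') ∂ν (positionAt τ ω) ∂μ < ⊤ := by
  have hμp := isProbabilityMeasure_of_mem_augmentedFamily hμ
  have hae := (lintegral_concatLaw (μ := μ) hτ
    (fun y => isProbabilityMeasure_of_mem_augmentedFamily (hν.1 y)) hν.2
    (f := fun ω => φ (G ω)) (hφ.comp hG) fun t ω => by rw [hs]).1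
  have hμfin := hfin y μ hμ
  obtain ⟨Q, hQ, Z, hZ, rfl⟩ := hμ
  have := hQ.1
  obtain ⟨x, z⟩ := y
  simp only at hQ hZ hae hμfin hfin ⊢
  obtain ⟨τ', hτ', hC, W, hW, hWQ, hpos⟩ := hZ.exists_stoppingTime hQ.2.1 z hτ
  have hU := measurable_pastOf hτ' hW
  have hUm := measurable_of_stoppingTime hτ' hU
  rw [lintegral_map' (f := fun ω => ∫⁻ ω', φ (G ω') ∂ν (positionAt τ ω)) hae
    (hZ.measurable_augment z).aemeasurable]
  rw [lintegral_congr_ae (g := fun ω => ∫⁻ ω', φ (G ω') ∂ν (coord (τ' ω) ω, z * W ω))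
    (hpos.mono fun ω hω => by simp only [hω.2])]
  -- With zero initial weight all weights vanish and the selector's choice of martingale measure is
  -- invisible to `G`; the Markov property alone identifies the integral.
  rcases eq_or_ne z 0 with rfl | hz
  · have h0 : ∀ x', ∫⁻ ω', φ (G ω') ∂ν (x', 0) = ∫⁻ ω', φ (terminal G ω' 0) ∂P x' := fun x' => by
      obtain ⟨Q', hQ', Z', hZ', h⟩ := hν.1 (x', 0)
      have := hQ'.1
      rw [h, hZ'.lintegral_augment hP hT hG hs _ hφ]
      simp only [zero_mul]
    simp only [zero_mul, h0]
    rw [hZ.lintegral_augment hP hT hG hs _ hφ] at hμfin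
    simp only [zero_mul] at hμfin
    have hf : Measurable fun p : Past d F × PathSpace (State d F) => φ (terminal G p.2 0) :=
      hφ.comp ((measurable_terminal hG).comp (measurable_snd.prodMk measurable_const))
    have := lintegral_shift hP x hτ' hC hU measurable_pos (pos_pastOf τ' W) hf
    simp only [terminal_shift hs] at this
    exact this ▸ hμfin
  · have : IsProbabilityMeasure (((P x).map (pastOf τ' W)).map (augmentedPos z)) := by
      have : IsProbabilityMeasure ((P x).map (pastOf τ' W)) :=
        Measure.isProbabilityMeasure_map hUm.aemeasurable
      exact Measure.isProbabilityMeasure_map (measurable_augmentedPos z).aemeasurable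
    obtain ⟨Q', hQ', hQ'ν⟩ := exists_kernel_of_selector hP hT hG hs hν
      (((P x).map (pastOf τ' W)).map (augmentedPos z))
    replace hQ'ν := ae_of_ae_map (measurable_augmentedPos z).aemeasurable hQ'ν
    have hD := Measure.measurable_rnDeriv Q (P x)
    have hQD := Measure.withDensity_rnDeriv_eq Q (P x) hQ.2.1
    -- Only the positivity of the weight at `τ` is taken from here; it places the random state where
    -- the selector determines a martingale measure.
    have hW0 := ae_futureLaw_mem hP ha hC hW hD (by rwa [hQD]) fun A hA => by rw [hQD]; exact hWQ A hA
    have hgood : ∀ᵐ u ∂((P x).map (pastOf τ' W)),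
        (Q'.comap _ (measurable_augmentedPos z)) u ∈ martingaleMeasures P u.pos := by
      filter_upwards [hQ'ν, hW0] with u hu hu0
      exact (hu (mul_ne_zero hz hu0.1)).1
    obtain ⟨Qb, hQb, hmap⟩ := exists_paste_mem hP ha hC hW hQ
      (Q'.comap _ (measurable_augmentedPos z)) hgood
    have := hQb.1
    obtain ⟨Zb, hZb⟩ := exists_isDensityProcess hQb.2.1
    have h1 := hfin (x, z) _ ⟨Qb, hQb, Zb, hZb, rfl⟩
    rw [hZb.lintegral_augment hP hT hG hs _ hφ,
      lintegral_paste_density (ψ := fun p => φ (terminal G p.1 (z * p.2))) hP hC hW hWQ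
        (hgood.mono fun u hu => hu.2.1) hmap
        (hφ.comp ((measurable_terminal hG).comp (measurable_fst.prodMk (measurable_snd.const_mul z))))
        fun t ω w => by simp only [terminal_shift hs]] at h1
    refine lt_of_eq_of_lt (lintegral_congr_ae ?_) h1
    filter_upwards [ae_of_ae_map hUm.aemeasurable hQ'ν, ae_of_ae_map hUm.aemeasurable hW0]
      with ω hω hω0
    have h2 := (hω (mul_ne_zero hz hω0.1)).2 φ hφ
    rw [augmentedPos_pastOf] at h2
    rw [h2]
    refine lintegral_congr fun ω' => ?_
    rw [Kernel.comap_apply, augmentedPos_pastOf, mul_assoc]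

end Tail

/-! ### The set of laws of martingale measures -/

section MeasurableFamily

variable {d : ℕ} {F : Type*} [TopologicalSpace F] [PolishSpace F] [MeasurableSpace F] [BorelSpace F]
  {P : Kernel (State d F) (PathSpace (State d F))} [IsMarkovKernel P] {X : Type*}
  [MeasurableSpace X]

/-- Absolute continuity of kernels is a Borel condition, and the local martingale property reduces
to countably many equations between measurable integrals, for all large radii. -/
theorem measurableSet_martingaleMeasures (hP : IsStrongMarkovFamily P) {a : ℕ → ℝ}
    (ha : LowerBounds P a) (κ : Kernel X (PathSpace (State d F))) [IsMarkovKernel κ]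
    {g : X → State d F} (hg : Measurable g) :
    MeasurableSet {p | κ p ∈ martingaleMeasures P (g p)} := by
  obtain ⟨b, hπ, hgen, huniv⟩ := exists_piSystem_nat (PathSpace (State d F))
  have hb : ∀ k, MeasurableSet (b k) := fun k => by
    rw [hgen]; exact MeasurableSpace.measurableSet_generateFrom ⟨k, rfl⟩
  have h : {p | κ p ∈ martingaleMeasures P (g p)} =
      {p | κ p ≪ P.comap g hg p} ∩ {p | P.comap g hg p ≪ κ p} ∩
        ⋃ N : ℕ, ⋂ n : ℕ, ⋂ (_ : N ≤ n), ⋂ (i : Fin d), ⋂ (s : ℚ≥0), ⋂ (t : ℚ≥0), ⋂ (_ : s ≤ t),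
          ⋂ k : ℕ, {p | ∫⁻ ω in stopPath (s : ℝ≥0) ⁻¹' b k, slack (a n) n i t ω ∂κ p =
            ∫⁻ ω in stopPath (s : ℝ≥0) ⁻¹' b k, slack (a n) n i s ω ∂κ p} := by
    ext p
    simp only [mem_inter_iff, mem_iUnion, mem_iInter, mem_ofPred_eq, Kernel.comap_apply]
    constructor
    · intro hp
      refine ⟨⟨hp.2.1, hp.2.2.1⟩, ?_⟩
      obtain ⟨N, hN⟩ := eventually_atTop.1
        (tendsto_natCast_atTop_atTop.eventually_gt_atTop ‖(g p).2.1‖)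
      refine ⟨N, fun n hn i s t hst k => ?_⟩
      exact slackMartingale_of_mem hP ha hp (hN n hn) i s t (by exact_mod_cast hst) _
        (measurable_stopPath_raw _ (hb k))
    · rintro ⟨⟨h1, h2⟩, N, hN⟩
      refine ⟨inferInstance, h1, h2, isLocalMartingalePrice_of_eventually hP ha h1 ?_⟩
      filter_upwards [eventually_ge_atTop N,
        tendsto_natCast_atTop_atTop.eventually_gt_atTop ‖(g p).2.1‖] with n hn hn'
      exact slackMartingale_of_rat hπ hgen huniv (h1.ae_le (ha n _ hn'))
        (integrable_stoppedPrice_zero hP h1 n) (hN n hn)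
  have hm : ∀ (n : ℕ) (i : Fin d) (s t : ℚ≥0) (k : ℕ), Measurable fun p =>
      ∫⁻ ω in stopPath (s : ℝ≥0) ⁻¹' b k, slack (a n) n i t ω ∂κ p := fun n i s t k =>
    (measurable_slack (a n) n i t).setLIntegral_kernel (measurable_stopPath _ (hb k))
  rw [h]
  refine ((Kernel.measurableSet_absolutelyContinuous _ _).inter
    (Kernel.measurableSet_absolutelyContinuous _ _)).inter ?_
  refine MeasurableSet.iUnion fun N => MeasurableSet.iInter fun n => MeasurableSet.iInter fun _ =>
    MeasurableSet.iInter fun i => MeasurableSet.iInter fun s => MeasurableSet.iInter fun t =>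
    MeasurableSet.iInter fun _ => MeasurableSet.iInter fun k => ?_
  exact measurableSet_eq_fun (hm n i s t k) (hm n i s s k)

/-- The laws of augmented paths, jointly in the state and in the martingale measure. -/
def augmentedKernel (P : Kernel (State d F) (PathSpace (State d F)))
    (κ : Kernel X (PathSpace (State d F))) :
    Kernel ((State d F × ℝ≥0) × X) (PathSpace (State d F × ℝ≥0)) :=
  ((Kernel.id : Kernel ((State d F × ℝ≥0) × X) ((State d F × ℝ≥0) × X)) ×ₖ
    P.comap _ measurable_fst.fst).map fun p =>
      augment p.1.1.2 p.2 (densityPath (κ.comap _ measurable_snd) (P.comap _ measurable_fst.fst) p)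

theorem augmentedKernel_apply (κ : Kernel X (PathSpace (State d F)))
    (p : (State d F × ℝ≥0) × X) : augmentedKernel P κ p = (P p.1.1).map fun ω =>
      augment p.1.2 ω (densityPath (κ.comap _ measurable_snd)
        (P.comap _ measurable_fst.fst) (p, ω)) := by
  have hm : Measurable fun p : ((State d F × ℝ≥0) × X) × PathSpace (State d F) =>
      augment p.1.1.2 p.2 (densityPath (κ.comap _ measurable_snd)
        (P.comap _ measurable_fst.fst) p) :=
    measurable_augment_comp measurable_fst.fst.snd measurable_snd (measurable_densityPath _ _)
  rw [augmentedKernel, Kernel.map_apply _ hm, Kernel.prod_apply, Kernel.id_apply,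
    Kernel.comap_apply, Measure.dirac_prod, Measure.map_map hm measurable_prodMk_left]
  rfl

theorem isDensityProcess_augmentedKernel (κ : Kernel X (PathSpace (State d F))) [IsMarkovKernel κ]
    {p : (State d F × ℝ≥0) × X} (h : κ p.2 ≪ P p.1.1) :
    IsDensityProcess (P p.1.1) (κ p.2) fun ω => densityPath (κ.comap _ measurable_snd)
        (P.comap _ measurable_fst.fst) (p, ω) :=
  isDensityProcess_densityPath (κ.comap _ measurable_snd) (P.comap _ measurable_fst.fst) (x := p) h

end MeasurableFamily

end DPP

namespace DPP

/-! ### Disintegration along the augmented state -/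

/-- In almost every fibre there is a point at which a function is at most its fibre average. -/
theorem exists_fiber_le {X Y : Type*} [MeasurableSpace X] [StandardBorelSpace X] [Nonempty X]
    [TopologicalSpace Y] [PolishSpace Y] [MeasurableSpace Y] [BorelSpace Y] (m : Measure X)
    [IsProbabilityMeasure m] {π : X → Y} (hπ : Measurable π) {a b : X → ℝ≥0∞} (ha : Measurable a)
    (hb : Measurable b) (hfin : ∫⁻ u, b u ∂m < ⊤) {p : X → Prop} (hp : ∀ᵐ u ∂m, p u) :
    ∃ A B : Y → ℝ≥0∞, Measurable A ∧ Measurable B ∧ ∫⁻ u, A (π u) ∂m = ∫⁻ u, a u ∂m ∧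
      ∫⁻ u, B (π u) ∂m = ∫⁻ u, b u ∂m ∧
      ∀ᵐ y ∂(m.map π), ∃ u, p u ∧ π u = y ∧ a u + B y ≤ A y + b u := by
  have hm : Measurable fun u => (π u, u) := hπ.prodMk measurable_id
  set ρ := m.map fun u => (π u, u)
  have : IsProbabilityMeasure ρ := Measure.isProbabilityMeasure_map hm.aemeasurable
  have hfst : ρ.fst = m.map π := Measure.fst_map_prodMk measurable_id
  have hsnd : ρ.map Prod.snd = m := by
    rw [Measure.map_map measurable_snd hm]; exact Measure.map_id
  have hK := ρ.disintegrate ρ.condKernel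
  have hint : ∀ {f : X → ℝ≥0∞}, Measurable f →
      ∫⁻ u, ∫⁻ v, f v ∂ρ.condKernel (π u) ∂m = ∫⁻ u, f u ∂m := fun {f} hf => by
    rw [← lintegral_map (f := fun y => ∫⁻ v, f v ∂ρ.condKernel y) hf.lintegral_kernel hπ, ← hfst,
      ← Measure.lintegral_compProd (f := fun p : Y × X => f p.2) (hf.comp measurable_snd), hK,
      ← lintegral_map hf measurable_snd, hsnd]
  have hρ : ∀ᵐ q ∂ρ, π q.2 = q.1 ∧ p q.2 := by
    refine Eventually.and ?_ (ae_of_ae_map (f := Prod.snd) measurable_snd.aemeasurable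
      (by rwa [hsnd]))
    exact (ae_map_iff hm.aemeasurable (measurableSet_eq_fun (hπ.comp measurable_snd)
      measurable_fst)).2 (Eventually.of_forall fun u => rfl)
  rw [← hK] at hρ
  replace hρ := Measure.ae_ae_of_ae_compProd hρ
  have hB : ∀ᵐ y ∂ρ.fst, ∫⁻ v, b v ∂ρ.condKernel y < ⊤ := by
    refine ae_lt_top hb.lintegral_kernel ?_
    rw [hfst, lintegral_map hb.lintegral_kernel hπ, hint hb]
    exact hfin.ne
  refine ⟨fun y => ∫⁻ v, a v ∂ρ.condKernel y, fun y => ∫⁻ v, b v ∂ρ.condKernel y,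
    ha.lintegral_kernel, hb.lintegral_kernel, hint ha, hint hb, ?_⟩
  rw [← hfst]
  filter_upwards [hρ, hB] with y hy hBy
  -- If every admissible point of the fibre violated the inequality, integrating the strict
  -- inequality over the conditional law would make the common integral smaller than itself. The
  -- additive form avoids differences of infinite values.
  by_contra hc
  push Not at hc
  have hlt : ∀ᵐ u ∂ρ.condKernel y, (∫⁻ v, a v ∂ρ.condKernel y) + b u <
      a u + ∫⁻ v, b v ∂ρ.condKernel y := hy.mono fun u hu => hc u hu.2 hu.1
  have hAy : ∫⁻ v, a v ∂ρ.condKernel y ≠ ⊤ := by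
    obtain ⟨u, hu⟩ := hlt.exists
    exact fun h => by simp [h] at hu
  have h1 : ∫⁻ u, ((∫⁻ v, a v ∂ρ.condKernel y) + b u) ∂ρ.condKernel y =
      (∫⁻ v, a v ∂ρ.condKernel y) + ∫⁻ v, b v ∂ρ.condKernel y := by
    rw [lintegral_add_left measurable_const, lintegral_const, measure_univ, mul_one]
  have h2 : ∫⁻ u, (a u + ∫⁻ v, b v ∂ρ.condKernel y) ∂ρ.condKernel y =
      (∫⁻ v, a v ∂ρ.condKernel y) + ∫⁻ v, b v ∂ρ.condKernel y := by
    rw [lintegral_add_right _ measurable_const, lintegral_const, measure_univ, mul_one]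
  have h3 := lintegral_strict_mono (IsProbabilityMeasure.ne_zero (ρ.condKernel y))
    (ha.add_const _).aemeasurable (by rw [h1]; exact ENNReal.add_ne_top.2 ⟨hAy, hBy.ne⟩) hlt
  rw [h1, h2] at h3
  exact lt_irrefl _ h3

/-! ### Choosing a martingale measure from the augmented state -/

section Disintegration

variable {d : ℕ} {F : Type*} [TopologicalSpace F] [PolishSpace F] [MeasurableSpace F] [BorelSpace F]
  {P : Kernel (State d F) (PathSpace (State d F))} [IsMarkovKernel P] {x : State d F}
  {G : PathSpace (State d F × ℝ≥0) → EReal}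
  {τ W : PathSpace (State d F) → ℝ≥0}
  {hτ : IsStoppingTime (hullFiltration (State d F)) fun ω => (τ ω : WithTop ℝ≥0)}
  {D : PathSpace (State d F) → ℝ≥0∞}

/-- The conditional expectation of a shift-invariant functional given the past. -/
def futureValue (P : Kernel (State d F) (PathSpace (State d F)))
    (G : PathSpace (State d F × ℝ≥0) → EReal) (D : PathSpace (State d F) → ℝ≥0∞) (z : ℝ≥0)
    (φ : EReal → ℝ≥0∞) (u : Past d F) : ℝ≥0∞ :=
  ∫⁻ ω', φ (terminal G ω' (z * (D (Past.paste (u, ω'))).toNNReal)) ∂P u.pos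

theorem measurable_terminal_paste (hG : Measurable G) (hD : Measurable D) (z : ℝ≥0)
    {φ : EReal → ℝ≥0∞} (hφ : Measurable φ) :
    Measurable fun p : Past d F × PathSpace (State d F) =>
      φ (terminal G p.2 (z * (D (Past.paste p)).toNNReal)) :=
  hφ.comp ((measurable_terminal hG).comp
    (measurable_snd.prodMk ((hD.comp measurable_paste).ennreal_toNNReal.const_mul z)))

theorem measurable_futureValue (hG : Measurable G) (hD : Measurable D) (z : ℝ≥0)
    {φ : EReal → ℝ≥0∞} (hφ : Measurable φ) : Measurable (futureValue P G D z φ) :=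
  (measurable_terminal_paste hG hD z hφ).lintegral_kernel_prod_right'
    (κ := P.comap _ measurable_pos)

/-- The tower property: `terminal G` ignores shifts, so evaluating it on the future loses nothing.
-/
theorem lintegral_futureValue (hP : IsStrongMarkovFamily P) (hC : ∃ C : ℝ≥0, ∀ ω, τ ω ≤ C)
    (hW : Measurable[hτ.measurableSpace] W) (hG : Measurable G)
    (hs : ∀ t ω, G (shift t ω) = G ω) (hD : Measurable D) (z : ℝ≥0) {φ : EReal → ℝ≥0∞}
    (hφ : Measurable φ) :
    ∫⁻ u, futureValue P G D z φ u ∂((P x).map (pastOf τ W)) =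
      ∫⁻ ω, φ (terminal G ω (z * (D ω).toNNReal)) ∂(P x) := by
  have hU := measurable_pastOf hτ hW
  have hUm := measurable_of_stoppingTime hτ hU
  have h := lintegral_shift hP x hτ hC hU measurable_pos (pos_pastOf τ W)
    (measurable_terminal_paste hG hD z hφ)
  simp only [paste_pastOf, terminal_shift hs] at h
  rw [h, lintegral_map (measurable_futureValue hG hD z hφ) hUm]
  simp only [futureValue, pos_pastOf]

/-- The weight carried by the augmented state cancels the normalisation of the future law, so
restarting from that state reproduces the original terminal weight. -/
theorem futureValue_eq_lintegral_rnDeriv (hD : Measurable D) (z : ℝ≥0) (φ : EReal → ℝ≥0∞)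
    {u : Past d F} (hu : u.2.2 ≠ 0) :
    ∫⁻ ω, φ (terminal G ω ((augmentedPos z u).2 *
      ((futureLaw P D u).rnDeriv (P u.pos) ω).toNNReal)) ∂P u.pos = futureValue P G D z φ u := by
  refine lintegral_congr_ae ?_
  filter_upwards [Measure.rnDeriv_withDensity (P u.pos) (measurable_futureLaw_density hD u)] with ω hω
  rw [futureLaw, hω, ENNReal.toNNReal_mul, ENNReal.toNNReal_inv, ENNReal.toNNReal_coe, augmentedPos,
    ← mul_assoc, mul_assoc z, mul_inv_cancel₀ hu, mul_one]

/-- A selector whose values are at most the conditional expectations given the augmented state. -/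
theorem exists_selector_le (hP : IsStrongMarkovFamily P) (hT : FiniteHorizon P) (hN : NFLVR P)
    {a : ℕ → ℝ} (ha : LowerBounds P a) (hC : ∃ C : ℝ≥0, ∀ ω, τ ω ≤ C)
    (hW : Measurable[hτ.measurableSpace] W) (hG : Measurable G)
    (hs : ∀ t ω, G (shift t ω) = G ω) (hD : Measurable D)
    (hQ : (P x).withDensity D ∈ martingaleMeasures P x)
    (hWD : ∀ A, MeasurableSet[hτ.measurableSpace] A →
      ∫⁻ ω in A, W ω ∂(P x) = (P x).withDensity D A) (z : ℝ≥0) {φ ψ : EReal → ℝ≥0∞}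
    (hφ : Measurable φ) (hψ : Measurable ψ)
    (hfin : ∫⁻ ω, ψ (terminal G ω (z * (D ω).toNNReal)) ∂(P x) < ⊤) :
    ∃ ν ∈ Selectors (augmentedFamily P), ∃ A B : State d F × ℝ≥0 → ℝ≥0∞, Measurable A ∧
      Measurable B ∧
      ∫⁻ ω, A (coord (τ ω) ω, z * W ω) ∂(P x) =
        ∫⁻ ω, φ (terminal G ω (z * (D ω).toNNReal)) ∂(P x) ∧
      ∫⁻ ω, B (coord (τ ω) ω, z * W ω) ∂(P x) =
        ∫⁻ ω, ψ (terminal G ω (z * (D ω).toNNReal)) ∂(P x) ∧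
      ∀ᵐ ω ∂(P x), ∫⁻ ω', φ (G ω') ∂ν (coord (τ ω) ω, z * W ω) + B (coord (τ ω) ω, z * W ω) ≤
        A (coord (τ ω) ω, z * W ω) + ∫⁻ ω', ψ (G ω') ∂ν (coord (τ ω) ω, z * W ω) := by
  have hU := measurable_pastOf hτ hW
  have hUm := measurable_of_stoppingTime hτ hU
  have hπ := measurable_augmentedPos (d := d) (F := F) z
  have : IsProbabilityMeasure ((P x).map (pastOf τ W)) :=
    Measure.isProbabilityMeasure_map hUm.aemeasurable
  obtain ⟨ω₀⟩ := (P x).nonempty_of_neZero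
  have : Nonempty (PathSpace (State d F)) := ⟨ω₀⟩
  obtain ⟨κ, hκ, hκs⟩ := exists_kernel_parametrization (PathSpace (State d F))
  have hφG : Measurable fun ω => φ (G ω) := hφ.comp hG
  have hψG : Measurable fun ω => ψ (G ω) := hψ.comp hG
  obtain ⟨A, B, hA, hB, hAint, hBint, hAB⟩ := exists_fiber_le ((P x).map (pastOf τ W)) hπ
    (measurable_futureValue (P := P) hG hD z hφ) (measurable_futureValue (P := P) hG hD z hψ)
    (by rwa [lintegral_futureValue hP hC hW hG hs hD z hψ])
    (ae_futureLaw_mem hP ha hC hW hD hQ hWD)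
  rw [lintegral_futureValue hP hC hW hG hs hD z hφ,
    lintegral_map (f := fun u => A (augmentedPos z u)) (hA.comp hπ) hUm] at hAint
  rw [lintegral_futureValue hP hC hW hG hs hD z hψ,
    lintegral_map (f := fun u => B (augmentedPos z u)) (hB.comp hπ) hUm] at hBint
  simp only [augmentedPos_pastOf] at hAint hBint
  obtain ⟨N, hN1, hN2, hN3⟩ := exists_measurable_superset_of_null (ae_iff.1 hAB)
  set V := augmentedKernel P κ
  have hVint : ∀ {f : EReal → ℝ≥0∞}, Measurable f → ∀ {y : State d F × ℝ≥0} {c : ℚ → ℝ},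
      κ c ≪ P y.1 → ∫⁻ ω, f (G ω) ∂V (y, c) =
        ∫⁻ ω, f (terminal G ω (y.2 * ((κ c).rnDeriv (P y.1) ω).toNNReal)) ∂P y.1 :=
    fun {f} hf {y c} h => by
      rw [augmentedKernel_apply]
      exact (isDensityProcess_augmentedKernel κ (p := (y, c)) h).lintegral_augment hP hT hG hs y.2 hf
  -- The inequality is imposed off the null set `N` only; there a past from the fibre lemma supplies
  -- a parameter, on `N` absence of arbitrage does, so every section is non-empty.
  set S : Set ((State d F × ℝ≥0) × (ℚ → ℝ)) :=
    {p | (κ.comap _ measurable_snd) p ∈ martingaleMeasures P p.1.1} ∩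
      ((Prod.fst ⁻¹' N) ∪ {p | ∫⁻ ω, φ (G ω) ∂V p + B p.1 ≤ A p.1 + ∫⁻ ω, ψ (G ω) ∂V p})
  have hS : MeasurableSet S :=
    (measurableSet_martingaleMeasures hP ha _ measurable_fst.fst).inter
      ((measurable_fst hN2).union (measurableSet_le
        (hφG.lintegral_kernel.add (hB.comp measurable_fst))
        ((hA.comp measurable_fst).add hψG.lintegral_kernel)))
  have hex : ∀ y, ∃ c, (y, c) ∈ S := fun y => by
    by_cases hy : y ∈ N
    · obtain ⟨Q', hQ'⟩ := hN y.1
      obtain ⟨c, hc⟩ := hκs Q' hQ'.1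
      refine ⟨c, ?_, Or.inl hy⟩
      rw [mem_ofPred_eq, Kernel.comap_apply, hc]
      exact hQ'
    · have hy' : ∃ u : Past d F, (u.2.2 ≠ 0 ∧ futureLaw P D u ∈ martingaleMeasures P u.pos) ∧
          augmentedPos z u = y ∧ futureValue P G D z φ u + B y ≤ A y + futureValue P G D z ψ u := by
        by_contra hc
        exact hy (hN1 hc)
      obtain ⟨u, ⟨hu0, hu⟩, rfl, hle⟩ := hy'
      obtain ⟨c, hc⟩ := hκs _ hu.1
      have hcu : κ c ≪ P (augmentedPos z u).1 := by rw [hc]; exact hu.2.1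
      refine ⟨c, ?_, Or.inr ?_⟩
      · rw [mem_ofPred_eq, Kernel.comap_apply, hc]
        exact hu
      · rw [mem_ofPred_eq, hVint hφ hcu, hVint hψ hcu, hc]
        change ∫⁻ ω, φ (terminal G ω ((augmentedPos z u).2 *
          ((futureLaw P D u).rnDeriv (P u.pos) ω).toNNReal)) ∂P u.pos + _ ≤ _ +
          ∫⁻ ω, ψ (terminal G ω ((augmentedPos z u).2 *
          ((futureLaw P D u).rnDeriv (P u.pos) ω).toNNReal)) ∂P u.pos
        rw [futureValue_eq_lintegral_rnDeriv hD z φ hu0, futureValue_eq_lintegral_rnDeriv hD z ψ hu0]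
        exact hle
  obtain ⟨s, hsu, hsS⟩ := exists_universallyMeasurable_selector hS hex
  refine ⟨fun y => V (y, s y), ⟨fun y => ?_, fun M hM m hm => ?_⟩, A, B, hA, hB, hAint, hBint, ?_⟩
  · refine ⟨κ (s y), (hsS y).1, _, isDensityProcess_augmentedKernel κ (p := (y, s y))
      (hsS y).1.2.1, augmentedKernel_apply κ (y, s y)⟩
  · have h1 : AEMeasurable (fun y => (y, s y)) m :=
      aemeasurable_id.prodMk (hsu m hm).aemeasurable
    exact ((V.measurable_coe hM).comp_aemeasurable h1).nullMeasurable
  · have h1 : ∀ᵐ y ∂(((P x).map (pastOf τ W)).map (augmentedPos z)), y ∉ N :=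
      measure_eq_zero_iff_ae_notMem.1 hN3
    filter_upwards [ae_of_ae_map hUm.aemeasurable (ae_of_ae_map hπ.aemeasurable h1)] with ω hω
    rw [augmentedPos_pastOf] at hω
    exact (hsS (coord (τ ω) ω, z * W ω)).2.resolve_left hω

end Disintegration

theorem sub_le_sub_of_add_le_add {p q r s : ℝ≥0∞} (h : p + s ≤ r + q) (hq : q < ⊤) (hs : s < ⊤) :
    (p : EReal) - q ≤ (r : EReal) - s := by
  lift q to ℝ≥0 using hq.ne
  lift s to ℝ≥0 using hs.ne
  induction r with
  | top => simp [EReal.coe_nnreal_eq_coe_real]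
  | coe r =>
    have hp : p ≠ ⊤ := fun hp => by
      subst hp
      simp only [top_add] at h
      exact absurd (top_le_iff.1 h) (by simp)
    lift p to ℝ≥0 using hp
    have h' : (p : ℝ) + s ≤ r + q := by exact_mod_cast h
    simp only [EReal.coe_nnreal_eq_coe_real]
    rw [← EReal.coe_sub, ← EReal.coe_sub, EReal.coe_le_coe_iff]
    linarith

/-! ### Disintegrability -/

section Main

variable {d : ℕ} {F : Type*} [TopologicalSpace F] [PolishSpace F] [MeasurableSpace F] [BorelSpace F]
  {P : Kernel (State d F) (PathSpace (State d F))} [IsMarkovKernel P]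
  {G : PathSpace (State d F × ℝ≥0) → EReal}

theorem isTail_augmentedFamily (hP : IsStrongMarkovFamily P) (hT : FiniteHorizon P) {a : ℕ → ℝ}
    (ha : LowerBounds P a) (hG : Measurable G)
    (hlsi : ∀ y, ∀ μ ∈ augmentedFamily P y, NegPartIntegrable μ G)
    (hs : ∀ t ω, G (shift t ω) = G ω) :
    IsTail (augmentedFamily P) (boundedStoppingTimes (State d F × ℝ≥0)) G where
  measurable := hG
  lowerSemiIntegrable := hlsi
  tail y μ hμ ν hν τ hτ := by
    have := isProbabilityMeasure_of_mem_augmentedFamily hμ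
    exact expect_concatLaw hτ (fun y => isProbabilityMeasure_of_mem_augmentedFamily (hν.1 y)) hν.2
      hG hs (lintegral_selector_lt_top hP hT ha hG hs (φ := fun e => (-e).toENNReal)
        (continuous_neg.measurable.ereal_toENNReal) hlsi hμ hν hτ)

/-- The pointwise inequality of `exists_selector_le` is integrated, positive and negative parts
being kept on opposite sides; both negative parts are finite, the concatenated one by the tail
property, so they can be subtracted. -/
theorem exists_selector_expect_le (hP : IsStrongMarkovFamily P) (hT : FiniteHorizon P)
    (hN : NFLVR P) {a : ℕ → ℝ} (ha : LowerBounds P a) (hG : Measurable G)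
    (hlsi : ∀ y, ∀ μ ∈ augmentedFamily P y, NegPartIntegrable μ G)
    (hs : ∀ t ω, G (shift t ω) = G ω) {y : State d F × ℝ≥0}
    {μ : Measure (PathSpace (State d F × ℝ≥0))} (hμ : μ ∈ augmentedFamily P y)
    {τ : PathSpace (State d F × ℝ≥0) → WithTop ℝ≥0}
    (hτ : τ ∈ boundedStoppingTimes (State d F × ℝ≥0)) :
    ∃ ν ∈ Selectors (augmentedFamily P), expect (concatLaw μ τ ν) G ≤ expect μ G := by
  have hφ : Measurable EReal.toENNReal := measurable_id.ereal_toENNReal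
  have hψ : Measurable fun e : EReal => (-e).toENNReal := continuous_neg.measurable.ereal_toENNReal
  have hμ' := hμ
  have hμp := isProbabilityMeasure_of_mem_augmentedFamily hμ
  obtain ⟨Q, hQ, Z, hZ, hμZ⟩ := hμ'
  have := hQ.1
  obtain ⟨τ', hτ', hC, W, hW, hWQ, hpos⟩ := hZ.exists_stoppingTime hQ.2.1 y.2 hτ
  have hQD := Measure.withDensity_rnDeriv_eq Q (P y.1) hQ.2.1
  have hint : ∀ {f : EReal → ℝ≥0∞}, Measurable f → ∫⁻ ω, f (G ω) ∂μ =
      ∫⁻ ω, f (terminal G ω (y.2 * (Q.rnDeriv (P y.1) ω).toNNReal)) ∂(P y.1) := fun hf => by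
    rw [hμZ, hZ.lintegral_augment hP hT hG hs _ hf]
  have hfin := hlsi y μ hμ
  rw [NegPartIntegrable, hint hψ] at hfin
  obtain ⟨ν, hν, A, B, hA, hB, hAint, hBint, hle⟩ := exists_selector_le hP hT hN ha hC hW hG hs
    (Measure.measurable_rnDeriv Q (P y.1)) (by rwa [hQD])
    (fun M hM => by rw [hQD]; exact hWQ M hM) y.2 hφ hψ hfin
  have hνp := fun y => isProbabilityMeasure_of_mem_augmentedFamily (hν.1 y)
  have hτm : Measurable τ' := measurable_of_stoppingTime hτ' (measurable_stoppingTime_nnreal hτ')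
  have hpm : Measurable fun ω : PathSpace (State d F) => (coord (τ' ω) ω, y.2 * W ω) :=
    (measurable_coord_comp hτm measurable_id).prodMk
      ((measurable_of_stoppingTime hτ' hW).const_mul _)
  have hνint : ∀ {f : EReal → ℝ≥0∞}, Measurable f → ∫⁻ ω, f (G ω) ∂(concatLaw μ τ ν) =
      ∫⁻ ω, ∫⁻ ω', f (G ω') ∂ν (coord (τ' ω) ω, y.2 * W ω) ∂(P y.1) := fun {f} hf => by
    obtain ⟨h1, h2⟩ := lintegral_concatLaw (μ := μ) hτ hνp hν.2 (f := fun ω => f (G ω))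
      (hf.comp hG) fun t ω => by rw [hs]
    rw [h2]
    rw [hμZ] at h1 ⊢
    rw [lintegral_map' (f := fun ω => ∫⁻ ω', f (G ω') ∂ν (positionAt τ ω)) h1
      (hZ.measurable_augment y.2).aemeasurable]
    exact lintegral_congr_ae (hpos.mono fun ω hω => by simp only [hω.2])
  refine ⟨ν, hν, ?_⟩
  have htail := ((isTail_augmentedFamily hP hT ha hG hlsi hs).tail y μ hμ ν hν τ hτ).1
  refine sub_le_sub_of_add_le_add ?_ htail (hlsi y μ hμ)
  have hA' : Measurable fun ω : PathSpace (State d F) => A (coord (τ' ω) ω, y.2 * W ω) := hA.comp hpm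
  have hB' : Measurable fun ω : PathSpace (State d F) => B (coord (τ' ω) ω, y.2 * W ω) := hB.comp hpm
  rw [hνint hφ, hνint hψ, hint hφ, hint hψ, ← hAint, ← hBint, ← lintegral_add_right _ hB',
    ← lintegral_add_left hA']
  exact lintegral_mono_ae hle

end Main

end DPP

end

theorem mainTheorem10 (d : ℕ) (F : Type*) [TopologicalSpace F] [T2Space F] [LocallyCompactSpace F]
    [SecondCountableTopology F] [MeasurableSpace F] [BorelSpace F]
    (P : ProbabilityTheory.Kernel (DPP.State d F) (DPP.PathSpace (DPP.State d F)))
    [ProbabilityTheory.IsMarkovKernel P]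
    (hMarkov : DPP.IsStrongMarkovFamily P) (hHorizon : DPP.FiniteHorizon P)
    (hNFLVR : DPP.NFLVR P) (hBdd : DPP.UniformlyLocallyBoundedBelow P)
    (G : DPP.PathSpace (DPP.State d F × ℝ≥0) → EReal) (hG : Measurable G)
    (hlsi : ∀ y, ∀ μ ∈ DPP.augmentedFamily P y, DPP.NegPartIntegrable μ G)
    (hshift : ∀ (t : ℝ≥0) (ω : DPP.PathSpace (DPP.State d F × ℝ≥0)), G (DPP.shift t ω) = G ω) :
    DPP.IsDisintegrable (DPP.augmentedFamily P)
      (DPP.boundedStoppingTimes (DPP.State d F × ℝ≥0)) G := by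
  have := DPP.polishSpace_of_locallyCompact F
  obtain ⟨a, ha⟩ := hBdd.exists_lowerBounds
  exact ⟨DPP.isTail_augmentedFamily hMarkov hHorizon ha hG hlsi hshift, fun y μ hμ τ hτ =>
    DPP.exists_selector_expect_le hMarkov hHorizon hNFLVR ha hG hlsi hshift hμ hτ⟩
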